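/- Let $K$ be a field of characteristic $0$, let $G$ be a finite group and let $V$ be a finite-dimensional representation of $G$ over $K$. Suppose: (i) There is an irreducible representation $\rho$ of $G$ over $K$ and an integer $m \ge 0$ such that $V \cong \rho^m$ if $\rho \cong \rho^*$, and $V \cong \rho^m \oplus (\rho^*)^m$ if $\rho \not\cong \rho^*$. (ii) $\bigwedge^\bullet V$ and $(\bigwedge^\bullet V)^G$ both have depth $n$ (a graded algebra $R$ has depth $n$ if it is supported in degrees $0,\dots,2n$ and $R_{2n}\neq 0$), and there is an $a \in (\bigwedge^2 V)^G$ which has the hard Lefschetz property on both, i.e. for $R = \bigwedge^\bullet V$ and for $R = (\bigwedge^\bullet V)^G$ the map $a^k \colon R_{n-k} \to R_{n+k}$ is an isomorphism for all $k \ge 0$. Let $\mathfrak{g}$ be the LLV algebra of $R = (\bigwedge^\bullet V)^G$: the Lie subalgebra of $\mathfrak{gl}_K(R)$ generated by all triples $(e_a, h, f_a)$, for $a \in R_2$ with the hard Lefschetz property on $R$, where $e_a$ is multiplication by $a$, $h$ is multiplication by $i-n$ on $R_i$, and $f_a$ is the unique operator of degree $-2$ with $[e_a,f_a]=h$, $[h,e_a]=2e_a$,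 $[h,f_a]=-2f_a$. Let $A$ be the factor of $K[G]$ associated to $\{\rho,\rho^*\}$, i.e. the product of those simple factors of $K[G]$ that act nontrivially on $\rho$ or $\rho^*$. Let $\widetilde V = V \oplus V^*$, on which $A$ acts through $K[G]$ (with the dual representation on $V^*$), equipped with the symmetric bilinear form $b((v,\eta),(v',\eta'))=\eta(v')+\eta'(v)$. Let $\widetilde A = \mathrm{End}_A(\widetilde V)$, let $\widetilde\sigma$ be the involution of $\widetilde A$ adjoint to $b$, and let $F = Z(\widetilde A)$ be the centre of $\widetilde A$. Let $\deg \widetilde A$ be the integer $d$ with $\widetilde A$ of rank $d^2$ over $F$ (if $\widetilde A$ is a product of two simple algebras, this is the common degree of the two factors). The involution $\widetilde\sigma$ is called orthogonal if it is the identity on $F$ and becomes adjoint to a nondegenerate symmetric bilinear form over a splitting field of $\widetilde A$. Let $\mathfrak{s}(\widetilde A,\widetilde\sigma)$ be the derived Lie algebra of $\mathrm{Skew}(\widetilde A,\widetilde\sigma)=\{x \in \widetilde A : \widetilde\sigma(x)=-x\}$. Then, as Lie algebras over $K$: - if it is not the case that $\deg\widetilde A=4$ and $\widetilde\sigma$ is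 orthogonal, then $\mathfrak{g} \cong \mathfrak{s}(\widetilde A,\widetilde\sigma)$; - if $\deg\widetilde A=4$ and $\widetilde\sigma$ is orthogonal, then $\mathfrak{g} \cong \mathfrak{sl}_2(F)$. -/

import Mathlib

open scoped TensorProduct

attribute [local instance 100] LieRing.ofAssociativeRing

noncomputable section

namespace LLV

section Lefschetz

variable {K M : Type*} [Field K] [AddCommGroup M] [Module K M]

/-- `e` is homogeneous of degree `d` for the `ℤ`-grading `ℳ` of `M`. -/
def HasDegree (ℳ : ℤ → Submodule K M) (e : Module.End K M) (d : ℤ) : Prop :=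
  ∀ k : ℤ, ∀ x ∈ ℳ k, e x ∈ ℳ (k + d)

/-- The hard Lefschetz property: `e` has degree `2` and `e ^ k : M_{-k} → M_k` is an isomorphism
for all natural numbers `k`. -/
structure HardLefschetz (ℳ : ℤ → Submodule K M) (e : Module.End K M) : Prop where
  degree : HasDegree ℳ e 2
  bijOn : ∀ k : ℕ, Set.BijOn (e ^ k : Module.End K M) (ℳ (-k : ℤ)) (ℳ (k : ℤ))

/-- `h` is the grading operator, i.e. multiplication by `k` on `M_k`. It is determined by this
when `M` is the direct sum of the `M_k`. -/
def IsGradingOperator (ℳ : ℤ → Submodule K M) (h : Module.End K M) : Prop :=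
  ∀ k : ℤ, ∀ x ∈ ℳ k, h x = (k : K) • x

/-- `(e, h, f)` is the triple attached to an operator `e` with the hard Lefschetz property:
`h` is the grading operator, `f` has degree `-2`, and the relations of the standard generators of
`sl₂` hold. -/
structure IsLefschetzTriple (ℳ : ℤ → Submodule K M) (e h f : Module.End K M) : Prop where
  hardLefschetz : HardLefschetz ℳ e
  grading : IsGradingOperator ℳ h
  degree : HasDegree ℳ f (-2)
  lie_h_e : ⁅h, e⁆ = (2 : K) • e
  lie_h_f : ⁅h, f⁆ = -((2 : K) • f)
  lie_e_f : ⁅e, f⁆ = h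

/-- The LLV algebra of `(𝔞, M)`: the Lie subalgebra of `𝔤𝔩(M)` generated by all triples
`(e_a, h, f_a)`, for those `a` for which `e_a` has the hard Lefschetz property. -/
def llv {𝔞 : Type*} [AddCommGroup 𝔞] [Module K 𝔞] (ℳ : ℤ → Submodule K M)
    (e : 𝔞 →ₗ[K] Module.End K M) : LieSubalgebra K (Module.End K M) :=
  LieSubalgebra.lieSpan K (Module.End K M)
    {x | ∃ (a : 𝔞) (h f : Module.End K M), IsLefschetzTriple ℳ (e a) h f ∧
      (x = e a ∨ x = h ∨ x = f)}

end Lefschetz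

section GradedAlgebras

variable {K R : Type*} [Field K] [Ring R] [Algebra K R]

/-- The grading of `R[n]`, i.e. `R[n]_k = R_{n+k}`, for an algebra graded in degrees `≥ 0`. -/
def shift (𝒜 : ℕ → Submodule K R) (n : ℕ) (k : ℤ) : Submodule K R :=
  if 0 ≤ (n : ℤ) + k then 𝒜 ((n : ℤ) + k).toNat else ⊥

/-- `R` has depth `n`: it is supported in degrees `0, …, 2n` and `R_{2n} ≠ 0`. -/
def HasDepth (𝒜 : ℕ → Submodule K R) (n : ℕ) : Prop :=
  (∀ i, 2 * n < i → 𝒜 i = ⊥) ∧ 𝒜 (2 * n) ≠ ⊥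

/-- The action of `R_2` on `R` by multiplication. -/
def mulAction (𝒜 : ℕ → Submodule K R) : 𝒜 2 →ₗ[K] Module.End K R :=
  (LinearMap.mul K R).domRestrict (𝒜 2)

/-- The LLV algebra of a graded commutative algebra `R` of depth `n`, i.e. of `(R_2, R[n])`. -/
def llvAlgebra (𝒜 : ℕ → Submodule K R) (n : ℕ) : LieSubalgebra K (Module.End K R) :=
  llv (shift 𝒜 n) (mulAction 𝒜)

end GradedAlgebras

section Exterior

variable {K G V : Type*} [Field K] [Group G] [AddCommGroup V] [Module K V]

/-- The grading of the exterior algebra `⋀^• V`. -/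
def extGrading (K V : Type*) [Field K] [AddCommGroup V] [Module K V] :
    ℕ → Submodule K (ExteriorAlgebra K V) := fun i => ⋀[K]^i V

/-- The invariant subalgebra `(⋀^• V)^G`. -/
def extInvariants (ρ : Representation K G V) : Subalgebra K (ExteriorAlgebra K V) where
  carrier := {x | ∀ g : G, ExteriorAlgebra.map (ρ g) x = x}
  mul_mem' hx hy g := by rw [map_mul, hx g, hy g]
  add_mem' hx hy g := by rw [map_add, hx g, hy g]
  algebraMap_mem' r g := by rw [AlgHom.commutes]

/-- The grading of `(⋀^• V)^G` induced by that of `⋀^• V`. -/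
def extInvariantsGrading (ρ : Representation K G V) : ℕ → Submodule K (extInvariants ρ) :=
  fun i => (extGrading K V i).comap (extInvariants ρ).val.toLinearMap

end Exterior

section Involutions

/-- A `K`-linear involution (anti-automorphism of order at most two) on a `K`-algebra `A`. -/
structure AlgInvolution (K A : Type*) [Field K] [Ring A] [Algebra K A] extends A →ₗ[K] A where
  map_mul_rev' : ∀ x y : A, toFun (x * y) = toFun y * toFun x
  apply_apply' : ∀ x : A, toFun (toFun x) = x

variable {K A : Type*} [Field K] [Ring A] [Algebra K A]

/-- The Lie algebra of skew elements `{x | σ x = -x}`. -/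
def Skew (σ : AlgInvolution K A) : LieSubalgebra K A where
  carrier := {x | σ.toLinearMap x = -x}
  zero_mem' := by simp
  add_mem' {x y} hx hy := by
    simp only [Set.mem_ofPred_eq] at hx hy ⊢
    rw [map_add, hx, hy, neg_add]
  smul_mem' c x hx := by
    simp only [Set.mem_ofPred_eq] at hx ⊢
    rw [map_smul, hx, smul_neg]
  lie_mem' {x y} hx hy := by
    have hm : ∀ x y : A, σ.toLinearMap (x * y) = σ.toLinearMap y * σ.toLinearMap x :=
      σ.map_mul_rev'
    change σ.toLinearMap x = -x at hx
    change σ.toLinearMap y = -y at hy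
    change σ.toLinearMap ⁅x, y⁆ = -⁅x, y⁆
    rw [Ring.lie_def, map_sub, hm, hm, hx, hy]
    noncomm_ring

/-- `𝔰(A, σ) = Skew(A, σ)'`, the derived Lie algebra of the Lie algebra of skew elements. -/
abbrev derivedSkew (σ : AlgInvolution K A) : LieIdeal K (Skew σ) :=
  ⁅(⊤ : LieIdeal K (Skew σ)), (⊤ : LieIdeal K (Skew σ))⁆

/-- An algebra as an algebra over its centre. -/
instance centerAlgebra (K A : Type*) [Field K] [Ring A] [Algebra K A] :
    Algebra (Subalgebra.center K A) A where
  algebraMap := (Subalgebra.center K A).val.toRingHom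
  commutes' z x := (Subalgebra.mem_center_iff.mp z.2 x).symm
  smul_def' _ _ := rfl

/-- The degree of an algebra: `d` with `dim_Z A = d ^ 2`, for `Z` the centre of `A`. This is the
usual degree of a central simple `Z`-algebra if `A` is simple. If `A = A₁ × A₂` for simple algebras
`A₁` and `A₂` of the same degree `d`, then `A` is free of rank `d ^ 2` over `Z = Z₁ × Z₂`. -/
def degree (K A : Type*) [Field K] [Ring A] [Algebra K A] : ℕ :=
  Nat.sqrt (Module.finrank (Subalgebra.center K A) A)

/-- An involution `σ` on an algebra `A` with centre `Z` is orthogonal if it is of the first kind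
(the identity on `Z`) and, over some field extension `L` of `Z` that splits `A`, it becomes the
adjoint involution `X ↦ S⁻¹ Xᵀ S` of a nondegenerate symmetric bilinear form (with Gram matrix
`S`). -/
def IsOrthogonal.{u, v} {K : Type u} {A : Type v} [Field K] [Ring A] [Algebra K A]
    (σ : AlgInvolution K A) : Prop :=
  (∀ z ∈ Subalgebra.center K A, σ.toLinearMap z = z) ∧
  ∃ (L : Type v) (_ : Field L) (_ : Algebra (Subalgebra.center K A) L) (d : ℕ)
    (φ : (L ⊗[Subalgebra.center K A] A) ≃ₐ[L] Matrix (Fin d) (Fin d) L)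
    (S : Matrix (Fin d) (Fin d) L),
    S.IsSymm ∧ IsUnit S.det ∧
    ∀ a : A, φ (1 ⊗ₜ σ.toLinearMap a) = S⁻¹ * (φ (1 ⊗ₜ a)).transpose * S

/-- `sl₂(F)`, the traceless `2 × 2` matrices over `F`, as a Lie algebra over `K`. -/
def sl2 (K F : Type*) [Field K] [CommRing F] [Algebra K F] :
    LieSubalgebra K (Matrix (Fin 2) (Fin 2) F) where
  carrier := {x | x.trace = 0}
  zero_mem' := by simp
  add_mem' {x y} hx hy := by
    simp only [Set.mem_ofPred_eq] at hx hy ⊢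
    rw [Matrix.trace_add, hx, hy, add_zero]
  smul_mem' c x hx := by
    simp only [Set.mem_ofPred_eq] at hx ⊢
    rw [Matrix.trace_smul, hx, smul_zero]
  lie_mem' {x y} _ _ := by
    change Matrix.trace ⁅x, y⁆ = 0
    rw [Ring.lie_def, Matrix.trace_sub, Matrix.trace_mul_comm, sub_self]

end Involutions

section Representations

variable {K G V W : Type*} [Field K] [Group G]
  [AddCommGroup V] [Module K V] [AddCommGroup W] [Module K W]

/-- `ρ` is isomorphic to its dual. -/
def IsSelfDual (ρ : Representation K G W) : Prop := Nonempty (ρ.Equiv ρ.dual)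

/-- The direct sum `ρ^m` of `m` copies of `ρ`. -/
def power (ρ : Representation K G W) (m : ℕ) :
    Representation K G (DirectSum (Fin m) fun _ => W) :=
  Representation.directSum fun _ : Fin m => ρ

/-- `V ≅ ρ^m` if `ρ` is self-dual, and `V ≅ ρ^m ⊕ (ρ^*)^m` if not. -/
def IsIsotypic (τ : Representation K G V) (ρ : Representation K G W) (m : ℕ) : Prop :=
  (IsSelfDual ρ → Nonempty (τ.Equiv (power ρ m))) ∧
  (¬ IsSelfDual ρ → Nonempty (τ.Equiv ((power ρ m).prod (power ρ.dual m))))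

/-- The factor `A` of `K[G]` associated to `[ρ]`, as a two-sided ideal of `K[G]` (it has its own
unit, a central idempotent of `K[G]`): the product of those simple factors of `K[G]` that act
nontrivially on `ρ` or `ρ^*`, described as the annihilator of the ideal of all elements that act
as zero on both `ρ` and `ρ^*`. -/
def factor (ρ : Representation K G W) : Submodule K (MonoidAlgebra K G) where
  carrier := {x | ∀ y : MonoidAlgebra K G, ρ.asAlgebraHom y = 0 → ρ.dual.asAlgebraHom y = 0 →
    x * y = 0 ∧ y * x = 0}
  zero_mem' := by simp
  add_mem' {x x'} hx hx' y h h' := by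
    rw [add_mul, mul_add, (hx y h h').1, (hx y h h').2, (hx' y h h').1, (hx' y h h').2]
    simp
  smul_mem' c x hx y h h' := by
    rw [smul_mul_assoc, mul_smul_comm, (hx y h h').1, (hx y h h').2]
    simp

/-- The vector space `Ṽ = V ⊕ V^*`. -/
def Tilde (K V : Type*) [Field K] [AddCommGroup V] [Module K V] := V × Module.Dual K V

instance : AddCommGroup (Tilde K V) := inferInstanceAs (AddCommGroup (V × Module.Dual K V))

instance : Module K (Tilde K V) := inferInstanceAs (Module K (V × Module.Dual K V))

instance [FiniteDimensional K V] : FiniteDimensional K (Tilde K V) :=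
  inferInstanceAs (FiniteDimensional K (V × Module.Dual K V))

/-- The projection `Ṽ → V`. -/
def Tilde.fst (K V : Type*) [Field K] [AddCommGroup V] [Module K V] : Tilde K V →ₗ[K] V :=
  LinearMap.fst K V (Module.Dual K V)

/-- The projection `Ṽ → V^*`. -/
def Tilde.snd (K V : Type*) [Field K] [AddCommGroup V] [Module K V] :
    Tilde K V →ₗ[K] Module.Dual K V :=
  LinearMap.snd K V (Module.Dual K V)

/-- The representation `Ṽ = V ⊕ V^*`. -/
def tilde (τ : Representation K G V) : Representation K G (Tilde K V) :=
  τ.prod τ.dual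

/-- `Ã = End_A(Ṽ)`: the endomorphisms of `Ṽ` that commute with the action of the factor `A`
of `K[G]` associated to `[ρ]`. The action of `A` on `V^*` through its involution `g ↦ g⁻¹`,
`(a η)(v) = η(σ(a) v)`, is the restriction to `A` of the action of `K[G]` on the dual. -/
def tildeA (τ : Representation K G V) (ρ : Representation K G W) :
    Subalgebra K (Module.End K (Tilde K V)) :=
  Subalgebra.centralizer K ((fun x => (tilde τ).asAlgebraHom x) '' (factor ρ : Set _))

/-- The symmetric bilinear form `b((v, η), (v', η')) = η(v') + η'(v)` on `Ṽ`. -/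
def tildeForm (K V : Type*) [Field K] [AddCommGroup V] [Module K V] :
    LinearMap.BilinForm K (Tilde K V) :=
  LinearMap.mk₂ K (fun x y => Tilde.snd K V x (Tilde.fst K V y) + Tilde.snd K V y (Tilde.fst K V x))
    (fun x x' y => by simp only [map_add, LinearMap.add_apply]; ring)
    (fun c x y => by simp only [map_smul, LinearMap.smul_apply, smul_add])
    (fun x y y' => by simp only [map_add, LinearMap.add_apply]; ring)
    (fun c x y => by simp only [map_smul, LinearMap.smul_apply, smul_add])

theorem tildeForm_apply (x y : Tilde K V) :
    tildeForm K V x y = Tilde.snd K V x (Tilde.fst K V y) + Tilde.snd K V y (Tilde.fst K V x) :=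
  rfl

theorem tildeForm_symm (x y : Tilde K V) : tildeForm K V x y = tildeForm K V y x := by
  rw [tildeForm_apply, tildeForm_apply, add_comm]

theorem tildeForm_left_ext {x x' : Tilde K V}
    (h : ∀ y, tildeForm K V x y = tildeForm K V x' y) : x = x' := by
  refine Prod.ext ?_ ?_
  · rw [← sub_eq_zero, ← Module.forall_dual_apply_eq_zero_iff K]
    intro η
    rw [map_sub, sub_eq_zero]
    have h0 : Tilde.snd K V x 0 + η x.1 = Tilde.snd K V x' 0 + η x'.1 :=
      h ((0, η) : V × Module.Dual K V)
    simpa only [map_zero, zero_add] using h0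
  · refine LinearMap.ext fun v => ?_
    have h0 : x.2 v + (0 : K) = x'.2 v + (0 : K) := h ((v, 0) : V × Module.Dual K V)
    simpa only [add_zero] using h0

theorem tildeForm_nondegenerate : (tildeForm K V).Nondegenerate := by
  have hl : ∀ x, (∀ y, tildeForm K V x y = 0) → x = 0 := fun x h =>
    tildeForm_left_ext fun y => by rw [h y, map_zero, LinearMap.zero_apply]
  exact ⟨hl, fun y h => hl y fun x => by rw [tildeForm_symm]; exact h x⟩

/-- The involution `σ` of `K[G]` with `σ(g) = g⁻¹`. -/
def groupInv (K G : Type*) [Field K] [Group G] : MonoidAlgebra K G →ₗ[K] MonoidAlgebra K G :=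
  HopfAlgebra.antipode K

@[simp]
theorem groupInv_single (g : G) (c : K) :
    groupInv K G (MonoidAlgebra.single g c) = MonoidAlgebra.single g⁻¹ c := by
  simp [groupInv]

theorem groupInv_groupInv (x : MonoidAlgebra K G) : groupInv K G (groupInv K G x) = x := by
  induction x using MonoidAlgebra.induction_linear with
  | zero => simp
  | add x y hx hy => rw [map_add, map_add, hx, hy]
  | single g c => simp

theorem groupInv_mul (x y : MonoidAlgebra K G) :
    groupInv K G (x * y) = groupInv K G y * groupInv K G x := by
  induction x using MonoidAlgebra.induction_linear with
  | zero => simp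
  | add x x' hx hx' => rw [add_mul, map_add, hx, hx', map_add, mul_add]
  | single g c =>
    induction y using MonoidAlgebra.induction_linear with
    | zero => simp
    | add y y' hy hy' => rw [mul_add, map_add, hy, hy', map_add, add_mul]
    | single h d => simp [MonoidAlgebra.single_mul_single, mul_comm]

/-- The action of `K[G]` on the dual is `(a η)(v) = η(σ(a) v)`. -/
theorem dual_asAlgebraHom (ρ : Representation K G W) (x : MonoidAlgebra K G)
    (η : Module.Dual K W) (w : W) :
    ρ.dual.asAlgebraHom x η w = η (ρ.asAlgebraHom (groupInv K G x) w) := by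
  induction x using MonoidAlgebra.induction_linear with
  | zero => simp
  | add x y hx hy => simp [hx, hy]
  | single g c =>
    rw [groupInv_single, Representation.asAlgebraHom_single, Representation.asAlgebraHom_single,
      LinearMap.smul_apply, LinearMap.smul_apply, LinearMap.smul_apply, map_smul]
    rfl

theorem dual_asAlgebraHom_eq_zero (ρ : Representation K G W) (x : MonoidAlgebra K G) :
    ρ.dual.asAlgebraHom x = 0 ↔ ρ.asAlgebraHom (groupInv K G x) = 0 := by
  constructor
  · intro h
    refine LinearMap.ext fun w => (Module.forall_dual_apply_eq_zero_iff K _).mp fun η => ?_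
    rw [← dual_asAlgebraHom, h]
    rfl
  · intro h
    refine LinearMap.ext fun η => LinearMap.ext fun w => ?_
    rw [dual_asAlgebraHom, h]
    simp

/-- The involution of `K[G]` preserves the factor `A`. -/
theorem groupInv_mem_factor (ρ : Representation K G W) {x : MonoidAlgebra K G}
    (hx : x ∈ factor ρ) : groupInv K G x ∈ factor ρ := by
  intro y h h'
  have hy := hx (groupInv K G y) ((dual_asAlgebraHom_eq_zero ρ y).mp h')
    ((dual_asAlgebraHom_eq_zero ρ _).mpr (by rwa [groupInv_groupInv]))
  have h1 := congrArg (groupInv K G) hy.1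
  have h2 := congrArg (groupInv K G) hy.2
  rw [groupInv_mul, groupInv_groupInv, map_zero] at h1 h2
  exact ⟨h2, h1⟩

theorem fst_tilde (τ : Representation K G V) (x : MonoidAlgebra K G) (v : Tilde K V) :
    Tilde.fst K V ((tilde τ).asAlgebraHom x v) = τ.asAlgebraHom x (Tilde.fst K V v) := by
  induction x using MonoidAlgebra.induction_linear with
  | zero => simp only [map_zero, LinearMap.zero_apply]
  | add x y hx hy => simp only [map_add, LinearMap.add_apply, hx, hy]
  | single g c =>
    simp only [Representation.asAlgebraHom_single, LinearMap.smul_apply, map_smul]; rfl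

theorem snd_tilde (τ : Representation K G V) (x : MonoidAlgebra K G) (v : Tilde K V) :
    Tilde.snd K V ((tilde τ).asAlgebraHom x v) = τ.dual.asAlgebraHom x (Tilde.snd K V v) := by
  induction x using MonoidAlgebra.induction_linear with
  | zero => simp only [map_zero, LinearMap.zero_apply]
  | add x y hx hy => simp only [map_add, LinearMap.add_apply, hx, hy]
  | single g c =>
    simp only [Representation.asAlgebraHom_single, LinearMap.smul_apply, map_smul]; rfl

variable [FiniteDimensional K V]

/-- The adjoint of an endomorphism of `Ṽ` with respect to the form `b`. -/
def adj (f : Module.End K (Tilde K V)) : Module.End K (Tilde K V) :=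
  (tildeForm K V).leftAdjointOfNondegenerate tildeForm_nondegenerate f

theorem adj_left (f : Module.End K (Tilde K V)) (x y : Tilde K V) :
    tildeForm K V (adj f x) y = tildeForm K V x (f y) :=
  LinearMap.BilinForm.isAdjointPairLeftAdjointOfNondegenerate _ _ f x y

theorem eq_adj {f g : Module.End K (Tilde K V)}
    (h : ∀ x y, tildeForm K V (g x) y = tildeForm K V x (f y)) : g = adj f := by
  refine LinearMap.ext fun x => ?_
  exact tildeForm_left_ext fun y => by rw [h, adj_left]

theorem adj_mul (f g : Module.End K (Tilde K V)) : adj (f * g) = adj g * adj f :=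
  (eq_adj fun x y => by rw [Module.End.mul_apply, Module.End.mul_apply, adj_left, adj_left]).symm

theorem adj_adj (f : Module.End K (Tilde K V)) : adj (adj f) = f :=
  (eq_adj fun x y => by rw [tildeForm_symm, ← adj_left, tildeForm_symm]).symm

/-- The form `b` is equivariant: `b(a x, y) = b(x, σ(a) y)`. -/
theorem adj_tilde (τ : Representation K G V) (x : MonoidAlgebra K G) :
    adj ((tilde τ).asAlgebraHom x) = (tilde τ).asAlgebraHom (groupInv K G x) := by
  refine (eq_adj fun u w => ?_).symm
  rw [tildeForm_apply, tildeForm_apply, fst_tilde, fst_tilde, snd_tilde, snd_tilde,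
    dual_asAlgebraHom, dual_asAlgebraHom, groupInv_groupInv]

theorem adj_mem_tildeA (τ : Representation K G V) (ρ : Representation K G W)
    {f : Module.End K (Tilde K V)} (hf : f ∈ tildeA τ ρ) : adj f ∈ tildeA τ ρ := by
  rw [tildeA, Subalgebra.mem_centralizer_iff] at hf ⊢
  rintro _ ⟨x, hx, rfl⟩
  have h := congrArg adj (hf _ ⟨groupInv K G x, groupInv_mem_factor ρ hx, rfl⟩)
  rw [adj_mul, adj_mul, adj_tilde, groupInv_groupInv] at h
  exact h.symm

/-- The involution `σ̃` on `Ã = End_A(Ṽ)`: the adjoint with respect to the form `b`. -/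
def tildeSigma (τ : Representation K G V) (ρ : Representation K G W) :
    AlgInvolution K (tildeA τ ρ) where
  toFun f := ⟨adj f.1, adj_mem_tildeA τ ρ f.2⟩
  map_add' f g := Subtype.ext <| (eq_adj fun x y => by
    simp [adj_left]).symm
  map_smul' c f := Subtype.ext <| (eq_adj fun x y => by
    simp [adj_left]).symm
  map_mul_rev' f g := Subtype.ext (adj_mul f.1 g.1)
  apply_apply' f := Subtype.ext (adj_adj f.1)

end Representations

end LLV
end

/-! Write E = End_G(V). By hard Lefschetz the invariant bivector a satisfies a^n ≠ 0, so it is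
nondegenerate and contraction against it is a skew equivariant isomorphism V* ≅ V (`SkewIso`). This
puts an involution σ (`SkewIso.dagger`) on E, identifies Ṽ with V ⊕ V, and turns (Ã, σ̃) into M₂(E)
with `doubleInvolution σ` (`tildeEquiv`). Its skew elements are the matrices with diagonal x, -σ(x)
and arbitrary symmetric s, t off the diagonal. Let Sym and Skew denote the symmetric and skew
elements of E.

The Clifford algebra of Ṽ acts on ⋀V by wedging and contracting. The resulting spin representation
restricts to an action of Skew(Ã), which commutes with G, on (⋀V)^G. The strictly upper triangular
matrix of s acts as multiplication by an invariant bivector, and every invariant bivector arises so.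
The matrix diag(1, -1) acts as the grading operator, and if st = 1 the strictly lower triangular
matrix of t completes an sl₂-triple. A bivector is therefore hard Lefschetz exactly when s is
invertible, and invertible elements span Sym. Hence 𝔤 is the image of the Lie algebra L generated by
the strictly triangular matrices (`llvAlgebra_eq_map`).

In L the entry x ranges over Sym + [Sym, Sym] (`mem_triangularSpan`), and L is the derived algebra
of Skew(M₂(E)) once [Skew, Skew] ⊆ [Sym, Sym]. Duality for the trace form of V gives this inclusion
if every skew element commuting with Sym is central (`IsTraceForm.commutator_skew_mem`). A skew unit
in the centre ensures that condition; one exists if ρ is not self-dual or if σ moves the centre.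
Otherwise E is zero or prime with an involution of the first kind. In the prime case a violation
makes Sym central (`IsTraceForm.sym_central_of_prime`), so E is a quaternion algebra with its
conjugation, and M₂(E) has degree 4 and an orthogonal involution. Conversely, in degree 4 with σ̃
orthogonal, the trace of σ̃ bounds the dimension of Sym, so that Sym is the centre F and L = sl₂(F).

The spin representation is faithful on L: a kernel element reduces to a diagonal x in [Sym, Sym]
commuting with Sym. Such an x vanishes, either because it is central and trace-orthogonal to the
centre, or because [Sym, Sym] = 0. -/

open scoped TensorProduct

attribute [local instance 100] LieRing.ofAssociativeRing

noncomputable section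

namespace LLV

/-! ### Symmetric and skew elements, and trace forms -/

section InvolutionAlgebra

variable {K E : Type*} [Field K] [Ring E] [Algebra K E] (σ : AlgInvolution K E)

namespace AlgInvolution

theorem map_mul_rev (x y : E) :
    σ.toLinearMap (x * y) = σ.toLinearMap y * σ.toLinearMap x :=
  σ.map_mul_rev' x y

@[simp]
theorem apply_apply (x : E) : σ.toLinearMap (σ.toLinearMap x) = x :=
  σ.apply_apply' x

@[simp]
theorem map_one : σ.toLinearMap 1 = 1 := by
  have h := σ.map_mul_rev (σ.toLinearMap 1) 1
  rwa [mul_one, apply_apply, mul_one, eq_comm] at h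

theorem map_mem_center {z : E} (hz : z ∈ Subalgebra.center K E) :
    σ.toLinearMap z ∈ Subalgebra.center K E := by
  rw [Subalgebra.mem_center_iff] at hz ⊢
  intro b
  have h := congrArg σ.toLinearMap (hz (σ.toLinearMap b))
  rwa [map_mul_rev, map_mul_rev, apply_apply, eq_comm] at h

/-- The subspace of symmetric elements of an algebra with involution. -/
def sym : Submodule K E where
  carrier := {x | σ.toLinearMap x = x}
  zero_mem' := map_zero _
  add_mem' {x y} hx hy := by
    simp only [Set.mem_ofPred_eq] at hx hy ⊢
    rw [map_add, hx, hy]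
  smul_mem' c x hx := by
    simp only [Set.mem_ofPred_eq] at hx ⊢
    rw [map_smul, hx]

variable {σ}

theorem mem_sym {x : E} : x ∈ σ.sym ↔ σ.toLinearMap x = x := Iff.rfl

theorem mem_Skew {x : E} : x ∈ Skew σ ↔ σ.toLinearMap x = -x := Iff.rfl

theorem one_mem_sym : (1 : E) ∈ σ.sym := σ.map_one

theorem add_apply_mem_sym (x : E) : x + σ.toLinearMap x ∈ σ.sym := by
  rw [mem_sym, map_add, apply_apply, add_comm]

theorem sub_apply_mem_Skew (x : E) : x - σ.toLinearMap x ∈ Skew σ := by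
  rw [mem_Skew, map_sub, apply_apply, neg_sub]

theorem commutator_sym_mem_Skew {s t : E} (hs : s ∈ σ.sym) (ht : t ∈ σ.sym) :
    s * t - t * s ∈ Skew σ := by
  rw [mem_sym] at hs ht
  rw [mem_Skew, map_sub, map_mul_rev, map_mul_rev, hs, ht, neg_sub]

theorem commutator_skew_sym_mem_sym {k s : E} (hk : k ∈ Skew σ) (hs : s ∈ σ.sym) :
    k * s - s * k ∈ σ.sym := by
  rw [mem_sym] at hs ⊢
  rw [mem_Skew] at hk
  rw [map_sub, map_mul_rev, map_mul_rev, hs, hk]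
  noncomm_ring

variable [CharZero K]

theorem exists_sym_add_skew (x : E) : ∃ s ∈ σ.sym, ∃ k ∈ Skew σ, x = s + k := by
  refine ⟨(2 : K)⁻¹ • (x + σ.toLinearMap x), Submodule.smul_mem _ _ (add_apply_mem_sym x),
    (2 : K)⁻¹ • (x - σ.toLinearMap x), (Skew σ).smul_mem _ (sub_apply_mem_Skew x), ?_⟩
  rw [← smul_add]
  have : x + σ.toLinearMap x + (x - σ.toLinearMap x) = (2 : K) • x := by
    rw [two_smul]; abel
  rw [this, smul_smul, inv_mul_cancel₀ two_ne_zero, one_smul]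

theorem eq_zero_of_mem_sym_of_mem_Skew {x : E} (hs : x ∈ σ.sym) (hk : x ∈ Skew σ) : x = 0 := by
  rw [mem_sym] at hs
  rw [mem_Skew, hs] at hk
  have : (2 : K) • x = 0 := by
    rw [two_smul]; nth_rewrite 1 [hk]; rw [neg_add_cancel]
  exact (smul_eq_zero.mp this).resolve_left two_ne_zero

end AlgInvolution

open AlgInvolution

/-- The span of the commutators of symmetric elements. -/
def symCommutators : Submodule K E :=
  Submodule.span K {x | ∃ s ∈ σ.sym, ∃ t ∈ σ.sym, x = s * t - t * s}

variable {σ}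

theorem commutator_mem_symCommutators {s t : E} (hs : s ∈ σ.sym) (ht : t ∈ σ.sym) :
    s * t - t * s ∈ symCommutators σ :=
  Submodule.subset_span ⟨s, hs, t, ht, rfl⟩

theorem symCommutators_le_Skew : symCommutators σ ≤ (Skew σ).toSubmodule := by
  refine Submodule.span_le.mpr ?_
  rintro _ ⟨s, hs, t, ht, rfl⟩
  exact commutator_sym_mem_Skew hs ht

/-- A linear form `t` with the properties of the trace of a faithful representation of a
semisimple algebra with involution. -/
structure IsTraceForm (σ : AlgInvolution K E) (t : E →ₗ[K] K) : Prop where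
  comm : ∀ x y, t (x * y) = t (y * x)
  map_involution : ∀ x, t (σ.toLinearMap x) = t x
  eq_zero : ∀ x, (∀ y, t (x * y) = 0) → x = 0
  nilpotent : ∀ x, IsNilpotent x → t x = 0
  idempotent : ∀ x, IsIdempotentElem x → t x = 0 → x = 0

namespace IsTraceForm

variable {t : E →ₗ[K] K} (ht : IsTraceForm σ t)
include ht

/-- Invariance of the form (x, y) ↦ t (x y). It turns orthogonality to commutators into statements
about commuting. -/
theorem apply_commutator (x y z : E) : t ((x * y - y * x) * z) = t (x * (y * z - z * y)) := by
  rw [sub_mul, mul_sub, map_sub, map_sub, mul_assoc y, ht.comm y, mul_assoc, mul_assoc]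

/-- A central element that is orthogonal to the centre vanishes. -/
theorem eq_zero_of_center [FiniteDimensional K E] {x : E} (hx : x ∈ Subalgebra.center K E)
    (h : ∀ y ∈ Subalgebra.center K E, t (x * y) = 0) : x = 0 := by
  let Z := Subalgebra.center K E
  have : IsArtinianRing Z := IsArtinianRing.of_finite K Z
  -- The powers of X stabilise in the Artinian centre, which gives an idempotent e = X^(n+1) y^(n+1)
  -- with X^(n+1) = X^(n+1) e. As e is a multiple of x by a central element, its trace is zero, so e
  -- = 0 and x is nilpotent. Then all x z are nilpotent, because x is central.
  obtain ⟨n, y, hy⟩ := IsArtinian.exists_pow_succ_smul_dvd (⟨x, hx⟩ : Z) (1 : Z)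
  simp only [smul_eq_mul, mul_one] at hy
  set X : Z := ⟨x, hx⟩ with hX
  have hpow : ∀ m, X ^ n = X ^ (n + m) * y ^ m := by
    intro m
    induction m with
    | zero => simp
    | succ m ih =>
      calc X ^ n = X ^ (n + m) * y ^ m := ih
        _ = X ^ (n + 1) * y * X ^ m * y ^ m := by rw [hy, pow_add]
        _ = _ := by ring
  have h1 : X ^ (n + 1) = X ^ (n + 1) * (X ^ (n + 1) * y ^ (n + 1)) := by
    calc X ^ (n + 1) = X ^ n * X := pow_succ _ _
      _ = X ^ (n + (n + 1)) * y ^ (n + 1) * X := by rw [← hpow]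
      _ = _ := by ring
  set e : Z := X ^ (n + 1) * y ^ (n + 1) with he
  have hee : IsIdempotentElem e := by
    change e * e = e
    calc e * e = (X ^ (n + 1) * e) * y ^ (n + 1) := by rw [he]; ring
      _ = e := by rw [← h1]
  have he0 : (e : E) = 0 := by
    refine ht.idempotent _ (congrArg Subtype.val hee) ?_
    have : (e : E) = x * ((X ^ n * y ^ (n + 1) : Z) : E) := by
      have : e = X * (X ^ n * y ^ (n + 1)) := by rw [he]; ring
      rw [this]; rfl
    rw [this]
    exact h _ (Subtype.prop _)
  have hx0 : x ^ (n + 1) = 0 := by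
    have h2 : e = 0 := Subtype.ext he0
    rw [h2, mul_zero] at h1
    exact congrArg Subtype.val h1
  refine ht.eq_zero x fun z => ht.nilpotent _ ⟨n + 1, ?_⟩
  have hc : Commute x z := (Subalgebra.mem_center_iff.mp hx z).symm
  rw [hc.mul_pow, hx0, zero_mul]

variable [CharZero K]

/-- The involution preserves t and sends s k to -k s, whose trace is -t (s k). -/
theorem apply_sym_mul_skew {s k : E} (hs : s ∈ σ.sym) (hk : k ∈ Skew σ) : t (s * k) = 0 := by
  have h := ht.map_involution (s * k)
  rw [mem_sym] at hs
  rw [mem_Skew] at hk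
  rw [map_mul_rev, hs, hk, neg_mul, map_neg, ht.comm k s] at h
  exact self_eq_neg.mp h.symm

theorem eq_zero_of_sym {s : E} (hs : s ∈ σ.sym) (h : ∀ u ∈ σ.sym, t (s * u) = 0) : s = 0 := by
  refine ht.eq_zero s fun y => ?_
  obtain ⟨u, hu, k, hk, rfl⟩ := exists_sym_add_skew (σ := σ) y
  rw [mul_add, map_add, h u hu, ht.apply_sym_mul_skew hs hk, add_zero]

/-- If the skew elements that commute with all symmetric elements are central, then commutators
of skew elements are sums of commutators of symmetric elements. -/
theorem commutator_skew_mem [FiniteDimensional K E]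
    (hC : ∀ k ∈ Skew σ, (∀ s ∈ σ.sym, k * s = s * k) → ∀ x, k * x = x * k)
    {k l : E} (hk : k ∈ Skew σ) (hl : l ∈ Skew σ) : k * l - l * k ∈ symCommutators σ := by
  let B : LinearMap.BilinForm K E := (LinearMap.mul K E).compr₂ t
  have hB : ∀ x y, B x y = t (x * y) := fun _ _ => rfl
  have hsymm : B.IsSymm := ⟨fun x y => by simpa [hB] using ht.comm x y⟩
  have hnd : B.Nondegenerate := by
    have hl : ∀ x, (∀ y, B x y = 0) → x = 0 := fun x hx => ht.eq_zero x hx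
    exact ⟨hl, fun y hy => hl y fun x => by rw [← hy x, hB, hB, ht.comm]⟩
  -- By double orthogonality it suffices to pair [k, l] with any y orthogonal to [Sym, Sym]. The
  -- symmetric part of y is orthogonal to skew elements. The skew part c satisfies t ([c, u] v) = t
  -- (c [u, v]) = 0, so it commutes with Sym, hence is central, and t (c [k, l]) = t ([c, k] l) = 0.
  have horth := LinearMap.BilinForm.orthogonal_orthogonal hnd hsymm.isRefl (symCommutators σ)
  rw [← horth, LinearMap.BilinForm.mem_orthogonal_iff]
  intro y hy
  rw [LinearMap.BilinForm.mem_orthogonal_iff] at hy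
  rw [hB]
  obtain ⟨s, hs, c, hc, rfl⟩ := exists_sym_add_skew (σ := σ) y
  have hcs : ∀ u ∈ σ.sym, c * u = u * c := by
    intro u hu
    rw [← sub_eq_zero]
    refine ht.eq_zero_of_sym (commutator_skew_sym_mem_sym hc hu) fun v hv => ?_
    rw [ht.apply_commutator]
    have h1 := hy _ (commutator_mem_symCommutators hu hv)
    rw [hB, ht.comm, add_mul, map_add,
      ht.apply_sym_mul_skew hs (commutator_sym_mem_Skew hu hv), zero_add] at h1
    exact h1
  have hcc := hC c hc hcs
  have hkl : k * l - l * k ∈ Skew σ := (Skew σ).lie_mem hk hl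
  rw [add_mul, map_add, ht.apply_sym_mul_skew hs hkl, zero_add, ← ht.apply_commutator, hcc k,
    sub_self, zero_mul, map_zero]

/-- In a prime algebra with involution, the existence of a noncentral skew element that commutes
with all symmetric elements forces the symmetric elements to be central. -/
theorem sym_central_of_prime (hprime : ∀ x y : E, (∀ z, x * z * y = 0) → x = 0 ∨ y = 0)
    {k : E} (hks : ∀ s ∈ σ.sym, k * s = s * k) {x₀ : E}
    (hx₀ : k * x₀ ≠ x₀ * k) {s : E} (hs : s ∈ σ.sym) (x : E) : s * x = x * s := by
  -- Commute k with the symmetric elements x + σ(x), s and s x + σ(x) s. The first gives [k, σ(x)] =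
  -- -[k, x], and the last then says that [k, x] commutes with s.
  have h1 : ∀ s ∈ σ.sym, ∀ x, s * (k * x - x * k) = (k * x - x * k) * s := by
    intro s hs x
    have hmem : s * x + σ.toLinearMap x * s ∈ σ.sym := by
      have := add_apply_mem_sym (σ := σ) (s * x)
      rwa [map_mul_rev, mem_sym.mp hs] at this
    have ha := hks _ hmem
    have hb := hks _ (add_apply_mem_sym (σ := σ) x)
    have hc := hks s hs
    have hb' : k * σ.toLinearMap x - σ.toLinearMap x * k = -(k * x - x * k) := by
      rw [mul_add, add_mul] at hb
      rw [eq_neg_iff_add_eq_zero, ← sub_eq_zero.mpr hb]; abel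
    have e1 : k * (s * x + σ.toLinearMap x * s) - (s * x + σ.toLinearMap x * s) * k
        = s * (k * x - x * k) + (k * σ.toLinearMap x - σ.toLinearMap x * k) * s
          + (k * s - s * k) * x + σ.toLinearMap x * (k * s - s * k) := by noncomm_ring
    rw [ha, hc, sub_self, sub_self, hb', zero_mul, mul_zero, add_zero, add_zero,
      neg_mul] at e1
    exact (add_neg_eq_zero.mp e1.symm)
  -- Replace x by s x in `h1` for u: as [k, s x] = s [k, x], this reads u s [k, x] = s u [k, x].
  have h2 : ∀ s ∈ σ.sym, ∀ u ∈ σ.sym, ∀ x, (u * s - s * u) * (k * x - x * k) = 0 := by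
    intro s hs u hu x
    have ha := h1 u hu (s * x)
    have e : k * (s * x) - s * x * k = s * (k * x - x * k) := by
      rw [← mul_assoc, hks s hs]; noncomm_ring
    rw [e] at ha
    rw [sub_mul, mul_assoc, ha, mul_assoc, mul_assoc, h1 u hu, sub_self]
  have hcomm : ∀ s ∈ σ.sym, ∀ u ∈ σ.sym, u * s = s * u := by
    intro s hs u hu
    rw [← sub_eq_zero]
    -- Since [k, ·] is a derivation, y [k, x₀] = [k, y x₀] - [k, y] x₀, so `h2` gives [u, s] y [k,
    -- x₀] = 0 for all y.
    refine (hprime _ (k * x₀ - x₀ * k) fun y => ?_).resolve_right (sub_ne_zero.mpr hx₀)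
    have e : (u * s - s * u) * y * (k * x₀ - x₀ * k)
        = (u * s - s * u) * (k * (y * x₀) - y * x₀ * k)
          - (u * s - s * u) * (k * y - y * k) * x₀ := by noncomm_ring
    rw [e, h2 s hs u hu, h2 s hs u hu, zero_mul, sub_zero]
  obtain ⟨u, hu, l, hl, rfl⟩ := exists_sym_add_skew (σ := σ) x
  rw [mul_add, add_mul, hcomm u hu s hs]
  congr 1
  symm
  rw [← sub_eq_zero]
  refine ht.eq_zero_of_sym (commutator_skew_sym_mem_sym hl hs) fun v hv => ?_
  rw [ht.apply_commutator, hcomm v hv s hs, sub_self, mul_zero, map_zero]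

end IsTraceForm

/-- Multiplication by a central skew unit exchanges symmetric and skew elements. So k commutes with
z l for every skew l, and z can be cancelled. -/
theorem skew_central_of_unit [CharZero K] {z w : E} (hz : z ∈ Subalgebra.center K E)
    (hzs : z ∈ Skew σ) (hzw : z * w = 1) {k : E} (hks : ∀ s ∈ σ.sym, k * s = s * k) (x : E) :
    k * x = x * k := by
  have hzc : ∀ b, b * z = z * b := Subalgebra.mem_center_iff.mp hz
  obtain ⟨u, hu, l, hl, rfl⟩ := exists_sym_add_skew (σ := σ) x
  have hzl : z * l ∈ σ.sym := by
    rw [mem_Skew] at hl hzs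
    rw [mem_sym, map_mul_rev, hl, hzs, neg_mul_neg, hzc]
  have h := hks _ hzl
  have hl' : k * l = l * k := by
    have e1 : z * (k * l) = z * (l * k) := by
      rw [← mul_assoc, ← hzc k, mul_assoc, h, mul_assoc]
    have hwz : w * z = 1 := by rw [hzc, hzw]
    calc k * l = w * z * (k * l) := by rw [hwz, one_mul]
      _ = l * k := by rw [mul_assoc, e1, ← mul_assoc, hwz, one_mul]
  rw [mul_add, add_mul, hks u hu, hl']

end InvolutionAlgebra

/-! ### Recognition of quaternion algebras -/

section Quaternion

open AlgInvolution

variable {F E : Type*} [Field F] [CharZero F] [Ring E] [Algebra F E] {σ : AlgInvolution F E}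

/-- A Gram–Schmidt step: u l + l u is symmetric, hence a scalar b, and anticommuting plays the role
of orthogonality. The coefficient is b / (2a). -/
theorem exists_anticomm_sub_smul (hS : ∀ x ∈ σ.sym, ∃ c : F, x = c • (1 : E)) {u l : E}
    (hu : u ∈ Skew σ) (hl : l ∈ Skew σ) {a : F} (ha : a ≠ 0) (hua : u * u = a • (1 : E)) :
    ∃ c : F, l - c • u ∈ Skew σ ∧ u * (l - c • u) = -((l - c • u) * u) := by
  have hmem : u * l + l * u ∈ σ.sym := by
    rw [mem_Skew] at hu hl
    rw [mem_sym, map_add, map_mul_rev, map_mul_rev, hu, hl, neg_mul_neg, neg_mul_neg, add_comm]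
  obtain ⟨b, hb⟩ := hS _ hmem
  refine ⟨b / (2 * a), (Skew σ).sub_mem hl ((Skew σ).smul_mem _ hu), ?_⟩
  have h2 : (b / (2 * a) * a + b / (2 * a) * a) = b := by field_simp; ring
  rw [eq_neg_iff_add_eq_zero, mul_sub, sub_mul, mul_smul_comm, smul_mul_assoc, hua,
    smul_smul]
  have : u * l - (b / (2 * a) * a) • (1 : E) + (l * u - (b / (2 * a) * a) • (1 : E))
      = (u * l + l * u) - (b / (2 * a) * a + b / (2 * a) * a) • (1 : E) := by
    rw [add_smul]; abel
  rw [this, h2, hb, sub_self]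

theorem exists_skew_decomposition (hS : ∀ x ∈ σ.sym, ∃ c : F, x = c • (1 : E)) (x : E) :
    ∃ c : F, ∃ l ∈ Skew σ, x = c • (1 : E) + l := by
  obtain ⟨s, hs, l, hl, rfl⟩ := exists_sym_add_skew (σ := σ) x
  obtain ⟨c, rfl⟩ := hS s hs
  exact ⟨c, l, hl, rfl⟩

omit [CharZero F] in
theorem sq_scalar (hS : ∀ x ∈ σ.sym, ∃ c : F, x = c • (1 : E)) {u : E} (hu : u ∈ Skew σ) :
    ∃ c : F, u * u = c • (1 : E) := by
  refine hS _ ?_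
  rw [mem_Skew] at hu
  rw [mem_sym, map_mul_rev, hu, neg_mul_neg]

theorem anticomm_of_sq_zero {u l : E} (hu : u * u = 0) (hl : l * l = 0)
    (h : (u + l) * (u + l) = 0) : u * l = -(l * u) := by
  rw [eq_neg_iff_add_eq_zero, ← h, mul_add, add_mul, add_mul, hu, hl]; abel

/-- A noncommutative prime algebra with an involution whose symmetric elements are the scalars is
a quaternion algebra with its canonical involution. -/
theorem exists_quaternion_generators (hS : ∀ x ∈ σ.sym, ∃ c : F, x = c • (1 : E))
    (hprime : ∀ x y : E, (∀ z, x * z * y = 0) → x = 0 ∨ y = 0)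
    (hnc : ∃ x y : E, x * y ≠ y * x) :
    ∃ (i j : E) (a b : F), a ≠ 0 ∧ b ≠ 0 ∧ i * i = a • (1 : E) ∧ j * j = b • (1 : E) ∧
      i * j = -(j * i) ∧ i ∈ Skew σ ∧ j ∈ Skew σ ∧
      ∀ x : E, ∃ p q r s : F, x = p • (1 : E) + q • i + r • j + s • (i * j) := by
  have hsq : ∀ u ∈ Skew σ, (∀ c : F, c ≠ 0 → u * u ≠ c • (1 : E)) → u * u = 0 := by
    intro u hu h
    obtain ⟨c, hc⟩ := sq_scalar hS hu
    by_cases hc0 : c = 0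
    · rw [hc, hc0, zero_smul]
    · exact absurd hc (h c hc0)
  obtain ⟨i, hi, a, ha, hia⟩ : ∃ i ∈ Skew σ, ∃ a : F, a ≠ 0 ∧ i * i = a • (1 : E) := by
    by_contra! hcon
    -- If all skew squares vanish, polarisation makes skew elements anticommute, so u z u = 0 for
    -- every z and primeness kills u. Then E consists of scalars.
    have h0 : ∀ u ∈ Skew σ, u = 0 := by
      intro u hu
      refine (or_self_iff.mp (hprime u u fun z => ?_))
      obtain ⟨c, l, hl, rfl⟩ := exists_skew_decomposition hS z
      have huu := hsq u hu (hcon u hu)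
      have hul := (Skew σ).add_mem hu hl
      rw [mul_add, add_mul, mul_smul_comm, mul_one, smul_mul_assoc, huu, smul_zero, zero_add,
        anticomm_of_sq_zero huu (hsq l hl (hcon l hl)) (hsq _ hul (hcon _ hul)), neg_mul,
        mul_assoc, huu, mul_zero, neg_zero]
    obtain ⟨x, y, hxy⟩ := hnc
    obtain ⟨c, l, hl, rfl⟩ := exists_skew_decomposition hS x
    rw [h0 l hl, add_zero, smul_mul_assoc, mul_smul_comm, one_mul, mul_one] at hxy
    exact hxy rfl
  obtain ⟨j, hj, b, hb, hjb, hij⟩ : ∃ j ∈ Skew σ, ∃ b : F, b ≠ 0 ∧ j * j = b • (1 : E) ∧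
      i * j = -(j * i) := by
    by_contra! hcon
    have hcon' : ∀ l ∈ Skew σ, i * l = -(l * i) → l * l = 0 := fun l hl hil =>
      hsq l hl fun c hc h => hcon l hl c hc h hil
    -- The same argument among the skew elements anticommuting with i. The component of z along i
    -- does no harm, since l i l = -i l l = 0. If no such l survives, E = F + F i is commutative.
    have h0 : ∀ l ∈ Skew σ, i * l = -(l * i) → l = 0 := by
      intro l hl hil
      refine (or_self_iff.mp (hprime l l fun z => ?_))
      obtain ⟨c, m, hm, rfl⟩ := exists_skew_decomposition hS z
      obtain ⟨d, hd, hdi⟩ := exists_anticomm_sub_smul hS hi hm ha hia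
      set m' := m - d • i with hm'
      have hmm : m = m' + d • i := by rw [hm']; abel
      have hll := hcon' l hl hil
      have hlm : l * m' = -(m' * l) := by
        refine anticomm_of_sq_zero hll (hcon' m' hd hdi) (hcon' _ ((Skew σ).add_mem hl hd) ?_)
        rw [mul_add, add_mul, hil, hdi, neg_add]
      have hli : l * i = -(i * l) := by rw [hil, neg_neg]
      rw [hmm, mul_add, mul_add, add_mul, add_mul, mul_smul_comm, mul_one, smul_mul_assoc, hll,
        hlm, neg_mul, mul_assoc, hll, mul_smul_comm, smul_mul_assoc, hli, neg_mul, mul_assoc, hll]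
      simp
    obtain ⟨x, y, hxy⟩ := hnc
    have hform : ∀ x : E, ∃ c d : F, x = c • (1 : E) + d • i := by
      intro x
      obtain ⟨c, l, hl, rfl⟩ := exists_skew_decomposition hS x
      obtain ⟨d, hd, hdi⟩ := exists_anticomm_sub_smul hS hi hl ha hia
      refine ⟨c, d, ?_⟩
      rw [sub_eq_zero.mp (h0 _ hd hdi)]
    obtain ⟨c, d, rfl⟩ := hform x
    obtain ⟨c', d', rfl⟩ := hform y
    refine hxy ?_
    simp only [mul_add, add_mul, smul_mul_assoc, mul_smul_comm, one_mul, mul_one, smul_add]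
    rw [smul_comm c, smul_comm d, smul_comm c, smul_comm d]
    abel
  refine ⟨i, j, a, b, ha, hb, hia, hjb, hij, hi, hj, fun x => ?_⟩
  have hji : j * i = -(i * j) := by rw [hij, neg_neg]
  have hk : i * j ∈ Skew σ := by
    rw [mem_Skew] at hi hj ⊢
    rw [map_mul_rev, hi, hj, neg_mul_neg, hji]
  have hkk : (i * j) * (i * j) = (-(a * b)) • (1 : E) := by
    calc i * j * (i * j) = i * (j * i) * j := by noncomm_ring
      _ = -((i * i) * (j * j)) := by rw [hji]; noncomm_ring
      _ = _ := by rw [hia, hjb, smul_mul_smul_comm, one_mul, neg_smul]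
  have hab : -(a * b) ≠ 0 := neg_ne_zero.mpr (mul_ne_zero ha hb)
  obtain ⟨p, l, hl, rfl⟩ := exists_skew_decomposition hS x
  -- After subtracting the components along i, j and i j, the remainder anticommutes with i j. It
  -- also commutes with i j, because m anticommutes with both i and j. As i j is invertible, the
  -- remainder is zero.
  obtain ⟨q, hl1, hq⟩ := exists_anticomm_sub_smul hS hi hl ha hia
  obtain ⟨r, hl2, hr⟩ := exists_anticomm_sub_smul hS hj hl1 hb hjb
  obtain ⟨s, hl3, hs⟩ := exists_anticomm_sub_smul hS hk hl2 hab hkk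
  refine ⟨p, q, r, s, ?_⟩
  have hq2 : i * (l - q • i - r • j) = -((l - q • i - r • j) * i) := by
    rw [mul_sub, sub_mul, hq, mul_smul_comm, smul_mul_assoc, hij, smul_neg, neg_sub]
    abel
  set m := l - q • i - r • j with hm
  have hcomm : (i * j) * m = m * (i * j) := by
    rw [mul_assoc, hr, mul_neg, ← mul_assoc, hq2, neg_mul, neg_neg, mul_assoc]
  have hzero : m - s • (i * j) = 0 := by
    have h1 : (i * j) * (m - s • (i * j)) = (m - s • (i * j)) * (i * j) := by
      rw [mul_sub, sub_mul, hcomm, mul_smul_comm, smul_mul_assoc]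
    have h2 : (2 : F) • ((i * j) * (m - s • (i * j))) = 0 := by
      rw [two_smul]
      nth_rewrite 1 [hs]
      rw [h1, neg_add_cancel]
    have h3 := (smul_eq_zero.mp h2).resolve_left two_ne_zero
    have h4 : (i * j) * ((i * j) * (m - s • (i * j))) = 0 := by rw [h3, mul_zero]
    rw [← mul_assoc, hkk, smul_mul_assoc, one_mul] at h4
    exact (smul_eq_zero.mp h4).resolve_left hab
  have h5 : l = q • i + r • j + s • (i * j) := by
    rw [sub_eq_zero] at hzero
    rw [← hzero, hm]; abel
  nth_rewrite 1 [h5]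
  abel

/-- Such an algebra is isomorphic to one of Mathlib's quaternion algebras, compatibly with the
conjugation. -/
theorem exists_equiv_quaternionAlgebra (hS : ∀ x ∈ σ.sym, ∃ c : F, x = c • (1 : E))
    (hprime : ∀ x y : E, (∀ z, x * z * y = 0) → x = 0 ∨ y = 0)
    (hnc : ∃ x y : E, x * y ≠ y * x) :
    ∃ (a b : F), a ≠ 0 ∧ b ≠ 0 ∧ ∃ ψ : QuaternionAlgebra F a 0 b ≃ₐ[F] E,
      ∀ x, σ.toLinearMap (ψ x) = ψ (star x) := by
  obtain ⟨i, j, a, b, ha, hb, hi, hj, hij, his, hjs, hspan⟩ :=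
    exists_quaternion_generators hS hprime hnc
  have hji : j * i = -(i * j) := by rw [hij, neg_neg]
  have : Nontrivial E := by
    obtain ⟨x, y, hxy⟩ := hnc
    exact ⟨_, _, hxy⟩
  let q : QuaternionAlgebra.Basis E a 0 b :=
    { i := i, j := j, k := i * j, i_mul_i := by rw [hi]; simp, j_mul_j := hj, i_mul_j := rfl,
      j_mul_i := by rw [hji]; simp }
  have hq : ∀ x, q.liftHom x = x.re • (1 : E) + x.imI • i + x.imJ • j + x.imK • (i * j) := by
    intro x
    change q.lift x = _
    rw [QuaternionAlgebra.Basis.lift, Algebra.algebraMap_eq_smul_one]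
  have hkey : ∀ p r : F, p • (1 : E) + r • i = 0 → p • (1 : E) - r • i = 0 → p = 0 ∧ r = 0 := by
    intro p r h1 h2
    have hp : (2 * p) • (1 : E) = 0 := by
      rw [mul_smul, two_smul]
      have : p • (1 : E) + p • (1 : E) = (p • (1 : E) + r • i) + (p • (1 : E) - r • i) := by abel
      rw [this, h1, h2, add_zero]
    have hp0 : p = 0 := by
      rcases smul_eq_zero.mp hp with h | h
      · exact (mul_eq_zero.mp h).resolve_left two_ne_zero
      · exact absurd h one_ne_zero
    refine ⟨hp0, ?_⟩
    rw [hp0, zero_smul, zero_add] at h1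
    refine (smul_eq_zero.mp h1).resolve_right fun hi0 => ?_
    rw [hi0, mul_zero] at hi
    exact (smul_ne_zero ha one_ne_zero) hi.symm
  have hinj : Function.Injective q.liftHom := by
    rw [injective_iff_map_eq_zero]
    intro x hx
    rw [hq] at hx
    obtain ⟨p, r, s, t⟩ := x
    simp only at hx
    -- Commuting or anticommuting with i separates F + F i from F j + F i j. Moving j across p + r i
    -- then changes the sign of r, which separates the last two coefficients.
    have hA : ∀ X Y : E, X + Y = 0 → (i * X = X * i) → i * Y = -(Y * i) → X = 0 ∧ Y = 0 := by
      intro X Y h1 h2 h3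
      have h4 : i * (X + Y) + (X + Y) * i = 0 := by rw [h1]; simp
      have h5 : (2 : F) • (X * i) = 0 := by
        rw [← h4, mul_add, add_mul, h2, h3, two_smul]; abel
      have h6 : X * i = 0 := (smul_eq_zero.mp h5).resolve_left two_ne_zero
      have h7 : X * (i * i) = 0 := by rw [← mul_assoc, h6, zero_mul]
      rw [hi, mul_smul_comm, mul_one] at h7
      have h8 := (smul_eq_zero.mp h7).resolve_left ha
      exact ⟨h8, by rwa [h8, zero_add] at h1⟩
    obtain ⟨h1, h2⟩ := hA (p • 1 + r • i) (s • j + t • (i * j)) (by rw [← hx]; abel)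
      (by simp only [mul_add, add_mul, mul_smul_comm, smul_mul_assoc, mul_one, one_mul])
      (by
        rw [mul_add, add_mul, mul_smul_comm, mul_smul_comm, smul_mul_assoc, smul_mul_assoc,
          mul_assoc i j i, hji, mul_neg]
        simp [add_comm])
    have h3 : (p • (1 : E) + r • i) = 0 ∧ p • (1 : E) - r • i = 0 := by
      refine ⟨h1, ?_⟩
      have h4 : j * (p • (1 : E) + r • i) = (p • (1 : E) - r • i) * j := by
        rw [mul_add, mul_smul_comm, mul_smul_comm, hji, sub_mul, smul_mul_assoc, smul_mul_assoc,
          mul_one, one_mul, smul_neg, sub_eq_add_neg]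
      rw [h1, mul_zero] at h4
      have h5 := congrArg (· * j) h4
      simp only [zero_mul] at h5
      rw [mul_assoc, hj, mul_smul_comm, mul_one] at h5
      exact (smul_eq_zero.mp h5.symm).resolve_left hb
    have h6 : s • (1 : E) + t • i = 0 := by
      have h7 : (s • (1 : E) + t • i) * j = 0 := by
        rw [← h2, add_mul, smul_mul_assoc, smul_mul_assoc, one_mul]
      have h5 := congrArg (· * j) h7
      simp only [zero_mul] at h5
      rw [mul_assoc, hj, mul_smul_comm, mul_one] at h5
      exact (smul_eq_zero.mp h5).resolve_left hb
    have h8 : s • (1 : E) - t • i = 0 := by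
      have h4 : j * (s • (1 : E) + t • i) = (s • (1 : E) - t • i) * j := by
        rw [mul_add, mul_smul_comm, mul_smul_comm, hji, sub_mul, smul_mul_assoc, smul_mul_assoc,
          mul_one, one_mul, smul_neg, sub_eq_add_neg]
      rw [h6, mul_zero] at h4
      have h5 := congrArg (· * j) h4
      simp only [zero_mul] at h5
      rw [mul_assoc, hj, mul_smul_comm, mul_one] at h5
      exact (smul_eq_zero.mp h5.symm).resolve_left hb
    obtain ⟨rfl, rfl⟩ := hkey _ _ h3.1 h3.2
    obtain ⟨rfl, rfl⟩ := hkey _ _ h6 h8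
    rfl
  have hsurj : Function.Surjective q.liftHom := by
    intro x
    obtain ⟨p, r, s, t, rfl⟩ := hspan x
    exact ⟨⟨p, r, s, t⟩, hq _⟩
  have hbij : Function.Bijective q.liftHom := ⟨hinj, hsurj⟩
  refine ⟨a, b, ha, hb, AlgEquiv.ofBijective q.liftHom hbij, fun x => ?_⟩
  rw [mem_Skew] at his hjs
  change σ.toLinearMap (q.liftHom x) = q.liftHom (star x)
  rw [hq, hq]
  simp only [map_add, map_smul, map_mul_rev, his, hjs, AlgInvolution.map_one, neg_mul_neg, hji,
    QuaternionAlgebra.re_star, QuaternionAlgebra.imI_star, QuaternionAlgebra.imJ_star,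
    QuaternionAlgebra.imK_star, zero_mul, add_zero, smul_neg, neg_smul]

end Quaternion

/-! ### The doubled involution and its splitting in degree four -/

section Doubling

open AlgInvolution Matrix

/-- The involution of `M₂(E)` that is adjoint to the hyperbolic skew-hermitian form over
`(E, σ)`. -/
def doubleInvolution {K E : Type*} [Field K] [Ring E] [Algebra K E] (σ : AlgInvolution K E) :
    AlgInvolution K (Matrix (Fin 2) (Fin 2) E) where
  toFun X := !![σ.toLinearMap (X 1 1), -σ.toLinearMap (X 0 1);
    -σ.toLinearMap (X 1 0), σ.toLinearMap (X 0 0)]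
  map_add' X Y := by
    ext i j
    fin_cases i <;> fin_cases j <;> simp [add_comm]
  map_smul' c X := by
    ext i j
    fin_cases i <;> fin_cases j <;> simp
  map_mul_rev' X Y := by
    ext i j
    fin_cases i <;> fin_cases j <;> simp [Matrix.mul_apply, Fin.sum_univ_two, map_mul_rev, add_comm]
  apply_apply' X := by
    ext i j
    fin_cases i <;> fin_cases j <;> simp

theorem doubleInvolution_apply {K E : Type*} [Field K] [Ring E] [Algebra K E]
    (σ : AlgInvolution K E) (X : Matrix (Fin 2) (Fin 2) E) :
    (doubleInvolution σ).toLinearMap X = !![σ.toLinearMap (X 1 1), -σ.toLinearMap (X 0 1);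
    -σ.toLinearMap (X 1 0), σ.toLinearMap (X 0 0)] := rfl

variable {F B E : Type*} [Field F] [CharZero F] [Ring B] [Algebra F B]
  [Ring E] [Algebra F E] {σ : AlgInvolution F E}

/-- With r² = a, the generator i goes to diag(r, -r) and j to the antidiagonal matrix with entries
b, 1. Spanning over L gives surjectivity after base change, and the adjugate formula keeps track of
the conjugation. -/
theorem exists_split_quaternionAlgebra {F : Type*} (L : Type*) [Field F] [CharZero F] [Field L]
    [Algebra F L] [IsAlgClosed L] {a b : F} (ha : a ≠ 0) (hb : b ≠ 0) :
    ∃ π : QuaternionAlgebra F a 0 b →ₐ[F] Matrix (Fin 2) (Fin 2) L,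
      (∀ x, π (star x) = (π x).adjugate) ∧
      ∀ Y : Matrix (Fin 2) (Fin 2) L, ∃ (l : Fin 4 → L)
        (x : Fin 4 → QuaternionAlgebra F a 0 b), Y = ∑ m, l m • π (x m) := by
  have : CharZero L := charZero_of_injective_algebraMap (algebraMap F L).injective
  obtain ⟨r, hr⟩ := IsAlgClosed.exists_pow_nat_eq (algebraMap F L a) (n := 2) (by norm_num)
  have hr0 : r ≠ 0 := by
    rintro rfl
    rw [zero_pow two_ne_zero, eq_comm, FaithfulSMul.algebraMap_eq_zero_iff] at hr
    exact ha hr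
  obtain ⟨b', hb'⟩ : ∃ b', b' = algebraMap F L b := ⟨_, rfl⟩
  have hb0 : b' ≠ 0 := by
    rw [hb', Ne, FaithfulSMul.algebraMap_eq_zero_iff]
    exact hb
  have hr2 : r * r = algebraMap F L a := by rw [← hr, sq]
  let q : QuaternionAlgebra.Basis (Matrix (Fin 2) (Fin 2) L) a 0 b :=
    { i := !![r, 0; 0, -r], j := !![0, b'; 1, 0], k := !![0, r * b'; -r, 0]
      i_mul_i := by
        ext i j
        fin_cases i <;> fin_cases j <;> simp [Algebra.smul_def, Matrix.algebraMap_matrix_apply, hr2]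
      j_mul_j := by
        ext i j
        fin_cases i <;> fin_cases j <;> simp [Algebra.smul_def, hb']
      i_mul_j := by
        ext i j
        fin_cases i <;> fin_cases j <;> simp
      j_mul_i := by
        ext i j
        fin_cases i <;> fin_cases j <;> simp [mul_comm] }
  have hq : ∀ x, q.liftHom x = !![algebraMap F L x.re + algebraMap F L x.imI * r,
      algebraMap F L x.imJ * b' + algebraMap F L x.imK * (r * b');
      algebraMap F L x.imJ - algebraMap F L x.imK * r,
      algebraMap F L x.re - algebraMap F L x.imI * r] := by
    intro x
    change algebraMap F _ x.re + x.imI • !![r, 0; 0, -r] + x.imJ • !![0, b'; 1, 0]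
      + x.imK • !![0, r * b'; -r, 0] = _
    ext i j
    fin_cases i <;> fin_cases j <;>
      simp [Algebra.smul_def, Matrix.algebraMap_matrix_apply, Matrix.mul_apply, sub_eq_add_neg]
  refine ⟨q.liftHom, fun x => ?_, fun Y => ?_⟩
  · rw [hq, hq, Matrix.adjugate_fin_two]
    ext i j
    fin_cases i <;> fin_cases j <;> simp [sub_eq_add_neg, add_comm]
  -- The coefficients of Y with respect to the images of 1, i, j, k.
  · refine ⟨![(Y 0 0 + Y 1 1) / 2, (Y 0 0 - Y 1 1) / (2 * r), (Y 0 1 / b' + Y 1 0) / 2,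
      (Y 0 1 / b' - Y 1 0) / (2 * r)], ![⟨1, 0, 0, 0⟩, ⟨0, 1, 0, 0⟩, ⟨0, 0, 1, 0⟩, ⟨0, 0, 0, 1⟩],
      ?_⟩
    simp only [Fin.sum_univ_four, hq]
    ext i j
    fin_cases i <;> fin_cases j <;> simp <;> field_simp <;> ring

/-- The standard symmetric Gram matrix of `w ⊗ w`, for `w` the standard symplectic form on the
plane. -/
def symplecticSquare (L : Type*) [Field L] : Matrix (Fin 2 × Fin 2) (Fin 2 × Fin 2) L :=
  comp (Fin 2) (Fin 2) (Fin 2) (Fin 2) L !![0, !![0, 1; -1, 0]; -!![0, 1; -1, 0], 0]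

theorem symplecticSquare_mul_self (L : Type*) [Field L] :
    symplecticSquare L * symplecticSquare L = 1 := by
  ext ⟨i, k⟩ ⟨j, l⟩
  fin_cases i <;> fin_cases k <;> fin_cases j <;> fin_cases l <;>
    simp [symplecticSquare, Matrix.mul_apply, Fintype.sum_prod_type, Fin.sum_univ_two]

theorem symplecticSquare_isSymm (L : Type*) [Field L] : (symplecticSquare L).IsSymm := by
  ext ⟨i, k⟩ ⟨j, l⟩
  fin_cases i <;> fin_cases k <;> fin_cases j <;> fin_cases l <;> simp [symplecticSquare]

/-- The adjugate is the adjoint for the alternating form w on the plane, and the outer 2 × 2 pattern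
has the same shape. Together they give the adjoint for w ⊗ w, which is symmetric as a product of two
alternating forms. -/
theorem symplecticSquare_adjoint {L : Type*} [Field L]
    (X Y : Matrix (Fin 2) (Fin 2) (Matrix (Fin 2) (Fin 2) L))
    (hY : Y = !![(X 1 1).adjugate, -(X 0 1).adjugate; -(X 1 0).adjugate, (X 0 0).adjugate]) :
    comp _ _ _ _ L Y = symplecticSquare L * (comp _ _ _ _ L X).transpose * symplecticSquare L := by
  subst hY
  ext ⟨i, k⟩ ⟨j, l⟩
  fin_cases i <;> fin_cases k <;> fin_cases j <;> fin_cases l <;>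
    simp [symplecticSquare, Matrix.mul_apply, Fintype.sum_prod_type, Fin.sum_univ_two,
      Matrix.adjugate_fin_two]

/-- If the symmetric elements of `E` are the scalars, then `M₂(E)` has degree `4` and an orthogonal
involution. -/
theorem exists_split_orthogonal (L : Type*) [Field L] [Algebra F L] [IsAlgClosed L]
    (ψ : B ≃ₐ[F] Matrix (Fin 2) (Fin 2) E) (τ : B → B)
    (hτ : ∀ x, ψ (τ x) = (doubleInvolution σ).toLinearMap (ψ x))
    (hS : ∀ x ∈ σ.sym, ∃ c : F, x = c • (1 : E))
    (hprime : ∀ x y : E, (∀ z, x * z * y = 0) → x = 0 ∨ y = 0)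
    (hnc : ∃ x y : E, x * y ≠ y * x) :
    Module.finrank F B = 16 ∧
    ∃ (φ : (L ⊗[F] B) ≃ₐ[L] Matrix (Fin 4) (Fin 4) L) (S : Matrix (Fin 4) (Fin 4) L),
      S.IsSymm ∧ IsUnit S.det ∧
      ∀ a : B, φ (1 ⊗ₜ τ a) = S⁻¹ * (φ (1 ⊗ₜ a)).transpose * S := by
  obtain ⟨a, b, ha, hb, χ, hχ⟩ := exists_equiv_quaternionAlgebra hS hprime hnc
  obtain ⟨π, hπ, hspan⟩ := exists_split_quaternionAlgebra L ha hb
  have hE : Module.finrank F E = 4 := by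
    rw [← χ.toLinearEquiv.finrank_eq, QuaternionAlgebra.finrank_eq_four]
  have hfin : Module.Finite F E := Module.finite_of_finrank_pos (by omega)
  have hB : Module.finrank F B = 16 := by
    rw [ψ.toLinearEquiv.finrank_eq, Module.finrank_matrix, hE]
    simp
  refine ⟨hB, ?_⟩
  have hBfin : Module.Finite F B := Module.finite_of_finrank_pos (by omega)
  let Θ : Matrix (Fin 2) (Fin 2) (Matrix (Fin 2) (Fin 2) L) ≃ₐ[L] Matrix (Fin 4) (Fin 4) L :=
    (compAlgEquiv (Fin 2) (Fin 2) L L).trans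
      (reindexAlgEquiv L L finProdFinEquiv)
  let β : E →ₐ[F] Matrix (Fin 2) (Fin 2) L := π.comp χ.symm.toAlgHom
  let P : B →ₐ[F] Matrix (Fin 4) (Fin 4) L :=
    ((Θ.restrictScalars F).toAlgHom.comp β.mapMatrix).comp ψ.toAlgHom
  have hP : ∀ x, P x = Θ ((ψ x).map β) := fun _ => rfl
  let Φ : L ⊗[F] B →ₐ[L] Matrix (Fin 4) (Fin 4) L :=
    Algebra.TensorProduct.lift (Algebra.ofId L _) P fun c x => Algebra.commutes c _
  have hΦ : ∀ (c : L) (x : B), Φ (c ⊗ₜ x) = c • P x := by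
    intro c x
    have := Algebra.TensorProduct.lift_tmul (Algebra.ofId L (Matrix (Fin 4) (Fin 4) L)) P
      (fun c x => Algebra.commutes c _) c x
    rw [Algebra.smul_def]
    exact this
  -- Each entry of X is an L-combination of images of quaternions, so Φ is onto. Both sides have
  -- dimension 16, so it is bijective.
  have hsurj : Function.Surjective Φ := by
    intro Y
    obtain ⟨X, rfl⟩ := Θ.surjective Y
    choose l y hl using fun i j => hspan (X i j)
    refine ⟨∑ i, ∑ j, ∑ m, l i j m ⊗ₜ ψ.symm (Matrix.single i j (χ (y i j m))), ?_⟩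
    simp only [map_sum, hΦ, hP, AlgEquiv.apply_symm_apply]
    have h1 : ∀ i j m, l i j m • Θ ((Matrix.single i j (χ (y i j m))).map β)
        = Θ (Matrix.single i j (l i j m • π (y i j m))) := by
      intro i j m
      rw [← map_smul]
      congr 1
      rw [Matrix.map_single, Matrix.smul_single]
      · congr 2
        exact congrArg π (χ.symm_apply_apply _)
    simp only [h1, ← map_sum]
    congr 1
    have h2 : ∀ i j, ∑ m, Matrix.single i j (l i j m • π (y i j m)) = Matrix.single i j (X i j) := by
      intro i j
      rw [hl i j]
      exact (map_sum (Matrix.singleAddMonoidHom (α := Matrix (Fin 2) (Fin 2) L) i j) _ _).symm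
    simp only [h2]
    exact (Matrix.matrix_eq_sum_single X).symm
  have hbij : Function.Bijective Φ := by
    have hfr : Module.finrank L (L ⊗[F] B) = Module.finrank L (Matrix (Fin 4) (Fin 4) L) := by
      rw [Module.finrank_baseChange, hB, Module.finrank_matrix]
      simp
    exact ⟨(LinearMap.injective_iff_surjective_of_finrank_eq_finrank hfr
      (f := Φ.toLinearMap)).mpr hsurj, hsurj⟩
  set S := reindexAlgEquiv L L finProdFinEquiv (symplecticSquare L) with hSdef
  have hSS : S * S = 1 := by
    rw [hSdef, ← map_mul, symplecticSquare_mul_self, _root_.map_one]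
  have hΘ : ∀ X, Θ X = reindexAlgEquiv L L finProdFinEquiv (comp _ _ _ _ L X) := fun _ => rfl
  have htr : ∀ X, reindexAlgEquiv L L finProdFinEquiv (Matrix.transpose X)
      = (reindexAlgEquiv L L (finProdFinEquiv (m := 2) (n := 2)) X).transpose := fun _ => rfl
  have hφ : ∀ x, AlgEquiv.ofBijective Φ hbij x = Φ x := fun _ => rfl
  refine ⟨AlgEquiv.ofBijective Φ hbij, S, ?_, ?_, fun x => ?_⟩
  · rw [Matrix.IsSymm, hSdef, ← htr, symplecticSquare_isSymm L]
  · exact (Matrix.isUnit_iff_isUnit_det _).mp (IsUnit.of_mul_eq_one _ hSS)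
  · have hinv : S⁻¹ = S := Matrix.inv_eq_left_inv hSS
    rw [hφ, hφ, hinv, hΦ, hΦ, one_smul, one_smul, hP, hP, hτ]
    have h4 : ∀ z : E, β (σ.toLinearMap z) = (β z).adjugate := by
      intro z
      obtain ⟨w, rfl⟩ := χ.surjective z
      have hβ : ∀ w, β (χ w) = π w := fun w => congrArg π (χ.symm_apply_apply w)
      rw [hχ, hβ, hβ, hπ]
    have h3 := symplecticSquare_adjoint ((ψ x).map β)
      (((doubleInvolution σ).toLinearMap (ψ x)).map β) (by
        rw [doubleInvolution_apply]
        ext1 i j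
        fin_cases i <;> fin_cases j <;> simp [h4])
    rw [hΘ, hΘ, h3, map_mul, map_mul, htr, hSdef]

end Doubling

/-! ### The trace of an orthogonal involution -/

section OrthogonalTrace

open AlgInvolution Matrix

/-- The adjoint involution `X ↦ S⁻¹ Xᵀ S` as a linear map. -/
def gramAdjoint {L : Type*} [Field L] {d : ℕ} (S : Matrix (Fin d) (Fin d) L) :
    Matrix (Fin d) (Fin d) L →ₗ[L] Matrix (Fin d) (Fin d) L :=
  LinearMap.mulLeftRight L (S⁻¹, S) ∘ₗ (Matrix.transposeLinearEquiv (Fin d) (Fin d) L L).toLinearMap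

theorem gramAdjoint_apply {L : Type*} [Field L] {d : ℕ} (S X : Matrix (Fin d) (Fin d) L) :
    gramAdjoint S X = S⁻¹ * X.transpose * S := rfl

/-- By symmetry of S, the diagonal coefficient at the matrix unit (i, j) is S⁻¹ᵢⱼ Sⱼᵢ, and these add
up to the trace of S⁻¹ S. An alternating Gram matrix would give -d, so the trace detects the type.
-/
theorem trace_gramAdjoint {L : Type*} [Field L] {d : ℕ} {S : Matrix (Fin d) (Fin d) L}
    (hS : S.IsSymm) (hdet : IsUnit S.det) : LinearMap.trace L _ (gramAdjoint S) = d := by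
  rw [LinearMap.trace_eq_matrix_trace L (Matrix.stdBasis L (Fin d) (Fin d)), Matrix.trace]
  have h : ∀ p : Fin d × Fin d, (LinearMap.toMatrix (Matrix.stdBasis L (Fin d) (Fin d))
      (Matrix.stdBasis L (Fin d) (Fin d)) (gramAdjoint S)).diag p = S⁻¹ p.1 p.2 * S p.2 p.1 := by
    rintro ⟨i, j⟩
    rw [Matrix.diag_apply, LinearMap.toMatrix_apply, Matrix.stdBasis_eq_single,
      gramAdjoint_apply, Matrix.transpose_single]
    change (S⁻¹ * Matrix.single j i (1 : L) * S) i j = _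
    rw [Matrix.mul_assoc, Matrix.mul_apply, Finset.sum_eq_single j]
    · rw [Matrix.single_mul_apply_same, one_mul]
      congr 1
      exact congrFun (congrFun hS j) i
    · intro k _ hk
      rw [Matrix.single_mul_apply_of_ne (h := hk), mul_zero]
    · simp
  rw [Finset.sum_congr rfl fun p _ => h p, Fintype.sum_prod_type]
  have : ∀ i, ∑ j, S⁻¹ i j * S j i = (S⁻¹ * S) i i := fun i => (Matrix.mul_apply).symm
  simp only [this]
  rw [Matrix.nonsing_inv_mul S hdet]
  simp

/-- The map (1 - τ)/2 is a projection onto the (-1)-eigenspace, and the trace of a projection is its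
rank. -/
theorem finrank_skew_of_trace {F B : Type*} [Field F] [CharZero F] [AddCommGroup B] [Module F B]
    [FiniteDimensional F B] (τ : B →ₗ[F] B) (hτ : ∀ x, τ (τ x) = x) :
    LinearMap.trace F B τ = Module.finrank F B - 2 * Module.finrank F (LinearMap.ker (τ + 1)) := by
  set P : B →ₗ[F] B := (2 : F)⁻¹ • (1 - τ) with hP
  have hproj : LinearMap.IsProj (LinearMap.ker (τ + 1)) P := by
    refine ⟨fun x => ?_, fun x hx => ?_⟩
    · rw [LinearMap.mem_ker, hP]
      simp [hτ]
    · rw [LinearMap.mem_ker, LinearMap.add_apply, Module.End.one_apply] at hx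
      rw [hP, LinearMap.smul_apply, LinearMap.sub_apply, Module.End.one_apply,
        eq_neg_of_add_eq_zero_left hx, sub_neg_eq_add, ← two_smul F, smul_smul,
        inv_mul_cancel₀ two_ne_zero, one_smul]
  have h := hproj.trace
  rw [hP, map_smul, map_sub, LinearMap.trace_one, smul_eq_mul] at h
  rw [← h]
  field_simp
  ring

variable {F B E L : Type*} [Field F] [CharZero F] [Ring B] [Algebra F B]
  [Ring E] [Algebra F E] {σ : AlgInvolution F E} [Field L] [Algebra F L]

/-- If `M₂(E)` has degree `4` and its involution is orthogonal, then the symmetric elements of `E`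
are the scalars. -/
theorem sym_scalar_of_orthogonal (ψ : B ≃ₐ[F] Matrix (Fin 2) (Fin 2) E) (τ : B →ₗ[F] B)
    (hτ : ∀ x, ψ (τ x) = (doubleInvolution σ).toLinearMap (ψ x)) {d : ℕ}
    (φ : (L ⊗[F] B) ≃ₐ[L] Matrix (Fin d) (Fin d) L) {S : Matrix (Fin d) (Fin d) L}
    (hS : S.IsSymm) (hdet : IsUnit S.det)
    (h : ∀ a : B, φ (1 ⊗ₜ τ a) = S⁻¹ * (φ (1 ⊗ₜ a)).transpose * S)
    (hdeg : Nat.sqrt (Module.finrank F B) = 4) :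
    ∀ x ∈ σ.sym, ∃ c : F, x = c • (1 : E) := by
  have hd : Module.finrank F B = d * d := by
    rw [← Module.finrank_baseChange (R := L), φ.toLinearEquiv.finrank_eq, Module.finrank_matrix]
    simp
  have hd4 : d = 4 := by rwa [hd, Nat.sqrt_eq] at hdeg
  subst hd4
  have hBfin : Module.Finite F B := Module.finite_of_finrank_pos (by omega)
  have hE4 : Module.finrank F E = 4 := by
    rw [ψ.toLinearEquiv.finrank_eq, Module.finrank_matrix] at hd
    simp only [Fintype.card_fin] at hd
    omega
  have hEfin : Module.Finite F E := Module.finite_of_finrank_pos (by omega)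
  -- The trace is unchanged by base change and conjugation, so it can be read off from the Gram
  -- matrix. In dimension 16, trace 4 leaves a space of skew elements of dimension 6.
  have htr : LinearMap.trace F B τ = 4 := by
    have hc : φ.toLinearEquiv.conj (τ.baseChange L) = gramAdjoint S := by
      have h1 : φ.toLinearEquiv.toLinearMap ∘ₗ τ.baseChange L
          = gramAdjoint S ∘ₗ φ.toLinearEquiv.toLinearMap := by
        refine TensorProduct.AlgebraTensorModule.ext fun c a => ?_
        have hca : ∀ a : B, (c ⊗ₜ[F] a : L ⊗[F] B) = c • (1 ⊗ₜ[F] a) := fun a => by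
          rw [TensorProduct.smul_tmul', smul_eq_mul, mul_one]
        change φ (τ.baseChange L (c ⊗ₜ a)) = gramAdjoint S (φ (c ⊗ₜ a))
        rw [LinearMap.baseChange_tmul, hca, hca, map_smul, map_smul, map_smul, h,
          gramAdjoint_apply]
      ext1 Y
      have h2 := LinearMap.congr_fun h1 (φ.symm Y)
      rw [LinearEquiv.conj_apply_apply]
      change φ (τ.baseChange L (φ.symm Y)) = gramAdjoint S (φ (φ.symm Y)) at h2
      rw [AlgEquiv.apply_symm_apply] at h2
      exact h2
    have h3 := LinearMap.trace_conj' (τ.baseChange L) φ.toLinearEquiv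
    rw [hc, trace_gramAdjoint hS hdet, LinearMap.trace_baseChange] at h3
    apply (algebraMap F L).injective
    rw [← h3, map_ofNat]
    rfl
  have hττ : ∀ x, τ (τ x) = x := fun x => ψ.injective (by rw [hτ, hτ, apply_apply])
  have hsk : Module.finrank F (LinearMap.ker (τ + 1)) = 6 := by
    have := finrank_skew_of_trace τ hττ
    rw [htr, hd] at this
    have h5 : ((Module.finrank F (LinearMap.ker (τ + 1)) : ℕ) : F) = (6 : ℕ) := by
      push_cast at this ⊢
      linear_combination (1 / 2 : F) * this
    exact_mod_cast h5
  -- The block description embeds E ⊕ Sym ⊕ Sym in the skew elements, so 4 + 2 dim Sym ≤ 6. As 1 is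
  -- symmetric, dim Sym = 1.
  let f₀ : E × σ.sym × σ.sym →ₗ[F] Matrix (Fin 2) (Fin 2) E :=
    { toFun := fun p => !![p.1, (p.2.1 : E); (p.2.2 : E), -σ.toLinearMap p.1]
      map_add' := fun p q => by
        ext i j
        fin_cases i <;> fin_cases j <;> simp [add_comm]
      map_smul' := fun c p => by
        ext i j
        fin_cases i <;> fin_cases j <;> simp }
  have hf₀ : ∀ p, f₀ p = !![p.1, (p.2.1 : E); (p.2.2 : E), -σ.toLinearMap p.1] := fun _ => rfl
  let f : E × σ.sym × σ.sym →ₗ[F] LinearMap.ker (τ + 1) :=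
    LinearMap.codRestrict _ (ψ.symm.toLinearMap ∘ₗ f₀) fun p => by
      rw [LinearMap.mem_ker, LinearMap.add_apply, Module.End.one_apply]
      apply ψ.injective
      change ψ (τ (ψ.symm (f₀ p)) + ψ.symm (f₀ p)) = ψ 0
      rw [map_add, hτ, AlgEquiv.apply_symm_apply, map_zero, hf₀, doubleInvolution_apply]
      have h1 := mem_sym.mp p.2.1.2
      have h2 := mem_sym.mp p.2.2.2
      ext i j
      fin_cases i <;> fin_cases j <;> simp [h1, h2]
  have hinj : Function.Injective f := by
    rw [injective_iff_map_eq_zero]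
    intro p hp
    have h1 : ψ.symm (f₀ p) = 0 := congrArg Subtype.val hp
    have h2 : f₀ p = 0 := ψ.symm.injective (by rw [h1, map_zero])
    rw [hf₀] at h2
    have e1 := congrFun (congrFun h2 0) 0
    have e2 := congrFun (congrFun h2 0) 1
    have e3 := congrFun (congrFun h2 1) 0
    refine Prod.ext e1 (Prod.ext (Subtype.ext e2) (Subtype.ext e3))
  have hle := LinearMap.finrank_le_finrank_of_injective hinj
  rw [Module.finrank_prod, Module.finrank_prod, hE4, hsk] at hle
  have hnt : Nontrivial E := Module.nontrivial_of_finrank_pos (R := F) (by omega)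
  have h1ne : (⟨1, one_mem_sym⟩ : σ.sym) ≠ 0 := fun h0 => one_ne_zero (congrArg Subtype.val h0)
  have hsym1 : Module.finrank F σ.sym = 1 := by
    have : 0 < Module.finrank F σ.sym :=
      Module.finrank_pos_iff_exists_ne_zero.mpr ⟨_, h1ne⟩
    omega
  intro x hx
  obtain ⟨c, hc⟩ := (finrank_eq_one_iff_of_nonzero' _ h1ne).mp hsym1 ⟨x, hx⟩
  exact ⟨c, (congrArg Subtype.val hc).symm⟩

end OrthogonalTrace

theorem nonempty_equiv_map_of_injOn {K L N : Type*} [Field K] [LieRing L] [LieAlgebra K L]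
    [LieRing N] [LieAlgebra K N] (f : L →ₗ⁅K⁆ N) (A : LieSubalgebra K L)
    (h : ∀ x ∈ A, f x = 0 → x = 0) : Nonempty (A.map f ≃ₗ⁅K⁆ A) := by
  have hinj : Function.Injective (f.comp A.incl) := by
    rw [injective_iff_map_eq_zero]
    exact fun x hx => Subtype.ext (h x.1 x.2 hx)
  have hr : (f.comp A.incl).range = A.map f := by
    ext y
    simp only [LieHom.mem_range, LieSubalgebra.mem_map]
    exact ⟨fun ⟨x, hx⟩ => ⟨x.1, x.2, hx⟩, fun ⟨x, hx, hy⟩ => ⟨⟨x, hx⟩, hy⟩⟩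
  rw [← hr]
  exact ⟨(LieEquiv.ofInjective _ hinj).symm⟩

/-! ### The Lie algebra generated by strictly triangular matrices -/

section BlockLie

open AlgInvolution Matrix

variable {K E : Type*} [Field K] [Ring E] [Algebra K E] (σ : AlgInvolution K E)

theorem block_mem_Skew (x : E) {s t : E} (hs : s ∈ σ.sym) (ht : t ∈ σ.sym) :
    !![x, s; t, -σ.toLinearMap x] ∈ Skew (doubleInvolution σ) := by
  rw [mem_sym] at hs ht
  rw [mem_Skew, doubleInvolution_apply]
  ext i j
  fin_cases i <;> fin_cases j <;> simp [hs, ht]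

variable {σ} in
theorem Skew_doubleInvolution_entries {X : Matrix (Fin 2) (Fin 2) E}
    (hX : X ∈ Skew (doubleInvolution σ)) :
    X 0 1 ∈ σ.sym ∧ X 1 0 ∈ σ.sym ∧ X 1 1 = -σ.toLinearMap (X 0 0) := by
  rw [mem_Skew, doubleInvolution_apply] at hX
  have e0 := congrFun (congrFun hX 0) 1
  have e1 := congrFun (congrFun hX 1) 0
  have e2 := congrFun (congrFun hX 1) 1
  refine ⟨neg_injective e0, neg_injective e1, ?_⟩
  have e3 : σ.toLinearMap (X 0 0) = -X 1 1 := e2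
  rw [e3, neg_neg]

variable {σ} in
theorem eq_block {X : Matrix (Fin 2) (Fin 2) E} (hX : X ∈ Skew (doubleInvolution σ)) :
    X = !![X 0 0, X 0 1; X 1 0, -σ.toLinearMap (X 0 0)] := by
  conv_lhs => rw [Matrix.eta_fin_two X, (Skew_doubleInvolution_entries hX).2.2]

/-- The element of `Skew(M₂(E))` with given entries. -/
def block (x : E) (s t : σ.sym) : Skew (doubleInvolution σ) :=
  ⟨!![x, (s : E); (t : E), -σ.toLinearMap x], block_mem_Skew σ x s.2 t.2⟩

theorem block_add (x y : E) (s t s' t' : σ.sym) :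
    block σ x s t + block σ y s' t' = block σ (x + y) (s + s') (t + t') := by
  refine Subtype.ext ?_
  change !![x, (s : E); (t : E), -σ.toLinearMap x] + !![y, (s' : E); (t' : E), -σ.toLinearMap y] =
    !![x + y, (s + s' : E); (t + t' : E), -σ.toLinearMap (x + y)]
  ext i j
  fin_cases i <;> fin_cases j <;> simp [add_comm]

theorem block_smul (c : K) (x : E) (s t : σ.sym) :
    c • block σ x s t = block σ (c • x) (c • s) (c • t) := by
  refine Subtype.ext ?_
  change c • !![x, (s : E); (t : E), -σ.toLinearMap x] =
    !![c • x, (c • s : E); (c • t : E), -σ.toLinearMap (c • x)]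
  ext i j
  fin_cases i <;> fin_cases j <;> simp

theorem block_ext {X Y : Skew (doubleInvolution σ)} (h0 : X.1 0 0 = Y.1 0 0)
    (h1 : X.1 0 1 = Y.1 0 1) (h2 : X.1 1 0 = Y.1 1 0) : X = Y := by
  refine Subtype.ext ?_
  rw [eq_block X.2, eq_block Y.2, h0, h1, h2]

theorem exists_block (X : Skew (doubleInvolution σ)) : ∃ x s t, X = block σ x s t :=
  ⟨X.1 0 0, ⟨X.1 0 1, (Skew_doubleInvolution_entries X.2).1⟩,
    ⟨X.1 1 0, (Skew_doubleInvolution_entries X.2).2.1⟩, block_ext σ rfl rfl rfl⟩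

theorem lie_block_apply (x y : E) (s t s' t' : σ.sym) :
    (⁅block σ x s t, block σ y s' t'⁆ : Skew (doubleInvolution σ)).1 =
      !![x, (s : E); (t : E), -σ.toLinearMap x] * !![y, (s' : E); (t' : E), -σ.toLinearMap y] -
      !![y, (s' : E); (t' : E), -σ.toLinearMap y] * !![x, (s : E); (t : E), -σ.toLinearMap x] := rfl

/-- The Lie subalgebra of `Skew(M₂(E))` generated by the strictly triangular elements. -/
def triangularSpan : LieSubalgebra K (Skew (doubleInvolution σ)) :=
  LieSubalgebra.lieSpan K _ {X | ∃ s, X = block σ 0 s 0 ∨ X = block σ 0 0 s}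

variable {σ}

theorem upper_mem (s : σ.sym) : block σ 0 s 0 ∈ triangularSpan σ :=
  LieSubalgebra.subset_lieSpan ⟨s, Or.inl rfl⟩

theorem lower_mem (s : σ.sym) : block σ 0 0 s ∈ triangularSpan σ :=
  LieSubalgebra.subset_lieSpan ⟨s, Or.inr rfl⟩

theorem lie_upper_lower (s t : σ.sym) :
    ⁅block σ 0 s 0, block σ 0 0 t⁆ = block σ (s * t : E) 0 0 := by
  refine block_ext σ ?_ ?_ ?_ <;> rw [lie_block_apply] <;> simp [block]

theorem lie_diag_diag (x y : E) :
    ⁅block σ x 0 0, block σ y 0 0⁆ = block σ (x * y - y * x) 0 0 := by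
  refine block_ext σ ?_ ?_ ?_ <;> rw [lie_block_apply] <;> simp [block]

theorem lie_diag_upper (x : E) (s : σ.sym) :
    (⁅block σ x 0 0, block σ 0 s 0⁆ : Skew (doubleInvolution σ)) =
      block σ 0 ⟨x * s + s * σ.toLinearMap x, by
        have := add_apply_mem_sym (σ := σ) (x * s)
        rwa [map_mul_rev, mem_sym.mp s.2] at this⟩ 0 := by
  refine block_ext σ ?_ ?_ ?_ <;> rw [lie_block_apply] <;> simp [block]

/-- The adjoint action of diag(1, -1) has eigenvalues 2, 0, -2 on the upper, diagonal and lower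
parts, and so separates them. -/
theorem lie_one_block (x : E) (s t : σ.sym) :
    ⁅block σ 1 0 0, block σ x s t⁆ = block σ 0 (s + s) (-(t + t)) := by
  refine block_ext σ ?_ ?_ ?_ <;> rw [lie_block_apply] <;> simp [block, sub_eq_add_neg]

theorem lie_upper_diag_one (x : E) :
    ⁅block σ 0 ⟨1, one_mem_sym⟩ 0, block σ x 0 0⁆ =
      block σ 0 (-⟨x + σ.toLinearMap x, add_apply_mem_sym x⟩) 0 := by
  refine block_ext σ ?_ ?_ ?_ <;> rw [lie_block_apply] <;> simp [block, sub_eq_add_neg, add_comm]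

variable [CharZero K]

/-- A product is half its anticommutator, which is symmetric, plus half its commutator. -/
theorem mul_mem_sup {s t : E} (hs : s ∈ σ.sym) (ht : t ∈ σ.sym) :
    s * t ∈ σ.sym ⊔ symCommutators σ := by
  have h : s * t = (2 : K)⁻¹ • (s * t + t * s) + (2 : K)⁻¹ • (s * t - t * s) := by
    rw [← smul_add, add_add_sub_cancel, ← two_smul K, smul_smul, inv_mul_cancel₀ two_ne_zero,
      one_smul]
  rw [h]
  refine Submodule.add_mem_sup (Submodule.smul_mem _ _ ?_)
    (Submodule.smul_mem _ _ (commutator_mem_symCommutators hs ht))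
  have := add_apply_mem_sym (σ := σ) (s * t)
  rwa [map_mul_rev, mem_sym.mp hs, mem_sym.mp ht] at this

omit [CharZero K] in
-- As w is skew, [w, ·] is a derivation preserving Sym, hence also [Sym, Sym].
theorem commutator_symCommutators_mem {w v : E} (hw : w ∈ symCommutators σ)
    (hv : v ∈ symCommutators σ) : w * v - v * w ∈ symCommutators σ := by
  have hw' : w ∈ Skew σ := symCommutators_le_Skew hw
  induction hv using Submodule.span_induction with
  | zero => simp
  | add x y _ _ hx hy =>
    have : w * (x + y) - (x + y) * w = (w * x - x * w) + (w * y - y * w) := by noncomm_ring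
    rw [this]
    exact add_mem hx hy
  | smul c x _ hx =>
    rw [mul_smul_comm, smul_mul_assoc, ← smul_sub]
    exact Submodule.smul_mem _ _ hx
  | mem x hx =>
    obtain ⟨s, hs, t, ht, rfl⟩ := hx
    have : w * (s * t - t * s) - (s * t - t * s) * w
        = ((w * s - s * w) * t - t * (w * s - s * w))
          + (s * (w * t - t * w) - (w * t - t * w) * s) := by noncomm_ring
    rw [this]
    exact add_mem (commutator_mem_symCommutators (commutator_skew_sym_mem_sym hw' hs) ht)
      (commutator_mem_symCommutators hs (commutator_skew_sym_mem_sym hw' ht))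

omit [CharZero K] in
theorem commutator_sup_mem {x y : E} (hx : x ∈ σ.sym ⊔ symCommutators σ)
    (hy : y ∈ σ.sym ⊔ symCommutators σ) : x * y - y * x ∈ σ.sym ⊔ symCommutators σ := by
  obtain ⟨s, hs, w, hw, rfl⟩ := Submodule.mem_sup.mp hx
  obtain ⟨t, ht, v, hv, rfl⟩ := Submodule.mem_sup.mp hy
  have : (s + w) * (t + v) - (t + v) * (s + w)
      = ((w * t - t * w) - (v * s - s * v)) + ((s * t - t * s) + (w * v - v * w)) := by
    noncomm_ring
  rw [this]
  exact Submodule.add_mem_sup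
    (sub_mem (commutator_skew_sym_mem_sym (symCommutators_le_Skew hw) ht)
      (commutator_skew_sym_mem_sym (symCommutators_le_Skew hv) hs))
    (add_mem (commutator_mem_symCommutators hs ht) (commutator_symCommutators_mem hw hv))

/-- The corner of the bracket is [x, y] + s t' - s' t, and products of symmetric elements are
covered by `mul_mem_sup`. Only [x, y] depends on the situation, so this serves both for L and for
the derived algebra. -/
theorem lie_entry_mem {X Y : Skew (doubleInvolution σ)}
    (h : X.1 0 0 * Y.1 0 0 - Y.1 0 0 * X.1 0 0 ∈ σ.sym ⊔ symCommutators σ) :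
    (⁅X, Y⁆ : Skew (doubleInvolution σ)).1 0 0 ∈ σ.sym ⊔ symCommutators σ := by
  obtain ⟨x, s, t, rfl⟩ := exists_block σ X
  obtain ⟨y, s', t', rfl⟩ := exists_block σ Y
  have h' : x * y - y * x ∈ σ.sym ⊔ symCommutators σ := h
  have : (⁅block σ x s t, block σ y s' t'⁆ : Skew (doubleInvolution σ)).1 0 0
      = (x * y - y * x) + (s * t' - s' * t) := by
    rw [lie_block_apply]
    simp
    abel
  rw [this]
  exact add_mem h' (sub_mem (mul_mem_sup s.2 t'.2) (mul_mem_sup s'.2 t.2))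

omit [CharZero K] in
-- A symmetric diagonal is the bracket of an upper s with the lower 1. Brackets of such diagonals
-- produce [Sym, Sym].
theorem diag_mem {x : E} (hx : x ∈ σ.sym ⊔ symCommutators σ) :
    block σ x 0 0 ∈ triangularSpan σ := by
  have hsym : ∀ s ∈ σ.sym, block σ s 0 0 ∈ triangularSpan σ := by
    intro s hs
    have h := (triangularSpan σ).lie_mem (upper_mem ⟨s, hs⟩) (lower_mem ⟨1, one_mem_sym⟩)
    rwa [lie_upper_lower, mul_one] at h
  have hadd : ∀ x y, block σ x 0 0 ∈ triangularSpan σ → block σ y 0 0 ∈ triangularSpan σ →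
      block σ (x + y) 0 0 ∈ triangularSpan σ := by
    intro x y hx hy
    have := (triangularSpan σ).add_mem hx hy
    rwa [block_add, add_zero] at this
  obtain ⟨s, hs, w, hw, rfl⟩ := Submodule.mem_sup.mp hx
  refine hadd _ _ (hsym s hs) ?_
  clear hx
  induction hw using Submodule.span_induction with
  | zero => exact hsym 0 (zero_mem _)
  | add x y _ _ hx hy => exact hadd _ _ hx hy
  | smul c x _ hx =>
    have := (triangularSpan σ).smul_mem c hx
    rwa [block_smul, smul_zero] at this
  | mem x hx =>
    obtain ⟨s, hs, t, ht, rfl⟩ := hx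
    have := (triangularSpan σ).lie_mem (hsym s hs) (hsym t ht)
    rwa [lie_diag_diag] at this

/-- The off-diagonal entries are free, so only the possible corners matter. They are governed by the
fact that Sym + [Sym, Sym] is closed under commutators. -/
theorem mem_triangularSpan {X : Skew (doubleInvolution σ)} :
    X ∈ triangularSpan σ ↔ X.1 0 0 ∈ σ.sym ⊔ symCommutators σ := by
  constructor
  · intro hX
    let C : LieSubalgebra K (Skew (doubleInvolution σ)) :=
      { carrier := {X | X.1 0 0 ∈ σ.sym ⊔ symCommutators σ}
        zero_mem' := zero_mem (σ.sym ⊔ symCommutators σ)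
        add_mem' := fun {x y} hx hy => (σ.sym ⊔ symCommutators σ).add_mem hx hy
        smul_mem' := fun c x hx => Submodule.smul_mem (σ.sym ⊔ symCommutators σ) c hx
        lie_mem' := fun {x y} hx hy => lie_entry_mem (commutator_sup_mem hx hy) }
    have hle : triangularSpan σ ≤ C := by
      refine LieSubalgebra.lieSpan_le.mpr ?_
      rintro _ ⟨s, rfl | rfl⟩
      · exact zero_mem (σ.sym ⊔ symCommutators σ)
      · exact zero_mem (σ.sym ⊔ symCommutators σ)
    exact hle hX
  · intro hX
    obtain ⟨x, s, t, rfl⟩ := exists_block σ X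
    have : block σ x s t = block σ x 0 0 + block σ 0 s 0 + block σ 0 0 t := by
      rw [block_add, block_add]; simp
    rw [this]
    exact (triangularSpan σ).add_mem ((triangularSpan σ).add_mem (diag_mem hX) (upper_mem s))
      (lower_mem t)

/-- If commutators of skew elements are sums of commutators of symmetric elements, then the
strictly triangular elements generate the derived algebra of `Skew(M₂(E))`. -/
theorem triangularSpan_eq_derivedSkew
    (h : ∀ k ∈ Skew σ, ∀ l ∈ Skew σ, k * l - l * k ∈ symCommutators σ)
    (X : Skew (doubleInvolution σ)) :
    X ∈ triangularSpan σ ↔ X ∈ derivedSkew (doubleInvolution σ) := by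
  -- Split x and y into symmetric and skew parts. The mixed commutators are symmetric, and `h`
  -- handles the skew ones.
  have hcomm : ∀ x y : E, x * y - y * x ∈ σ.sym ⊔ symCommutators σ := by
    intro x y
    obtain ⟨s, hs, k, hk, rfl⟩ := exists_sym_add_skew (σ := σ) x
    obtain ⟨t, ht, l, hl, rfl⟩ := exists_sym_add_skew (σ := σ) y
    have : (s + k) * (t + l) - (t + l) * (s + k)
      = ((k * t - t * k) - (l * s - s * l)) + ((s * t - t * s) + (k * l - l * k)) := by
      noncomm_ring
    rw [this]
    exact Submodule.add_mem_sup (sub_mem (commutator_skew_sym_mem_sym hk ht)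
      (commutator_skew_sym_mem_sym hl hs))
      (add_mem (commutator_mem_symCommutators hs ht) (h k hk l hl))
  constructor
  · intro hX
    have hle : triangularSpan σ ≤
        (derivedSkew (doubleInvolution σ)).toLieSubalgebra := by
      refine LieSubalgebra.lieSpan_le.mpr ?_
      -- Strictly triangular elements are brackets with diag(1, -1). The halves undo the eigenvalues
      -- 2 and -2.
      have key : ∀ s t, block σ 0 s t ∈ derivedSkew (doubleInvolution σ) := by
        intro s t
        have hb : ⁅block σ 1 0 0, block σ 0 ((2 : K)⁻¹ • s) (-((2 : K)⁻¹ • t))⁆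
            ∈ derivedSkew (doubleInvolution σ) :=
          LieSubmodule.lie_mem_lie (LieSubmodule.mem_top _) (LieSubmodule.mem_top _)
        have h2 : ∀ s : σ.sym, (2 : K)⁻¹ • s + (2 : K)⁻¹ • s = s := fun s => by
          rw [← smul_add, ← two_smul K, smul_smul, inv_mul_cancel₀ two_ne_zero, one_smul]
        rwa [lie_one_block, ← neg_add, neg_neg, h2, h2] at hb
      rintro _ ⟨s, rfl | rfl⟩
      · exact key s 0
      · exact key 0 s
    exact hle hX
  · intro hX
    have hX' : X ∈ (derivedSkew (doubleInvolution σ)).toSubmodule := hX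
    rw [LieSubmodule.lieIdeal_oper_eq_linear_span'] at hX'
    have hle : Submodule.span K {x | ∃ y ∈ (⊤ : LieIdeal K (Skew (doubleInvolution σ))),
        ∃ z ∈ (⊤ : LieIdeal K (Skew (doubleInvolution σ))), ⁅y, z⁆ = x}
        ≤ (triangularSpan σ).toSubmodule := by
      refine Submodule.span_le.mpr ?_
      rintro _ ⟨y, -, z, -, rfl⟩
      exact mem_triangularSpan.mpr (lie_entry_mem (hcomm _ _))
    exact hle hX'

/-- A representation of `Skew(M₂(E))` that is faithful on strictly upper triangular elements is
faithful on the Lie algebra generated by the strictly triangular elements. -/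
theorem injOn_triangularSpan {N : Type*} [LieRing N] [LieAlgebra K N]
    (f : Skew (doubleInvolution σ) →ₗ⁅K⁆ N) (hf : ∀ s, f (block σ 0 s 0) = 0 → s = 0)
    (hC : ∀ x ∈ symCommutators σ, (∀ s ∈ σ.sym, x * s = s * x) → x = 0)
    (X : Skew (doubleInvolution σ)) (hX : X ∈ triangularSpan σ) (h0 : f X = 0) : X = 0 := by
  rw [mem_triangularSpan] at hX
  obtain ⟨x, s, t, rfl⟩ := exists_block σ X
  have htwo : ∀ s : σ.sym, s + s = 0 → s = 0 := by
    intro s hs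
    rw [← two_smul K] at hs
    exact (smul_eq_zero.mp hs).resolve_left two_ne_zero
  have hl : ∀ Y Z : Skew (doubleInvolution σ), f Z = 0 → f ⁅Y, Z⁆ = 0 := by
    intro Y Z h
    rw [LieHom.map_lie, h, lie_zero]
  -- The kernel is an ideal. Bracketing once with diag(1, -1) gives off-diagonal entries (2s, -2t),
  -- and twice gives (4s, 4t). The second plus twice the first is (8s, 0), on which f is faithful.
  have h1 : f (block σ 0 (s + s) (-(t + t))) = 0 := by
    rw [← lie_one_block x]
    exact hl _ _ h0
  have h2 : f (block σ 0 (s + s + (s + s)) (-(-(t + t) + -(t + t)))) = 0 := by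
    rw [← lie_one_block 0]
    exact hl _ _ h1
  have hs : s = 0 := by
    have h3 : f (block σ 0 ((s + s + (s + s)) + ((s + s) + (s + s))) 0) = 0 := by
      have e : block σ 0 ((s + s + (s + s)) + ((s + s) + (s + s))) 0
          = block σ 0 (s + s + (s + s)) (-(-(t + t) + -(t + t)))
            + (block σ 0 (s + s) (-(t + t)) + block σ 0 (s + s) (-(t + t))) := by
        rw [block_add, block_add]
        congr 1
        · simp
        · abel
      rw [e, map_add, map_add, h1, h2, add_zero, add_zero]
    exact htwo _ (htwo _ (htwo _ (hf _ h3)))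
  subst hs
  -- Bracketing twice with the upper unit moves the lower entry to the upper corner.
  have ht : t = 0 := by
    simp only [add_zero] at h1
    have h4 := hl (block σ 0 ⟨1, one_mem_sym⟩ 0) _ h1
    rw [lie_upper_lower] at h4
    have h5 := hl (block σ 0 ⟨1, one_mem_sym⟩ 0) _ h4
    rw [lie_upper_diag_one] at h5
    have h6 := hf _ h5
    rw [neg_eq_zero] at h6
    have h7 := congrArg Subtype.val h6
    simp only [one_mul, mem_sym.mp (-(t + t)).2] at h7
    have h8 : -(t + t) + -(t + t) = 0 := Subtype.ext h7
    have h9 := htwo _ h8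
    rw [neg_eq_zero] at h9
    exact htwo _ h9
  subst ht
  -- Only the diagonal x is left. Bracketing with upper elements gives x s + s σ(x) = 0. The case s
  -- = 1 shows that x is skew, so x commutes with Sym; being skew, it has no component in Sym and
  -- lies in [Sym, Sym].
  have hup : ∀ s ∈ σ.sym, x * s + s * σ.toLinearMap x = 0 := by
    intro s hs
    have h3 := hl (block σ 0 ⟨s, hs⟩ 0) _ h0
    rw [← lie_skew, map_neg, neg_eq_zero, lie_diag_upper] at h3
    exact congrArg Subtype.val (hf _ h3)
  have hxs : σ.toLinearMap x = -x := by
    have := hup 1 one_mem_sym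
    rw [mul_one, one_mul] at this
    exact eq_neg_of_add_eq_zero_right this
  have hxC : x ∈ symCommutators σ := by
    change x ∈ _ at hX
    obtain ⟨u, hu, w, hw, huw⟩ := Submodule.mem_sup.mp hX
    have hu0 : u = 0 := by
      refine eq_zero_of_mem_sym_of_mem_Skew hu ?_
      have hsub : u = x - w := by rw [← huw, add_sub_cancel_right]
      rw [hsub]
      exact (Skew σ).sub_mem hxs (symCommutators_le_Skew hw)
    rw [← huw, hu0, zero_add]
    exact hw
  have hx0 : x = 0 := by
    refine hC x hxC fun s hs => ?_
    have := hup s hs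
    rw [hxs, mul_neg] at this
    exact add_neg_eq_zero.mp this
  rw [hx0]
  refine block_ext σ ?_ ?_ ?_ <;> simp [block]

/-- If the symmetric elements form a subfield `F`, then the strictly triangular elements generate
`sl₂(F)`. -/
theorem nonempty_triangularSpan_equiv_sl2 {F : Type*} [CommRing F] [Algebra K F] (ι : F →ₐ[K] E)
    (hι : Function.Injective ι) (hF : ∀ x, x ∈ σ.sym ↔ ∃ c, ι c = x) :
    Nonempty (triangularSpan σ ≃ₗ⁅K⁆ sl2 K F) := by
  have hιs : ∀ c, σ.toLinearMap (ι c) = ι c := fun c => mem_sym.mp ((hF _).mpr ⟨c, rfl⟩)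
  have hmem : ∀ X ∈ sl2 K F, ι.mapMatrix X ∈ Skew (doubleInvolution σ) := by
    intro X hX
    have hX' : X 0 0 + X 1 1 = 0 := by
      rw [← Matrix.trace_fin_two]; exact hX
    rw [mem_Skew, doubleInvolution_apply]
    have h1 : ι (X 0 0) + ι (X 1 1) = 0 := by rw [← map_add, hX', map_zero]
    ext i j
    fin_cases i <;> fin_cases j <;>
      simp [hιs, eq_neg_of_add_eq_zero_left h1]
  let f : sl2 K F →ₗ⁅K⁆ Skew (doubleInvolution σ) :=
    { toFun := fun X => ⟨ι.mapMatrix X.1, hmem X.1 X.2⟩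
      map_add' := fun X Y => Subtype.ext (map_add ι.mapMatrix X.1 Y.1)
      map_smul' := fun c X => Subtype.ext (map_smul ι.mapMatrix c X.1)
      map_lie' := fun {X Y} => by
        refine Subtype.ext ?_
        change ι.mapMatrix (X.1 * Y.1 - Y.1 * X.1) = _
        rw [map_sub, map_mul, map_mul]
        rfl }
  have hf : ∀ X, (f X).1 = ι.mapMatrix X.1 := fun _ => rfl
  have hinj : Function.Injective f := by
    intro X Y h
    refine Subtype.ext (Matrix.ext fun i j => hι ?_)
    have h1 := congrArg Subtype.val h
    rw [hf, hf] at h1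
    exact congrFun (congrFun h1 i) j
  have hrange : f.range = triangularSpan σ := by
    ext X
    rw [mem_triangularSpan, LieHom.mem_range]
    have hcomm : symCommutators σ = ⊥ := by
      rw [symCommutators, Submodule.span_eq_bot]
      rintro _ ⟨s, hs, t, ht, rfl⟩
      obtain ⟨c, rfl⟩ := (hF s).mp hs
      obtain ⟨d, rfl⟩ := (hF t).mp ht
      rw [← map_mul, ← map_mul, mul_comm, sub_self]
    rw [hcomm, sup_bot_eq]
    constructor
    · rintro ⟨Y, rfl⟩
      exact hιs _
    · intro hX
      obtain ⟨a, ha⟩ := (hF _).mp hX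
      obtain ⟨b, hb⟩ := (hF _).mp (Skew_doubleInvolution_entries X.2).1
      obtain ⟨c, hc⟩ := (hF _).mp (Skew_doubleInvolution_entries X.2).2.1
      refine ⟨⟨!![a, b; c, -a], ?_⟩, block_ext σ ?_ ?_ ?_⟩
      · change Matrix.trace _ = 0
        simp [Matrix.trace_fin_two]
      · simp [hf, ha]
      · simp [hf, hb]
      · simp [hf, hc]
  rw [← hrange]
  exact ⟨(LieEquiv.ofInjective f hinj).symm⟩

end BlockLie

theorem commutator_smul {K M : Type*} [Field K] [AddCommGroup M] [Module K M] (c : K)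
    (f g : Module.End K M) : ⁅f, c • g⁆ = c • ⁅f, g⁆ := by
  rw [Ring.lie_def, Ring.lie_def, mul_smul_comm, smul_mul_assoc, smul_sub]

/-! ### Clifford action and spin representation -/

section Clifford

open ExteriorAlgebra

variable {K V : Type*} [Field K] [AddCommGroup V] [Module K V]

/-- The contraction of the exterior algebra by a linear form. -/
def contract : Module.Dual K V →ₗ[K] Module.End K (ExteriorAlgebra K V) :=
  CliffordAlgebra.contractLeft

theorem contract_ι_mul (η : Module.Dual K V) (v : V) (x : ExteriorAlgebra K V) :
    contract η (ι K v * x) = η v • x - ι K v * contract η x :=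
  CliffordAlgebra.contractLeft_ι_mul η v x

theorem contract_ι (η : Module.Dual K V) (v : V) :
    contract η (ι K v) = algebraMap K _ (η v) :=
  CliffordAlgebra.contractLeft_ι _ η v

theorem contract_one (η : Module.Dual K V) : contract η (1 : ExteriorAlgebra K V) = 0 :=
  CliffordAlgebra.contractLeft_one _ η

theorem contract_contract (η η' : Module.Dual K V) (x : ExteriorAlgebra K V) :
    contract η (contract η' x) = -contract η' (contract η x) :=
  CliffordAlgebra.contractLeft_comm _ _ x

theorem ι_mul_ι_comm (u v : V) : ι K u * ι K v = -(ι K v * ι K u) :=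
  eq_neg_of_add_eq_zero_left (ι_add_mul_swap u v)

theorem ext_induction {C : ExteriorAlgebra K V → Prop} (one : C 1)
    (add : ∀ x y, C x → C y → C (x + y)) (smul : ∀ (c : K) x, C x → C (c • x))
    (ι_mul : ∀ v x, C x → C (ι K v * x)) (x : ExteriorAlgebra K V) : C x := by
  refine CliffordAlgebra.left_induction (P := C) (0 : QuadraticForm K V) (fun c => ?_)
    (fun x y => add x y) (fun x v hx => ι_mul v x hx) x
  rw [Algebra.algebraMap_eq_smul_one]
  exact smul c 1 one

/-- The action of the Clifford algebra of `Ṽ` on the exterior algebra of `V`. -/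
def cliff : Tilde K V →ₗ[K] Module.End K (ExteriorAlgebra K V) :=
  LinearMap.mul K (ExteriorAlgebra K V) ∘ₗ ι K ∘ₗ Tilde.fst K V + contract ∘ₗ Tilde.snd K V

theorem cliff_apply (z : Tilde K V) (x : ExteriorAlgebra K V) :
    cliff z x = ι K (Tilde.fst K V z) * x + contract (Tilde.snd K V z) x := rfl

/-- Wedges anticommute, contractions anticommute, and the antiderivation rule leaves the two cross
pairings, whose sum is b. -/
theorem cliff_anticomm (y z : Tilde K V) :
    cliff y * cliff z + cliff z * cliff y = tildeForm K V y z • 1 := by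
  refine LinearMap.ext fun x => ?_
  simp only [LinearMap.add_apply, Module.End.mul_apply, cliff_apply, LinearMap.smul_apply,
    Module.End.one_apply, tildeForm_apply, map_add, contract_ι_mul]
  rw [contract_contract (Tilde.snd K V y), ← mul_assoc, ← mul_assoc,
    ι_mul_ι_comm (Tilde.fst K V z), add_smul, neg_mul]
  abel

theorem lie_cliff (x y : Tilde K V) :
    ⁅cliff x, cliff y⁆ = (2 : K) • (cliff x * cliff y) - tildeForm K V x y • 1 := by
  rw [← cliff_anticomm, Ring.lie_def, two_smul]
  abel

theorem lie_mul_cliff (x y z : Tilde K V) :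
    ⁅cliff x * cliff y, cliff z⁆ = tildeForm K V y z • cliff x - tildeForm K V x z • cliff y := by
  have h1 : cliff y * cliff z = tildeForm K V y z • 1 - cliff z * cliff y :=
    eq_sub_of_add_eq (cliff_anticomm y z)
  have h2 : cliff z * cliff x = tildeForm K V x z • 1 - cliff x * cliff z :=
    eq_sub_of_add_eq' (cliff_anticomm x z)
  rw [Ring.lie_def, mul_assoc, h1, ← mul_assoc (cliff z), h2, mul_sub, sub_mul, mul_smul_comm,
    mul_one, smul_mul_assoc, one_mul, mul_assoc]
  abel

/-- A commutator of two vectors acts as an infinitesimal rotation. The factor 2, together with the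
two equal contributions of a skew map, explains the 1/4 in `spin`. -/
theorem lie_lie_cliff (x y z : Tilde K V) :
    ⁅⁅cliff x, cliff y⁆, cliff z⁆ =
      (2 : K) • (tildeForm K V y z • cliff x - tildeForm K V x z • cliff y) := by
  rw [lie_cliff, sub_lie, smul_lie, lie_mul_cliff, smul_lie]
  have : ⁅(1 : Module.End K (ExteriorAlgebra K V)), cliff z⁆ = 0 := by
    rw [Ring.lie_def, one_mul, mul_one, sub_self]
  rw [this, smul_zero, sub_zero]

variable [FiniteDimensional K V]

/-- A basis of `Ṽ` formed by a basis of `V` and the dual basis. -/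
def frame (K V : Type*) [Field K] [AddCommGroup V] [Module K V] [FiniteDimensional K V] :
    Fin (Module.finrank K V) ⊕ Fin (Module.finrank K V) → Tilde K V :=
  Sum.elim (fun i => ((Module.finBasis K V i, 0) : V × Module.Dual K V))
    (fun i => ((0, (Module.finBasis K V).coord i) : V × Module.Dual K V))

/-- The basis of `Ṽ` dual to `frame`. -/
def coframe (K V : Type*) [Field K] [AddCommGroup V] [Module K V] [FiniteDimensional K V] :
    Fin (Module.finrank K V) ⊕ Fin (Module.finrank K V) → Tilde K V :=
  frame K V ∘ Sum.swap

theorem sum_frame (z : Tilde K V) : ∑ k, tildeForm K V (coframe K V k) z • frame K V k = z := by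
  have h1 : ∀ i, tildeForm K V (coframe K V (Sum.inl i)) z
      = (Module.finBasis K V).coord i (Tilde.fst K V z) := by
    intro i
    rw [tildeForm_apply]
    change (Module.finBasis K V).coord i (Tilde.fst K V z) + Tilde.snd K V z 0 = _
    rw [map_zero, add_zero]
  have h2 : ∀ i, tildeForm K V (coframe K V (Sum.inr i)) z
      = Tilde.snd K V z (Module.finBasis K V i) := by
    intro i
    rw [tildeForm_apply]
    change (0 : Module.Dual K V) _ + Tilde.snd K V z (Module.finBasis K V i) = _
    rw [LinearMap.zero_apply, zero_add]
  rw [Fintype.sum_sum_type]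
  simp only [h1, h2]
  refine Prod.ext ?_ ?_
  · change Tilde.fst K V (_ + _) = Tilde.fst K V z
    rw [map_add, map_sum, map_sum]
    simp only [map_smul]
    have e1 : ∀ i, Tilde.fst K V (frame K V (Sum.inl i)) = Module.finBasis K V i := fun _ => rfl
    have e2 : ∀ i, Tilde.fst K V (frame K V (Sum.inr i)) = 0 := fun _ => rfl
    simp only [e1, e2, smul_zero, Finset.sum_const_zero, add_zero]
    exact (Module.finBasis K V).sum_repr _
  · change Tilde.snd K V (_ + _) = Tilde.snd K V z
    rw [map_add, map_sum, map_sum]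
    simp only [map_smul]
    have e1 : ∀ i, Tilde.snd K V (frame K V (Sum.inl i)) = 0 := fun _ => rfl
    have e2 : ∀ i, Tilde.snd K V (frame K V (Sum.inr i)) = (Module.finBasis K V).coord i :=
      fun _ => rfl
    simp only [e1, e2, smul_zero, Finset.sum_const_zero, zero_add]
    exact (Module.finBasis K V).sum_dual_apply_smul_coord _

theorem sum_coframe (z : Tilde K V) : ∑ k, tildeForm K V (frame K V k) z • coframe K V k = z := by
  conv_rhs => rw [← sum_frame z]
  refine Fintype.sum_equiv (Equiv.sumComm _ _) _ _ fun k => ?_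
  rw [coframe]
  simp

theorem tildeForm_adj (f : Module.End K (Tilde K V)) (x y : Tilde K V) :
    tildeForm K V (f x) y = tildeForm K V x (adj f y) := by
  rw [tildeForm_symm, ← adj_left, tildeForm_symm]

/-- The tensor ∑ eₖ ⊗ eₖ* represents the identity under b, so applying f to its second factor
amounts to applying the adjoint of f to its first. -/
theorem sum_frame_adj {N : Type*} [AddCommGroup N] [Module K N]
    (B : Tilde K V →ₗ[K] Tilde K V →ₗ[K] N) (f : Module.End K (Tilde K V)) :
    ∑ k, B (frame K V k) (f (coframe K V k)) = ∑ k, B (adj f (frame K V k)) (coframe K V k) := by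
  have h1 : ∀ k, f (coframe K V k) = ∑ j, tildeForm K V (coframe K V k) (adj f (frame K V j)) •
      coframe K V j := by
    intro k
    conv_lhs => rw [← sum_coframe (f (coframe K V k))]
    refine Finset.sum_congr rfl fun j _ => ?_
    rw [tildeForm_symm, tildeForm_adj]
  have h2 : ∀ k, adj f (frame K V k) = ∑ j, tildeForm K V (coframe K V j) (adj f (frame K V k)) •
      frame K V j := fun k => (sum_frame _).symm
  have e1 : ∀ k, B (frame K V k) (f (coframe K V k)) =
      ∑ j, tildeForm K V (coframe K V k) (adj f (frame K V j)) •
        B (frame K V k) (coframe K V j) := by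
    intro k
    rw [h1 k, map_sum]
    simp only [map_smul]
  have e2 : ∀ k, B (adj f (frame K V k)) (coframe K V k) =
      ∑ j, tildeForm K V (coframe K V j) (adj f (frame K V k)) •
        B (frame K V j) (coframe K V k) := by
    intro k
    nth_rewrite 1 [h2 k]
    rw [map_sum, LinearMap.sum_apply]
    simp only [map_smul, LinearMap.smul_apply]
  simp only [e1, e2]
  exact Finset.sum_comm

/-- The spin representation: `spin T` is `1/4 ∑ₖ [c (T eₖ), c eₖ*]`. -/
def spin : Module.End K (Tilde K V) →ₗ[K] Module.End K (ExteriorAlgebra K V) where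
  toFun T := (4 : K)⁻¹ • ∑ k, ⁅cliff (T (frame K V k)), cliff (coframe K V k)⁆
  map_add' S T := by
    simp only [LinearMap.add_apply, map_add, add_lie, Finset.sum_add_distrib, smul_add]
  map_smul' c T := by
    simp only [LinearMap.smul_apply, map_smul, smul_lie, RingHom.id_apply, ← Finset.smul_sum]
    rw [smul_comm]

theorem spin_apply (T : Module.End K (Tilde K V)) :
    spin T = (4 : K)⁻¹ • ∑ k, ⁅cliff (T (frame K V k)), cliff (coframe K V k)⁆ := rfl

variable [CharZero K]

/-- Both sums arising from `lie_lie_cliff` reproduce the vector T z, the second one by skewness of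
T. The total is 4 c(T z), which the factor 1/4 normalises. -/
theorem lie_spin_cliff {T : Module.End K (Tilde K V)} (hT : adj T = -T) (z : Tilde K V) :
    ⁅spin T, cliff z⁆ = cliff (T z) := by
  have h1 : ∑ k, tildeForm K V (coframe K V k) z • cliff (T (frame K V k)) = cliff (T z) := by
    conv_rhs => rw [← sum_frame z]
    simp only [map_sum, map_smul]
  have h2 : ∑ k, tildeForm K V (T (frame K V k)) z • cliff (coframe K V k) = -cliff (T z) := by
    conv_rhs => rw [← sum_coframe (T z)]
    simp only [map_sum, map_smul, ← Finset.sum_neg_distrib]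
    refine Finset.sum_congr rfl fun k _ => ?_
    rw [tildeForm_adj, hT, LinearMap.neg_apply, map_neg, neg_smul]
  rw [spin_apply, smul_lie, sum_lie]
  simp only [lie_lie_cliff, ← Finset.smul_sum, Finset.sum_sub_distrib, h1, h2]
  rw [sub_neg_eq_add, ← two_smul K (cliff (T z)), smul_smul, smul_smul]
  norm_num

/-- Bracketing with `spin S` is a derivation that acts on Clifford vectors by S. The terms with S on
the coframe turn into -T S on the frame by `sum_frame_adj`. -/
theorem lie_spin_spin {S T : Module.End K (Tilde K V)} (hS : adj S = -S) :
    ⁅spin S, spin T⁆ = spin ⁅S, T⁆ := by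
  let B : Tilde K V →ₗ[K] Tilde K V →ₗ[K] Module.End K (ExteriorAlgebra K V) :=
    LinearMap.mk₂ K (fun x y => ⁅cliff (T x), cliff y⁆)
      (fun x x' y => by simp only [map_add, add_lie])
      (fun c x y => by simp only [map_smul, smul_lie])
      (fun x y y' => by simp only [map_add, lie_add])
      (fun c x y => by simp only [map_smul, commutator_smul])
  have hB : ∀ x y, B x y = ⁅cliff (T x), cliff y⁆ := fun _ _ => rfl
  have h := sum_frame_adj B S
  rw [hS] at h
  simp only [hB, LinearMap.neg_apply, map_neg] at h
  rw [spin_apply T, spin_apply ⁅S, T⁆, commutator_smul, lie_sum]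
  congr 1
  have h3 : ∀ k, ⁅spin S, ⁅cliff (T (frame K V k)), cliff (coframe K V k)⁆⁆ =
      ⁅cliff (S (T (frame K V k))), cliff (coframe K V k)⁆
        + ⁅cliff (T (frame K V k)), cliff (S (coframe K V k))⁆ := by
    intro k
    rw [leibniz_lie, lie_spin_cliff hS, lie_spin_cliff hS]
  simp only [h3, Finset.sum_add_distrib, h]
  rw [← Finset.sum_add_distrib]
  refine Finset.sum_congr rfl fun k _ => ?_
  have e : ⁅S, T⁆ (frame K V k) = S (T (frame K V k)) - T (S (frame K V k)) := rfl
  rw [e, map_sub, sub_lie, sub_eq_add_neg]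

end Clifford

/-! ### Equivariance of the spin action -/

section Equivariance

open ExteriorAlgebra

variable {K G V : Type*} [Field K] [Group G] [AddCommGroup V] [Module K V]

theorem map_contract (f : V →ₗ[K] V) (η : Module.Dual K V) (x : ExteriorAlgebra K V) :
    ExteriorAlgebra.map f (contract (η ∘ₗ f) x) = contract η (ExteriorAlgebra.map f x) := by
  induction x using ext_induction with
  | one => rw [contract_one, map_one, contract_one, map_zero]
  | add x y hx hy => simp only [map_add, hx, hy]
  | smul c x hx => simp only [map_smul, hx]
  | ι_mul v x hx =>
    rw [contract_ι_mul, map_sub, map_smul, map_mul, map_mul, hx, map_apply_ι, contract_ι_mul]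
    rfl

theorem map_cliff (τ : Representation K G V) (g : G) (z : Tilde K V) (x : ExteriorAlgebra K V) :
    ExteriorAlgebra.map (τ g) (cliff z x) = cliff (tilde τ g z) (ExteriorAlgebra.map (τ g) x) := by
  rw [cliff_apply, cliff_apply, map_add, map_mul, map_apply_ι, ← map_contract]
  congr 2
  congr 2
  ext v
  change Tilde.snd K V z v = Tilde.snd K V z (τ g⁻¹ (τ g v))
  rw [← Module.End.mul_apply, ← map_mul, inv_mul_cancel, map_one, Module.End.one_apply]

variable [FiniteDimensional K V]

theorem adj_tilde_apply (τ : Representation K G V) (g : G) :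
    adj (tilde τ g) = tilde τ g⁻¹ := by
  have h := adj_tilde τ (MonoidAlgebra.single g 1)
  rwa [groupInv_single, Representation.asAlgebraHom_single, Representation.asAlgebraHom_single,
    one_smul, one_smul] at h

/-- The group acts on Ṽ by isometries, so translating frame and coframe by g does not change the sum
defining `spin T` when T commutes with g. -/
theorem map_spin (τ : Representation K G V) (g : G) {T : Module.End K (Tilde K V)}
    (hT : T * tilde τ g = tilde τ g * T) (x : ExteriorAlgebra K V) :
    ExteriorAlgebra.map (τ g) (spin T x) = spin T (ExteriorAlgebra.map (τ g) x) := by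
  let B : Tilde K V →ₗ[K] Tilde K V →ₗ[K] Module.End K (ExteriorAlgebra K V) :=
    LinearMap.mk₂ K (fun x y => ⁅cliff (T (tilde τ g x)), cliff y⁆)
      (fun x x' y => by simp only [map_add, add_lie])
      (fun c x y => by simp only [map_smul, smul_lie])
      (fun x y y' => by simp only [map_add, lie_add])
      (fun c x y => by simp only [map_smul, commutator_smul])
  have hB : ∀ x y, B x y = ⁅cliff (T (tilde τ g x)), cliff y⁆ := fun _ _ => rfl
  have h := sum_frame_adj B (tilde τ g)
  rw [adj_tilde_apply] at h
  have hg : ∀ z, tilde τ g (tilde τ g⁻¹ z) = z := by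
    intro z
    rw [← Module.End.mul_apply, ← map_mul, mul_inv_cancel, map_one, Module.End.one_apply]
  simp only [hB, hg] at h
  have hlie : ∀ y z, ExteriorAlgebra.map (τ g) (⁅cliff y, cliff z⁆ x) =
      ⁅cliff (tilde τ g y), cliff (tilde τ g z)⁆ (ExteriorAlgebra.map (τ g) x) := by
    intro y z
    simp only [Ring.lie_def, LinearMap.sub_apply, Module.End.mul_apply, map_sub, map_cliff]
  have hT' : ∀ z, tilde τ g (T z) = T (tilde τ g z) := fun z => (LinearMap.congr_fun hT z).symm
  rw [spin_apply, LinearMap.smul_apply, LinearMap.smul_apply, map_smul, LinearMap.sum_apply,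
    map_sum]
  simp only [hlie, hT']
  rw [← LinearMap.sum_apply, h]

end Equivariance

/-! ### Bivectors as skew maps V* → V -/

section Bivectors

open ExteriorAlgebra

variable {K V : Type*} [Field K] [AddCommGroup V] [Module K V]

theorem mem_extGrading_zero {x : ExteriorAlgebra K V} :
    x ∈ extGrading K V 0 ↔ ∃ c : K, x = c • (1 : ExteriorAlgebra K V) := by
  rw [extGrading, exteriorPower, pow_zero, Submodule.mem_one]
  simp only [Algebra.algebraMap_eq_smul_one, eq_comm]

theorem ι_mul_mem {i : ℕ} {x : ExteriorAlgebra K V} (v : V) (hx : x ∈ extGrading K V i) :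
    ι K v * x ∈ extGrading K V (i + 1) := by
  rw [extGrading, exteriorPower, pow_succ']
  exact Submodule.mul_mem_mul ⟨v, rfl⟩ hx

@[elab_as_elim]
theorem extGrading_succ_induction {i : ℕ} {C : ExteriorAlgebra K V → Prop}
    (mul : ∀ v, ∀ x ∈ extGrading K V i, C (ι K v * x)) (add : ∀ x y, C x → C y → C (x + y))
    {x : ExteriorAlgebra K V} (hx : x ∈ extGrading K V (i + 1)) : C x := by
  rw [extGrading, exteriorPower, pow_succ'] at hx
  refine Submodule.mul_induction_on hx ?_ add
  rintro _ ⟨v, rfl⟩ y hy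
  exact mul v y hy

@[elab_as_elim]
theorem extGrading_two_induction {C : ExteriorAlgebra K V → Prop}
    (mul : ∀ u v, C (ι K u * ι K v)) (add : ∀ x y, C x → C y → C (x + y))
    {x : ExteriorAlgebra K V} (hx : x ∈ extGrading K V 2) : C x := by
  rw [extGrading, exteriorPower, pow_two] at hx
  refine Submodule.mul_induction_on hx ?_ add
  rintro _ ⟨u, rfl⟩ _ ⟨v, rfl⟩
  exact mul u v

theorem ι_mul_ι_mem (u v : V) : ι K u * ι K v ∈ extGrading K V 2 := by
  rw [extGrading, exteriorPower, pow_two]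
  exact Submodule.mul_mem_mul ⟨u, rfl⟩ ⟨v, rfl⟩

/-- The map `V* → V` defined by a bivector. -/
def bivectorMap : ExteriorAlgebra K V →ₗ[K] Module.Dual K V →ₗ[K] V :=
  -((contract (K := K) (V := V)).flip.compr₂ ιInv)

theorem bivectorMap_ι_mul_ι (u v : V) (η : Module.Dual K V) :
    bivectorMap (ι K u * ι K v) η = η v • u - η u • v := by
  change -(ιInv (contract η (ι K u * ι K v))) = _
  rw [contract_ι_mul, contract_ι, ← Algebra.commutes, ← Algebra.smul_def, ← map_smul, ← map_smul,
    ← map_sub, ι_leftInverse, neg_sub]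

/-- With this sign the commutator of a ∧ · with the contraction by η is the wedge with `bivectorMap
a η`, in agreement with `upperMap` on Ṽ. -/
theorem contract_eq_bivectorMap {a : ExteriorAlgebra K V} (ha : a ∈ extGrading K V 2)
    (η : Module.Dual K V) : contract η a = -ι K (bivectorMap a η) := by
  refine extGrading_two_induction (fun u v => ?_) (fun x y hx hy => ?_) ha
  · rw [bivectorMap_ι_mul_ι, contract_ι_mul, contract_ι, ← Algebra.commutes, ← Algebra.smul_def,
      map_sub, map_smul, map_smul, neg_sub]
  · rw [map_add, hx, hy, map_add, LinearMap.add_apply, map_add, neg_add]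

theorem bivectorMap_skew {a : ExteriorAlgebra K V} (ha : a ∈ extGrading K V 2)
    (η η' : Module.Dual K V) : η' (bivectorMap a η) = -η (bivectorMap a η') := by
  refine extGrading_two_induction (fun u v => ?_) (fun x y hx hy => ?_) ha
  · rw [bivectorMap_ι_mul_ι, bivectorMap_ι_mul_ι]
    simp only [map_sub, map_smul, smul_eq_mul]
    ring
  · simp only [map_add, LinearMap.add_apply, hx, hy]
    ring

theorem contract_mul_of_even {a : ExteriorAlgebra K V} (ha : a ∈ extGrading K V 2)
    (η : Module.Dual K V) (x : ExteriorAlgebra K V) :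
    contract η (a * x) = a * contract η x + contract η a * x := by
  refine extGrading_two_induction (fun u v => ?_) (fun x y hx hy => ?_) ha
  · rw [mul_assoc, contract_ι_mul, contract_ι_mul, contract_ι_mul, contract_ι,
      ← Algebra.commutes, ← Algebra.smul_def, mul_sub, sub_mul, smul_mul_assoc, smul_mul_assoc,
      mul_smul_comm, mul_assoc]
    abel
  · rw [add_mul, map_add, hx, hy, map_add]
    noncomm_ring

theorem contract_pow_eq_zero {a : ExteriorAlgebra K V} (ha : a ∈ extGrading K V 2)
    {η : Module.Dual K V} (h : bivectorMap a η = 0) (k : ℕ) : contract η (a ^ k) = 0 := by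
  induction k with
  | zero => rw [pow_zero, contract_one]
  | succ k ih =>
    rw [pow_succ', contract_mul_of_even ha, ih, mul_zero, zero_add, contract_eq_bivectorMap ha, h,
      map_zero, neg_zero, zero_mul]

/-- For v with η(v) ≠ 0 the product v ∧ x vanishes for degree reasons. Contracting it with η leaves
η(v) x. -/
theorem eq_zero_of_contract_top {N : ℕ} (htop : extGrading K V (N + 1) = ⊥)
    {x : ExteriorAlgebra K V} (hx : x ∈ extGrading K V N) {η : Module.Dual K V} (hη : η ≠ 0)
    (h : contract η x = 0) : x = 0 := by
  obtain ⟨v, hv⟩ : ∃ v, η v ≠ 0 := by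
    by_contra! hcon
    exact hη (LinearMap.ext hcon)
  have h0 : ι K v * x = 0 := by
    have := ι_mul_mem v hx
    rwa [htop, Submodule.mem_bot] at this
  have h1 := contract_ι_mul η v x
  rw [h0, map_zero, h, mul_zero, sub_zero] at h1
  exact (smul_eq_zero.mp h1.symm).resolve_left hv

/-- A bivector with nonzero top power is nondegenerate. -/
theorem bivectorMap_injective {N : ℕ} (htop : extGrading K V (2 * N + 1) = ⊥)
    {a : ExteriorAlgebra K V} (ha : a ∈ extGrading K V 2) (haN : a ^ N ≠ 0) :
    Function.Injective (bivectorMap a) := by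
  rw [injective_iff_map_eq_zero]
  intro η hη
  by_contra hne
  -- An η in the kernel contracts a, hence a^N, to zero, although a^N is a nonzero element of top
  -- degree.
  refine haN (eq_zero_of_contract_top htop ?_ hne (contract_pow_eq_zero ha hη N))
  have : a ^ N ∈ (extGrading K V 2) ^ N := Submodule.pow_mem_pow _ ha N
  rwa [extGrading, exteriorPower, ← pow_mul] at this

/-- The element `(v, η)` of `Ṽ`. -/
def Tilde.mk (v : V) (η : Module.Dual K V) : Tilde K V := (v, η)

theorem cliff_mk_zero (v : V) (x : ExteriorAlgebra K V) :
    cliff (Tilde.mk v (0 : Module.Dual K V)) x = ι K v * x := by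
  rw [cliff_apply]
  change _ + contract 0 x = _
  rw [map_zero, LinearMap.zero_apply, add_zero]
  rfl

theorem cliff_zero_mk (η : Module.Dual K V) (x : ExteriorAlgebra K V) :
    cliff (Tilde.mk 0 η) x = contract η x := by
  rw [cliff_apply]
  change ι K 0 * x + _ = _
  rw [map_zero, zero_mul, zero_add]
  rfl

/-- The endomorphism `(v, η) ↦ (β η, 0)` of `Ṽ`. -/
def upperMap (β : Module.Dual K V →ₗ[K] V) : Module.End K (Tilde K V) :=
  LinearMap.prod (β ∘ₗ Tilde.snd K V) 0

/-- The endomorphism `(v, η) ↦ (v, -η)` of `Ṽ`. -/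
def gradOp (K V : Type*) [Field K] [AddCommGroup V] [Module K V] : Module.End K (Tilde K V) :=
  LinearMap.prod (Tilde.fst K V) (-Tilde.snd K V)

variable [FiniteDimensional K V]

theorem adj_upperMap {β : Module.Dual K V →ₗ[K] V} (hβ : ∀ η η' : Module.Dual K V, η' (β η) = -η (β η')) :
    adj (upperMap β) = -upperMap β := by
  refine (eq_adj fun x y => ?_).symm
  rw [tildeForm_apply, tildeForm_apply]
  change (-(0 : Module.Dual K V)) _ + Tilde.snd K V y (-(β (Tilde.snd K V x))) =
    Tilde.snd K V x (β (Tilde.snd K V y)) + (0 : Module.Dual K V) _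
  rw [hβ (Tilde.snd K V y), map_neg]
  simp

theorem adj_gradOp : adj (gradOp K V) = -gradOp K V := by
  refine (eq_adj fun x y => ?_).symm
  rw [tildeForm_apply, tildeForm_apply]
  change (-(-Tilde.snd K V x)) (Tilde.fst K V y) + Tilde.snd K V y (-Tilde.fst K V x) =
    Tilde.snd K V x (Tilde.fst K V y) + (-Tilde.snd K V y) (Tilde.fst K V x)
  rw [neg_neg, map_neg, LinearMap.neg_apply]

/-- The bivector defined by a skew map `V* → V`. -/
def toBivector : (Module.Dual K V →ₗ[K] V) →ₗ[K] ExteriorAlgebra K V where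
  toFun β := (4 : K)⁻¹ • ∑ i, (ι K (β ((Module.finBasis K V).coord i)) * ι K (Module.finBasis K V i)
    - ι K (Module.finBasis K V i) * ι K (β ((Module.finBasis K V).coord i)))
  map_add' β γ := by
    rw [← smul_add, ← Finset.sum_add_distrib]
    congr 1
    refine Finset.sum_congr rfl fun i _ => ?_
    rw [LinearMap.add_apply, map_add]
    noncomm_ring
  map_smul' c β := by
    rw [RingHom.id_apply, smul_comm c, Finset.smul_sum (r := c)]
    congr 1
    refine Finset.sum_congr rfl fun i _ => ?_
    rw [LinearMap.smul_apply, map_smul, smul_sub, smul_mul_assoc, mul_smul_comm]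

theorem toBivector_apply (β : Module.Dual K V →ₗ[K] V) : toBivector β =
    (4 : K)⁻¹ • ∑ i, (ι K (β ((Module.finBasis K V).coord i)) * ι K (Module.finBasis K V i)
    - ι K (Module.finBasis K V i) * ι K (β ((Module.finBasis K V).coord i))) := rfl

theorem toBivector_mem (β : Module.Dual K V →ₗ[K] V) : toBivector β ∈ extGrading K V 2 :=
  Submodule.smul_mem _ _ <| Submodule.sum_mem _ fun _ _ =>
    Submodule.sub_mem _ (ι_mul_ι_mem _ _) (ι_mul_ι_mem _ _)

/-- The map `upperMap β` kills the half of the frame in V. On the other half both Clifford vectors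
lie in V, so only wedge products occur. -/
theorem spin_upperMap (β : Module.Dual K V →ₗ[K] V) (x : ExteriorAlgebra K V) :
    spin (upperMap β) x = toBivector β * x := by
  rw [spin_apply, toBivector_apply, LinearMap.smul_apply, smul_mul_assoc, Fintype.sum_sum_type]
  congr 1
  have h1 : ∀ i, upperMap β (frame K V (Sum.inl i)) = 0 := by
    intro i
    refine Prod.ext ?_ rfl
    exact map_zero β
  have h2 : ∀ i y, cliff (upperMap β (frame K V (Sum.inr i))) y =
      ι K (β ((Module.finBasis K V).coord i)) * y := by
    intro i y
    rw [cliff_apply]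
    change _ + contract 0 y = _
    rw [map_zero, LinearMap.zero_apply, add_zero]
    rfl
  have h3 : ∀ i y, cliff (coframe K V (Sum.inr i)) y = ι K (Module.finBasis K V i) * y := by
    intro i y
    rw [cliff_apply]
    change _ + contract 0 y = _
    rw [map_zero, LinearMap.zero_apply, add_zero]
    rfl
  rw [LinearMap.add_apply, LinearMap.sum_apply, LinearMap.sum_apply, Finset.sum_mul]
  simp only [h1, map_zero, zero_lie, LinearMap.zero_apply, Finset.sum_const_zero, zero_add]
  refine Finset.sum_congr rfl fun i _ => ?_
  rw [Ring.lie_def, LinearMap.sub_apply, Module.End.mul_apply, Module.End.mul_apply, h2, h3, h3, h2,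
    sub_mul, mul_assoc, mul_assoc]

variable [CharZero K]

theorem toBivector_bivectorMap {a : ExteriorAlgebra K V} (ha : a ∈ extGrading K V 2) :
    toBivector (bivectorMap a) = a := by
  refine extGrading_two_induction (fun u v => ?_) (fun x y hx hy => ?_) ha
  · have hs : ∀ w : V, ∑ i, ((Module.finBasis K V).coord i w) • ι K (Module.finBasis K V i)
        = ι K w := by
      intro w
      simp only [← map_smul, ← map_sum]
      congr 1
      exact (Module.finBasis K V).sum_repr w
    have h : ∑ i, (ι K (bivectorMap (ι K u * ι K v) ((Module.finBasis K V).coord i))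
          * ι K (Module.finBasis K V i) - ι K (Module.finBasis K V i) *
          ι K (bivectorMap (ι K u * ι K v) ((Module.finBasis K V).coord i)))
        = (ι K u * ι K v - ι K v * ι K u) - (ι K v * ι K u - ι K u * ι K v) := by
      have hi : ∀ i, ι K (bivectorMap (ι K u * ι K v) ((Module.finBasis K V).coord i))
          * ι K (Module.finBasis K V i) - ι K (Module.finBasis K V i) *
          ι K (bivectorMap (ι K u * ι K v) ((Module.finBasis K V).coord i))
          = ι K u * ((Module.finBasis K V).coord i v • ι K (Module.finBasis K V i))
            - ι K v * ((Module.finBasis K V).coord i u • ι K (Module.finBasis K V i))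
            - ((Module.finBasis K V).coord i v • ι K (Module.finBasis K V i) * ι K u
            - (Module.finBasis K V).coord i u • ι K (Module.finBasis K V i) * ι K v) := by
        intro i
        rw [bivectorMap_ι_mul_ι, map_sub, map_smul, map_smul]
        simp only [sub_mul, mul_sub, smul_mul_assoc, mul_smul_comm]
      simp only [hi, Finset.sum_sub_distrib, ← Finset.mul_sum, ← Finset.sum_mul, hs]
    rw [toBivector_apply, h, ι_mul_ι_comm v u, sub_neg_eq_add, neg_sub_left, sub_neg_eq_add,
      ← two_smul K, ← two_smul K, smul_smul, smul_smul]
    norm_num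
  · rw [map_add, map_add, hx, hy]

/-- Evaluate `lie_spin_cliff` for `upperMap β` and (0, η) at the vector 1, which all contractions
kill. -/
theorem bivectorMap_toBivector {β : Module.Dual K V →ₗ[K] V}
    (hβ : ∀ η η' : Module.Dual K V, η' (β η) = -η (β η')) : bivectorMap (toBivector β) = β := by
  ext1 η
  have h := lie_spin_cliff (adj_upperMap hβ) (Tilde.mk 0 η)
  have h1 := LinearMap.congr_fun h 1
  have e : upperMap β (Tilde.mk 0 η) = Tilde.mk (β η) 0 := rfl
  rw [Ring.lie_def, LinearMap.sub_apply, Module.End.mul_apply, Module.End.mul_apply,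
    spin_upperMap, spin_upperMap, e, cliff_zero_mk, cliff_zero_mk, cliff_mk_zero, contract_one,
    mul_zero, mul_one, mul_one, zero_sub, contract_eq_bivectorMap (toBivector_mem β), neg_neg] at h1
  exact ι_leftInverse.injective h1

/-- Each of the 2 dim V commutators sends 1 to -1, and the factor is 1/4. -/
theorem spin_gradOp_one : spin (gradOp K V) (1 : ExteriorAlgebra K V) =
    (-(Module.finrank K V : K) / 2) • 1 := by
  rw [spin_apply, LinearMap.smul_apply, LinearMap.sum_apply, Fintype.sum_sum_type]
  have e1 : ∀ i, gradOp K V (frame K V (Sum.inl i)) = frame K V (Sum.inl i) := by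
    intro i
    exact Prod.ext rfl neg_zero
  have e2 : ∀ i, gradOp K V (frame K V (Sum.inr i)) = -frame K V (Sum.inr i) := by
    intro i
    exact Prod.ext neg_zero.symm rfl
  have hl : ∀ i y, cliff (frame K V (Sum.inl i)) y = ι K (Module.finBasis K V i) * y := by
    intro i y
    rw [cliff_apply]
    change _ + contract 0 y = _
    rw [map_zero, LinearMap.zero_apply, add_zero]
    rfl
  have hr : ∀ i y, cliff (frame K V (Sum.inr i)) y = contract ((Module.finBasis K V).coord i) y := by
    intro i y
    rw [cliff_apply]
    change ι K 0 * y + _ = _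
    rw [map_zero, zero_mul, zero_add]
    rfl
  have c1 : ∀ i, coframe K V (Sum.inl i) = frame K V (Sum.inr i) := fun _ => rfl
  have c2 : ∀ i, coframe K V (Sum.inr i) = frame K V (Sum.inl i) := fun _ => rfl
  have h : ∀ i, ⁅cliff (frame K V (Sum.inl i)), cliff (frame K V (Sum.inr i))⁆
      (1 : ExteriorAlgebra K V) = -1 := by
    intro i
    rw [Ring.lie_def, LinearMap.sub_apply, Module.End.mul_apply, Module.End.mul_apply, hl, hr, hr,
      hl, contract_one, mul_zero, mul_one, contract_ι, zero_sub, Module.Basis.coord_apply,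
      Module.Basis.repr_self, Finsupp.single_eq_same, map_one]
  have h' : ∀ i, ⁅-cliff (frame K V (Sum.inr i)), cliff (frame K V (Sum.inl i))⁆
      (1 : ExteriorAlgebra K V) = -1 := by
    intro i
    rw [neg_lie, lie_skew, h]
  simp only [e1, e2, c1, c2, map_neg, h, h', Finset.sum_const, Finset.card_univ, Fintype.card_fin]
  rw [← add_smul, smul_neg, ← Nat.cast_smul_eq_nsmul K, smul_neg, smul_smul, ← neg_smul]
  congr 1
  push_cast
  ring

/-- The grading operator acts on `⋀^i V` as multiplication by `i - dim V / 2`. -/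
theorem spin_gradOp {i : ℕ} {x : ExteriorAlgebra K V} (hx : x ∈ extGrading K V i) :
    spin (gradOp K V) x = ((i : K) - (Module.finrank K V : K) / 2) • x := by
  induction i generalizing x with
  | zero =>
    obtain ⟨c, rfl⟩ := mem_extGrading_zero.mp hx
    rw [map_smul, spin_gradOp_one, smul_comm]
    congr 2
    push_cast
    ring
  | succ i ih =>
    refine extGrading_succ_induction (fun v y hy => ?_) (fun x y hx hy => ?_) hx
    · have h := lie_spin_cliff (adj_gradOp (K := K) (V := V)) (Tilde.mk v 0)
      have h1 := LinearMap.congr_fun h y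
      have e : gradOp K V (Tilde.mk v 0) = Tilde.mk v 0 := Prod.ext rfl neg_zero
      rw [e, Ring.lie_def, LinearMap.sub_apply, Module.End.mul_apply, Module.End.mul_apply,
        cliff_mk_zero, cliff_mk_zero, ih hy, mul_smul_comm] at h1
      rw [eq_add_of_sub_eq h1, add_comm]
      nth_rewrite 2 [← one_smul K (ι K v * y)]
      rw [← add_smul]
      congr 1
      push_cast
      ring
    · rw [map_add, hx, hy, smul_add]

end Bivectors

/-! ### Hard Lefschetz from sl₂-triples -/

section SlTwo

variable {K M : Type*} [Field K] [AddCommGroup M] [Module K M]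

/-- The relations of the standard generators of `sl₂`. -/
structure SlTwoRelations (e h f : Module.End K M) : Prop where
  lie_h_e : ⁅h, e⁆ = (2 : K) • e
  lie_h_f : ⁅h, f⁆ = -((2 : K) • f)
  lie_e_f : ⁅e, f⁆ = h

namespace SlTwoRelations

variable {e h f : Module.End K M} (H : SlTwoRelations e h f)
include H

theorem symm : SlTwoRelations f (-h) e where
  lie_h_e := by rw [neg_lie, H.lie_h_f, neg_neg]
  lie_h_f := by rw [neg_lie, H.lie_h_e]
  lie_e_f := by rw [← lie_skew, H.lie_e_f]

theorem h_e (x : M) : h (e x) = e (h x) + (2 : K) • e x := by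
  have := LinearMap.congr_fun H.lie_h_e x
  rw [Ring.lie_def, LinearMap.sub_apply, Module.End.mul_apply, Module.End.mul_apply] at this
  rw [eq_add_of_sub_eq' this, LinearMap.smul_apply]

theorem h_f (x : M) : h (f x) = f (h x) - (2 : K) • f x := by
  have := LinearMap.congr_fun H.lie_h_f x
  rw [Ring.lie_def, LinearMap.sub_apply, Module.End.mul_apply, Module.End.mul_apply] at this
  rw [eq_add_of_sub_eq' this, LinearMap.neg_apply, LinearMap.smul_apply, sub_eq_add_neg]

theorem e_f (x : M) : e (f x) = f (e x) + h x := by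
  have := LinearMap.congr_fun H.lie_e_f x
  rw [Ring.lie_def, LinearMap.sub_apply, Module.End.mul_apply, Module.End.mul_apply] at this
  rw [eq_add_of_sub_eq' this]

theorem h_e_pow {x : M} {c : K} (hx : h x = c • x) (j : ℕ) :
    h ((e ^ j) x) = (c + 2 * j) • (e ^ j) x := by
  induction j with
  | zero => simpa using hx
  | succ j ih =>
    rw [pow_succ', Module.End.mul_apply, H.h_e, ih, map_smul, ← add_smul]
    congr 1
    push_cast
    ring

theorem h_f_pow {x : M} {c : K} (hx : h x = c • x) (j : ℕ) :
    h ((f ^ j) x) = (c - 2 * j) • (f ^ j) x := by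
  induction j with
  | zero => simpa using hx
  | succ j ih =>
    rw [pow_succ', Module.End.mul_apply, H.h_f, ih, map_smul, ← sub_smul]
    congr 1
    push_cast
    ring

theorem e_f_pow {x : M} {c : K} (hx : h x = c • x) (hfe : f (e x) = 0) (j : ℕ) :
    e ((f ^ (j + 1)) x) = ((j + 1) * (c - j)) • (f ^ j) x := by
  induction j with
  | zero =>
    rw [zero_add, pow_one, H.e_f, hfe, hx, pow_zero, Module.End.one_apply, zero_add]
    congr 1
    push_cast
    ring
  | succ j ih =>
    rw [pow_succ', Module.End.mul_apply, H.e_f, ih, H.h_f_pow hx, map_smul, ← Module.End.mul_apply,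
      ← pow_succ', ← add_smul]
    congr 1
    push_cast
    ring

theorem e_pow_f {x : M} {c : K} (hx : h x = c • x) (r : ℕ) :
    (e ^ (r + 1)) (f x) = f ((e ^ (r + 1)) x) + ((r + 1) * (c + r)) • (e ^ r) x := by
  induction r with
  | zero =>
    rw [zero_add, pow_one, H.e_f, hx, pow_zero, Module.End.one_apply]
    congr 2
    push_cast
    ring
  | succ r ih =>
    rw [pow_succ', Module.End.mul_apply, ih, map_add, H.e_f, map_smul, ← Module.End.mul_apply e,
      ← pow_succ', ← Module.End.mul_apply e, ← pow_succ', H.h_e_pow hx, add_assoc, ← add_smul]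
    congr 2
    push_cast
    ring

variable [CharZero K] [FiniteDimensional K M]

/-- Otherwise h would have the infinitely many eigenvalues c - 2j. -/
theorem exists_f_pow_eq_zero {x : M} {c : K} (hx : h x = c • x) : ∃ j : ℕ, (f ^ j) x = 0 := by
  by_contra! hne
  have hev : ∀ j : ℕ, Module.End.HasEigenvalue h (c - 2 * j) := fun j =>
    Module.End.hasEigenvalue_of_hasEigenvector
      (Module.End.hasEigenvector_iff.mpr ⟨Module.End.mem_eigenspace_iff.mpr (H.h_f_pow hx j), hne j⟩)
  have hfin := Module.End.finite_hasEigenvalue h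
  refine Set.infinite_of_injective_forall_mem (f := fun j : ℕ => c - 2 * (j : K)) ?_ hev hfin
  intro i j hij
  have : (2 : K) * i = 2 * j := sub_right_injective hij
  exact_mod_cast mul_left_cancel₀ two_ne_zero this

/-- A vector `x` of negative weight with `f e x = 0` vanishes. -/
theorem eq_zero_of_neg {x : M} {w : ℤ} (hw : w < 0) (hx : h x = (w : K) • x) (hfe : f (e x) = 0) :
    x = 0 := by
  by_contra hne
  obtain ⟨j, hj, hj'⟩ := Nat.exists_not_and_succ_of_not_zero_of_exists
    (p := fun j => (f ^ j) x = 0) (by simpa using hne) (H.exists_f_pow_eq_zero hx)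
  -- At the last nonzero f^j x this gives (j + 1)(w - j) = 0, impossible for w < 0.
  have := H.e_f_pow hx hfe j
  rw [hj', map_zero, eq_comm, smul_eq_zero] at this
  have h0 : ((j : K) + 1) * ((w : K) - j) = 0 := this.resolve_right hj
  have h1 : ((j : ℤ) + 1) * (w - j) = 0 := by exact_mod_cast h0
  rcases mul_eq_zero.mp h1 with h1 | h1 <;> omega

/-- Gives injectivity of e^r on weight -r directly, without complete reducibility. By induction, e x
is a nonzero vector killed by a lower power of e, which leaves one critical weight to exclude. -/
theorem le_weight {r : ℕ} {x : M} {w : ℤ} (hne : x ≠ 0) (hx : h x = (w : K) • x)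
    (he : (e ^ r) x = 0) : 1 - (r : ℤ) ≤ w := by
  induction r generalizing x w with
  | zero => exact absurd he (by simpa using hne)
  | succ r ih =>
    by_contra hlt
    push Not at hlt
    push_cast at hlt
    have hex : e x ≠ 0 := fun h0 =>
      hne (H.eq_zero_of_neg (by omega) hx (by rw [h0, map_zero]))
    have he' : (e ^ r) (e x) = 0 := by rwa [← Module.End.mul_apply, ← pow_succ]
    have hwe : h (e x) = ((w + 2 : ℤ) : K) • e x := by
      rw [H.h_e, hx, map_smul, ← add_smul]
      push_cast
      rfl
    have h1 := ih hex hwe he'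
    obtain rfl : w = -(r : ℤ) - 1 := by omega
    cases r with
    | zero => exact hex (by simpa using he')
    | succ r =>
      have hfe : f (e x) ≠ 0 := fun h0 => hne (H.eq_zero_of_neg (by omega) hx h0)
      -- At the critical weight, f e x is nonzero of the same weight as x. The coefficient in
      -- `e_pow_f` vanishes there, so a lower power of e kills f e x and the induction hypothesis
      -- applies to it.
      have h2 : h (f (e x)) = ((-((r + 1 : ℕ) : ℤ) - 1 : ℤ) : K) • f (e x) := by
        rw [H.h_f, hwe, map_smul, ← sub_smul]
        congr 1
        push_cast
        ring
      have h3 : (e ^ (r + 1)) (f (e x)) = 0 := by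
        rw [H.e_pow_f hwe, he', map_zero, zero_add]
        have : ((-((r + 1 : ℕ) : ℤ) - 1 + 2 : ℤ) : K) + r = 0 := by push_cast; ring
        rw [this, mul_zero, zero_smul]
      have := ih hfe h2 h3
      omega

/-- By `le_weight`, e^k is injective on weight -k. The opposite triple makes f^k injective on weight
k, so the dimensions agree and e^k is bijective. -/
theorem hardLefschetz {ℳ : ℤ → Submodule K M} (hℳ : ∀ k x, x ∈ ℳ k ↔ h x = (k : K) • x) :
    HardLefschetz ℳ e where
  degree k x hx := by
    rw [hℳ] at hx ⊢
    rw [H.h_e, hx, map_smul, ← add_smul]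
    push_cast
    rfl
  bijOn k := by
    have hinj : ∀ {e h f : Module.End K M} (_ : SlTwoRelations e h f) (x : M),
        h x = ((-k : ℤ) : K) • x → (e ^ k) x = 0 → x = 0 := by
      intro e h f H x hx h0
      by_contra hne
      have := H.le_weight hne hx h0
      omega
    have he : ∀ x ∈ ℳ (-k), (e ^ k) x ∈ ℳ k := by
      intro x hx
      rw [hℳ] at hx ⊢
      rw [H.h_e_pow hx]
      congr 1
      push_cast
      ring
    have hf : ∀ x ∈ ℳ k, (f ^ k) x ∈ ℳ (-k) := by
      intro x hx
      rw [hℳ] at hx ⊢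
      rw [H.h_f_pow hx]
      congr 1
      push_cast
      ring
    let E : ℳ (-k) →ₗ[K] ℳ k := (e ^ k).restrict he
    let F : ℳ k →ₗ[K] ℳ (-k) := (f ^ k).restrict hf
    have hE : Function.Injective E := by
      rw [injective_iff_map_eq_zero]
      exact fun x hx => Subtype.ext (hinj H x ((hℳ _ _).mp x.2) (congrArg Subtype.val hx))
    have hF : Function.Injective F := by
      rw [injective_iff_map_eq_zero]
      refine fun x hx => Subtype.ext (hinj H.symm x ?_ (congrArg Subtype.val hx))
      rw [LinearMap.neg_apply, (hℳ _ _).mp x.2, ← neg_smul]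
      push_cast
      rfl
    have hd : Module.finrank K (ℳ (-k)) = Module.finrank K (ℳ k) :=
      le_antisymm (LinearMap.finrank_le_finrank_of_injective hE)
        (LinearMap.finrank_le_finrank_of_injective hF)
    have hs : Function.Surjective E :=
      (LinearMap.injective_iff_surjective_of_finrank_eq_finrank hd).mp hE
    refine ⟨he, fun x hx y hy hxy => ?_, fun y hy => ?_⟩
    · exact congrArg Subtype.val (hE (a₁ := ⟨x, hx⟩) (a₂ := ⟨y, hy⟩) (Subtype.ext hxy))
    · obtain ⟨x, hx⟩ := hs ⟨y, hy⟩
      exact ⟨x, x.2, congrArg Subtype.val hx⟩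

theorem isLefschetzTriple {ℳ : ℤ → Submodule K M} (hℳ : ∀ k x, x ∈ ℳ k ↔ h x = (k : K) • x) :
    IsLefschetzTriple ℳ e h f where
  hardLefschetz := H.hardLefschetz hℳ
  grading k x hx := (hℳ k x).mp hx
  degree k x hx := by
    rw [hℳ] at hx ⊢
    rw [H.h_f, hx, map_smul, ← sub_smul]
    push_cast
    rw [sub_eq_add_neg]
  lie_h_e := H.lie_h_e
  lie_h_f := H.lie_h_f
  lie_e_f := H.lie_e_f

/-- Apply sl₂-theory to the adjoint action on End(M): f' - f has weight -2 and is killed by ad e,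
hence vanishes. -/
theorem f_unique {f' : Module.End K M} (H' : SlTwoRelations e h f') : f' = f := by
  have Had : SlTwoRelations (LieAlgebra.ad K (Module.End K M) e)
      (LieAlgebra.ad K (Module.End K M) h) (LieAlgebra.ad K (Module.End K M) f) :=
    { lie_h_e := by rw [← LieHom.map_lie, H.lie_h_e, map_smul]
      lie_h_f := by rw [← LieHom.map_lie, H.lie_h_f, map_neg, map_smul]
      lie_e_f := by rw [← LieHom.map_lie, H.lie_e_f] }
  rw [← sub_eq_zero]
  refine Had.eq_zero_of_neg (w := -2) (by norm_num) ?_ ?_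
  · rw [LieAlgebra.ad_apply, lie_sub, H'.lie_h_f, H.lie_h_f]
    push_cast
    rw [neg_smul, smul_sub]
    abel
  · rw [LieAlgebra.ad_apply K _ e, lie_sub, H'.lie_e_f, H.lie_e_f, sub_self, map_zero]

end SlTwoRelations

theorem IsLefschetzTriple.slTwoRelations {ℳ : ℤ → Submodule K M} {e h f : Module.End K M}
    (H : IsLefschetzTriple ℳ e h f) : SlTwoRelations e h f :=
  ⟨H.lie_h_e, H.lie_h_f, H.lie_e_f⟩

theorem IsGradingOperator.unique {ℳ : ℤ → Submodule K M} {h h' : Module.End K M}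
    (hspan : ⨆ k, ℳ k = ⊤) (H : IsGradingOperator ℳ h) (H' : IsGradingOperator ℳ h') : h = h' := by
  refine LinearMap.ext fun x => ?_
  have hx : x ∈ ⨆ k, ℳ k := hspan ▸ Submodule.mem_top
  induction hx using Submodule.iSup_induction' with
  | mem k x hx => rw [H k x hx, H' k x hx]
  | zero => rw [map_zero, map_zero]
  | add x y _ _ hx hy => rw [map_add, map_add, hx, hy]

end SlTwo

/-! ### The factor of K[G], the commutant and its involution -/

section Commutant

variable {K G V W : Type*} [Field K] [Group G]
  [AddCommGroup V] [Module K V] [AddCommGroup W] [Module K W]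

theorem map_asAlgebraHom {τ : Representation K G V} {ρ : Representation K G W}
    (f : τ.IntertwiningMap ρ) (x : MonoidAlgebra K G) (v : V) :
    f (τ.asAlgebraHom x v) = ρ.asAlgebraHom x (f v) := by
  induction x using MonoidAlgebra.induction_linear with
  | zero => simp only [map_zero, LinearMap.zero_apply]
  | add x y hx hy => simp only [map_add, LinearMap.add_apply, hx, hy]
  | single g c =>
    simp only [Representation.asAlgebraHom_single, LinearMap.smul_apply, map_smul,
      f.isIntertwining]

/-- The factor of `K[G]` associated to `[ρ]` contains an element that acts as the identity. -/
theorem exists_mem_factor [CharZero K] [Finite G] (ρ : Representation K G W) :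
    ∃ u ∈ factor ρ, ρ.asAlgebraHom u = 1 ∧ ρ.dual.asAlgebraHom u = 1 := by
  let I : Submodule (MonoidAlgebra K G) (MonoidAlgebra K G) :=
    { carrier := {y | ρ.asAlgebraHom y = 0 ∧ ρ.dual.asAlgebraHom y = 0}
      zero_mem' := ⟨map_zero _, map_zero _⟩
      add_mem' := fun {x y} hx hy => by
        constructor
        · rw [map_add, hx.1, hy.1, add_zero]
        · rw [map_add, hx.2, hy.2, add_zero]
      smul_mem' := fun c x hx => by
        constructor
        · rw [smul_eq_mul, map_mul, hx.1, mul_zero]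
        · rw [smul_eq_mul, map_mul, hx.2, mul_zero] }
  -- By Maschke, I has a complementary left ideal. The I-component ε of 1 is a right unit of I. As I
  -- is stable under g ↦ g⁻¹, the image of ε is a left unit, so both coincide, and 1 - ε annihilates
  -- I on both sides while acting as 1 on ρ and ρ*.
  have hI : ∀ y, y ∈ I ↔ ρ.asAlgebraHom y = 0 ∧ ρ.dual.asAlgebraHom y = 0 := fun _ => Iff.rfl
  have hInv : ∀ y ∈ I, groupInv K G y ∈ I := by
    intro y hy
    rw [hI] at hy ⊢
    rw [dual_asAlgebraHom_eq_zero] at hy ⊢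
    rw [groupInv_groupInv]
    exact hy.symm
  obtain ⟨J, hJ⟩ := MonoidAlgebra.Submodule.exists_isCompl I
  obtain ⟨ε, hε, u, hu, h1⟩ := Submodule.mem_sup.mp
    (hJ.sup_eq_top ▸ Submodule.mem_top : (1 : MonoidAlgebra K G) ∈ I ⊔ J)
  have hright : ∀ y ∈ I, y * ε = y := by
    intro y hy
    have e : y * ε + y * u = y := by rw [← mul_add, h1, mul_one]
    have h0 : y * u ∈ I ⊓ J := by
      refine ⟨?_, J.smul_mem y hu⟩
      rw [eq_sub_of_add_eq' e]
      exact I.sub_mem hy (I.smul_mem y hε)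
    rw [hJ.inf_eq_bot, Submodule.mem_bot] at h0
    rwa [h0, add_zero] at e
  have hleft' : ∀ y ∈ I, groupInv K G ε * y = y := by
    intro y hy
    have := congrArg (groupInv K G) (hright _ (hInv y hy))
    rwa [groupInv_mul, groupInv_groupInv] at this
  have hεε : groupInv K G ε = ε := by
    rw [← hright _ (hInv ε hε), hleft' ε hε]
  have hleft : ∀ y ∈ I, ε * y = y := by
    rwa [hεε] at hleft'
  obtain rfl : u = 1 - ε := eq_sub_of_add_eq' h1
  refine ⟨1 - ε, fun y hy hy' => ?_, ?_, ?_⟩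
  · rw [sub_mul, mul_sub, one_mul, mul_one, hleft y ⟨hy, hy'⟩, hright y ⟨hy, hy'⟩, sub_self]
    exact ⟨rfl, rfl⟩
  · rw [map_sub, hε.1, map_one, sub_zero]
  · rw [map_sub, hε.2, map_one]
    exact sub_zero (1 : Module.End K (Module.Dual K W))

theorem mul_mem_factor (ρ : Representation K G W) {x : MonoidAlgebra K G} (hx : x ∈ factor ρ)
    (z : MonoidAlgebra K G) : z * x ∈ factor ρ := by
  intro y h h'
  have h2 := hx (y * z) (by rw [map_mul, h, zero_mul]) (by rw [map_mul, h', zero_mul])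
  exact ⟨by rw [mul_assoc, (hx y h h').1, mul_zero], by rw [← mul_assoc, h2.2]⟩

/-- The projections to and the inclusions of the summands of `ρ ^ m`. -/
theorem exists_coordinates_of_power (ρ : Representation K G W) (m : ℕ) :
    ∃ (π : Fin m → (power ρ m).IntertwiningMap ρ) (ι : Fin m → ρ.IntertwiningMap (power ρ m)),
      ∀ v, ∑ i, ι i (π i v) = v := by
  refine ⟨fun i => ⟨DirectSum.component K (Fin m) (fun _ => W) i, fun g => ?_⟩,
    fun i => ⟨DirectSum.lof K (Fin m) (fun _ => W) i, fun g => ?_⟩, fun v => ?_⟩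
  · refine LinearMap.ext fun v => ?_
    exact DirectSum.lmap_apply (fun _ : Fin m => ρ g) v i
  · refine LinearMap.ext fun v => ?_
    simp [power]
  · change ∑ i, DirectSum.lof K (Fin m) (fun _ => W) i (DirectSum.component K (Fin m) _ i v) = v
    classical
    exact DirectSum.sum_univ_of v

theorem IsIsotypic.exists_coordinates {τ : Representation K G V} {ρ : Representation K G W} {m : ℕ}
    (hτ : IsIsotypic τ ρ m) (h : IsSelfDual ρ) :
    ∃ (π : Fin m → τ.IntertwiningMap ρ) (ι : Fin m → ρ.IntertwiningMap τ),
      ∀ v, ∑ i, ι i (π i v) = v := by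
  obtain ⟨φ⟩ := hτ.1 h
  obtain ⟨π, ι, hs⟩ := exists_coordinates_of_power ρ m
  refine ⟨fun i => (π i).comp φ.toIntertwiningMap, fun i => φ.symm.toIntertwiningMap.comp (ι i),
    fun v => ?_⟩
  change ∑ i, φ.symm (ι i (π i (φ v))) = v
  rw [← map_sum, hs, φ.symm_apply_apply]

theorem IsIsotypic.exists_coordinates' {τ : Representation K G V} {ρ : Representation K G W}
    {m : ℕ} (hτ : IsIsotypic τ ρ m) (h : ¬ IsSelfDual ρ) :
    ∃ (π : Fin m → τ.IntertwiningMap ρ) (ι : Fin m → ρ.IntertwiningMap τ)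
      (π' : Fin m → τ.IntertwiningMap ρ.dual) (ι' : Fin m → ρ.dual.IntertwiningMap τ),
      ∀ v, ∑ i, ι i (π i v) + ∑ i, ι' i (π' i v) = v := by
  obtain ⟨φ⟩ := hτ.2 h
  obtain ⟨π, ι, hs⟩ := exists_coordinates_of_power ρ m
  obtain ⟨π', ι', hs'⟩ := exists_coordinates_of_power ρ.dual m
  refine ⟨fun i => (π i).comp ((Representation.IntertwiningMap.fst K _ _).comp φ.toIntertwiningMap),
    fun i => φ.symm.toIntertwiningMap.comp ((Representation.IntertwiningMap.inl K _ _).comp (ι i)),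
    fun i => (π' i).comp ((Representation.IntertwiningMap.snd K _ _).comp φ.toIntertwiningMap),
    fun i => φ.symm.toIntertwiningMap.comp ((Representation.IntertwiningMap.inr K _ _).comp (ι' i)),
    fun v => ?_⟩
  change ∑ i, φ.symm (Representation.IntertwiningMap.inl K _ _ (ι i (π i (φ v).1)))
    + ∑ i, φ.symm (Representation.IntertwiningMap.inr K _ _ (ι' i (π' i (φ v).2))) = v
  rw [← map_sum, ← map_sum, ← map_sum, ← map_sum, hs, hs', ← map_add]
  have : Representation.IntertwiningMap.inl K (power ρ m) (power ρ.dual m) (φ v).1 +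
      Representation.IntertwiningMap.inr K (power ρ m) (power ρ.dual m) (φ v).2 = φ v :=
    Prod.ext (add_zero _) (zero_add _)
  rw [this, φ.symm_apply_apply]

theorem IsIsotypic.asAlgebraHom_eq_one {τ : Representation K G V} {ρ : Representation K G W}
    {m : ℕ} (hτ : IsIsotypic τ ρ m) {x : MonoidAlgebra K G} (h : ρ.asAlgebraHom x = 1)
    (h' : ρ.dual.asAlgebraHom x = 1) : τ.asAlgebraHom x = 1 := by
  refine LinearMap.ext fun v => ?_
  by_cases hd : IsSelfDual ρ
  · obtain ⟨π, ι, hs⟩ := hτ.exists_coordinates hd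
    rw [← hs (τ.asAlgebraHom x v)]
    simp only [map_asAlgebraHom, h, Module.End.one_apply, hs]
  · obtain ⟨π, ι, π', ι', hs⟩ := hτ.exists_coordinates' hd
    rw [← hs (τ.asAlgebraHom x v)]
    simp only [map_asAlgebraHom, h, h', Module.End.one_apply, hs]

/-- The factor contains some u acting as the identity on Ṽ, so g u lies in the factor and acts as g.
Commuting with A therefore means commuting with G. -/
theorem mem_tildeA_iff [CharZero K] [Finite G] {τ : Representation K G V}
    {ρ : Representation K G W} {m : ℕ} [FiniteDimensional K W] (hτ : IsIsotypic τ ρ m)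
    {f : Module.End K (Tilde K V)} : f ∈ tildeA τ ρ ↔ ∀ g, f * tilde τ g = tilde τ g * f := by
  constructor
  · intro hf g
    obtain ⟨u, hu, h1, h1'⟩ := exists_mem_factor ρ
    have hd : ρ.asAlgebraHom (groupInv K G u) = 1 := by
      refine LinearMap.ext fun w => (Module.forall_dual_apply_eq_zero_iff K _).mp ?_ |> sub_eq_zero.mp
      intro η
      rw [map_sub, ← dual_asAlgebraHom, h1', sub_eq_zero]
      rfl
    have hd' : ρ.dual.asAlgebraHom (groupInv K G u) = 1 := by
      refine LinearMap.ext fun η => LinearMap.ext fun w => ?_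
      rw [dual_asAlgebraHom, groupInv_groupInv, h1]
      rfl
    have hone : (tilde τ).asAlgebraHom u = 1 := by
      refine LinearMap.ext fun z => Prod.ext ?_ ?_
      · change Tilde.fst K V _ = Tilde.fst K V z
        rw [fst_tilde, hτ.asAlgebraHom_eq_one h1 h1', Module.End.one_apply]
      · change Tilde.snd K V _ = Tilde.snd K V z
        rw [snd_tilde]
        refine LinearMap.ext fun v => ?_
        rw [dual_asAlgebraHom, hτ.asAlgebraHom_eq_one hd hd', Module.End.one_apply]
    rw [tildeA, Subalgebra.mem_centralizer_iff] at hf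
    have := hf _ ⟨_, mul_mem_factor ρ hu (MonoidAlgebra.single g 1), rfl⟩
    simp only [map_mul, hone, mul_one, Representation.asAlgebraHom_single, one_smul] at this
    exact this.symm
  · intro h
    rw [tildeA, Subalgebra.mem_centralizer_iff]
    rintro _ ⟨x, -, rfl⟩
    change (tilde τ).asAlgebraHom x * f = f * (tilde τ).asAlgebraHom x
    induction x using MonoidAlgebra.induction_linear with
    | zero => rw [map_zero, zero_mul, mul_zero]
    | add x y hx hy => rw [map_add, add_mul, mul_add, hx, hy]
    | single g c =>
      rw [Representation.asAlgebraHom_single, smul_mul_assoc, mul_smul_comm, h]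

/-- The algebra of endomorphisms of a representation. -/
def commutant (τ : Representation K G V) : Subalgebra K (Module.End K V) :=
  Subalgebra.centralizer K (Set.range τ)

theorem mem_commutant {τ : Representation K G V} {x : Module.End K V} :
    x ∈ commutant τ ↔ ∀ g v, x (τ g v) = τ g (x v) := by
  rw [commutant, Subalgebra.mem_centralizer_iff]
  constructor
  · intro h g v
    exact (LinearMap.congr_fun (h _ ⟨g, rfl⟩) v).symm
  · rintro h _ ⟨g, rfl⟩
    exact LinearMap.ext fun v => (h g v).symm

/-- The endomorphism algebra of a multiple of an irreducible representation is prime. -/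
theorem commutant_prime {τ : Representation K G V} {ρ : Representation K G W}
    [ρ.IsIrreducible] {m : ℕ} {π : Fin m → τ.IntertwiningMap ρ} {ι : Fin m → ρ.IntertwiningMap τ}
    (hs : ∀ v, ∑ i, ι i (π i v) = v) (x y : commutant τ) (h : ∀ z, x * z * y = 0) :
    x = 0 ∨ y = 0 := by
  by_contra! hne
  obtain ⟨hx, hy⟩ := hne
  obtain ⟨i, hi⟩ : ∃ i, ∃ w, x.1 (ι i w) ≠ 0 := by
    by_contra! hcon
    refine hx (Subtype.ext (LinearMap.ext fun v => ?_))
    rw [← hs v, map_sum]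
    simp [hcon]
  obtain ⟨j, hj⟩ : ∃ j, ∃ v, π j (y.1 v) ≠ 0 := by
    by_contra! hcon
    refine hy (Subtype.ext (LinearMap.ext fun v => ?_))
    rw [← hs (y.1 v)]
    simp [hcon]
  -- By irreducibility, x ∘ ιᵢ is injective and πⱼ ∘ y is surjective. With z = ιᵢ πⱼ the product x z
  -- y is their composite, which is nonzero.
  let f : ρ.IntertwiningMap τ := LinearMap.intertwiningMap_of_isIntertwiningMap _ _
    (x.1 ∘ₗ (ι i).toLinearMap) fun g w => by
      change x.1 (ι i (ρ g w)) = τ g (x.1 (ι i w))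
      rw [(ι i).isIntertwining, mem_commutant.mp x.2]
  let k : τ.IntertwiningMap ρ := LinearMap.intertwiningMap_of_isIntertwiningMap _ _
    ((π j).toLinearMap ∘ₗ y.1) fun g w => by
      change π j (y.1 (τ g w)) = ρ g (π j (y.1 w))
      rw [mem_commutant.mp y.2, (π j).isIntertwining]
  have hf := (Representation.IsIrreducible.injective_or_eq_zero f).resolve_right fun h0 =>
    hi.elim fun w hw => hw (DFunLike.congr_fun h0 w)
  have hk := (Representation.IsIrreducible.surjective_or_eq_zero k).resolve_right fun h0 =>
    hj.elim fun w hw => hw (DFunLike.congr_fun h0 w)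
  obtain ⟨w, hw⟩ := hi
  have hw0 : w ≠ 0 := fun h0 => hw (by rw [h0, map_zero, map_zero])
  obtain ⟨v, hv⟩ := hk w
  let z : commutant τ := ⟨(ι i).toLinearMap ∘ₗ (π j).toLinearMap, mem_commutant.mpr fun g v => by
    change ι i (π j (τ g v)) = τ g (ι i (π j v))
    rw [(π j).isIntertwining, (ι i).isIntertwining]⟩
  have h0 : f (k v) = 0 := LinearMap.congr_fun (congrArg Subtype.val (h z)) v
  rw [hv] at h0
  exact hw0 (hf (h0.trans (map_zero f).symm))

/-- There are no nonzero equivariant maps between a representation and its dual if it is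
irreducible and not self-dual. -/
theorem eq_zero_of_not_isSelfDual [FiniteDimensional K W] {ρ : Representation K G W}
    [ρ.IsIrreducible] (h : ¬ IsSelfDual ρ) (f : ρ.IntertwiningMap ρ.dual) : f = 0 := by
  refine (Representation.IsIrreducible.injective_or_eq_zero f).resolve_left fun hf => h ?_
  exact ⟨f.ofBijective ⟨hf, (LinearMap.injective_iff_surjective_of_finrank_eq_finrank
    (f := f.toLinearMap) (Subspace.dual_finrank_eq (K := K) (V := W)).symm).mp hf⟩⟩

theorem eq_zero_of_not_isSelfDual' [FiniteDimensional K W] {ρ : Representation K G W}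
    [ρ.IsIrreducible] (h : ¬ IsSelfDual ρ) (f : ρ.dual.IntertwiningMap ρ) : f = 0 := by
  refine (Representation.IsIrreducible.surjective_or_eq_zero f).resolve_left fun hf => h ?_
  exact ⟨(f.ofBijective ⟨(LinearMap.injective_iff_surjective_of_finrank_eq_finrank
    (f := f.toLinearMap) (Subspace.dual_finrank_eq (K := K) (V := W))).mpr hf, hf⟩).symm⟩

/-- An equivariant isomorphism `V* → V` that is skew, i.e. a nondegenerate invariant bivector. -/
structure SkewIso (τ : Representation K G V) where
  toEquiv : Module.Dual K V ≃ₗ[K] V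
  skew : ∀ η η' : Module.Dual K V, η' (toEquiv η) = -η (toEquiv η')
  equivariant : ∀ g η, toEquiv (τ.dual g η) = τ g (toEquiv η)

namespace SkewIso

variable {τ : Representation K G V} (J : SkewIso τ)

theorem comp_mem_dual (x : commutant τ) (g : G) (η : Module.Dual K V) :
    τ.dual g η ∘ₗ x.1 = τ.dual g (η ∘ₗ x.1) := by
  refine LinearMap.ext fun v => ?_
  change η (τ g⁻¹ (x.1 v)) = η (x.1 (τ g⁻¹ v))
  rw [mem_commutant.mp x.2]

theorem dagger_mem (x : commutant τ) :
    (J.toEquiv : _ →ₗ[K] V) ∘ₗ x.1.dualMap ∘ₗ (J.toEquiv.symm : V →ₗ[K] _) ∈ commutant τ := by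
  rw [mem_commutant]
  intro g v
  obtain ⟨η, rfl⟩ := J.toEquiv.surjective v
  rw [← J.equivariant]
  simp only [LinearMap.comp_apply, LinearEquiv.coe_coe, LinearEquiv.symm_apply_apply]
  change J.toEquiv (τ.dual g η ∘ₗ x.1) = τ g (J.toEquiv (η ∘ₗ x.1))
  rw [comp_mem_dual, J.equivariant]

/-- The adjoint of an endomorphism of `V`. -/
def daggerMap : commutant τ →ₗ[K] commutant τ where
  toFun x := ⟨_, J.dagger_mem x⟩
  map_add' x y := Subtype.ext <| LinearMap.ext fun v => by
    change J.toEquiv (J.toEquiv.symm v ∘ₗ (x.1 + y.1)) = _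
    rw [LinearMap.comp_add, map_add]
    rfl
  map_smul' c x := Subtype.ext <| LinearMap.ext fun v => by
    change J.toEquiv (J.toEquiv.symm v ∘ₗ (c • x.1)) = _
    rw [LinearMap.comp_smul, map_smul]
    rfl

theorem daggerMap_apply (x : commutant τ) (η : Module.Dual K V) :
    (J.daggerMap x).1 (J.toEquiv η) = J.toEquiv (η ∘ₗ x.1) := by
  change J.toEquiv (J.toEquiv.symm (J.toEquiv η) ∘ₗ x.1) = _
  rw [LinearEquiv.symm_apply_apply]

/-- Testing against η' uses the skewness of J twice and the signs cancel. This makes the adjoint an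
involution. -/
theorem comp_daggerMap (x : commutant τ) (η : Module.Dual K V) :
    J.toEquiv (η ∘ₗ (J.daggerMap x).1) = x.1 (J.toEquiv η) := by
  rw [← sub_eq_zero, ← Module.forall_dual_apply_eq_zero_iff K]
  intro η'
  rw [map_sub, J.skew, LinearMap.comp_apply, daggerMap_apply, J.skew (η' ∘ₗ x.1), neg_neg,
    LinearMap.comp_apply, sub_self]

/-- The involution of `End_G(V)` defined by an equivariant skew isomorphism `V* → V`. -/
def dagger : AlgInvolution K (commutant τ) where
  toLinearMap := J.daggerMap
  map_mul_rev' x y := Subtype.ext <| LinearMap.ext fun v => by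
    obtain ⟨η, rfl⟩ := J.toEquiv.surjective v
    change (J.daggerMap (x * y)).1 (J.toEquiv η) =
      (J.daggerMap y).1 ((J.daggerMap x).1 (J.toEquiv η))
    rw [daggerMap_apply, daggerMap_apply, daggerMap_apply]
    rfl
  apply_apply' x := Subtype.ext <| LinearMap.ext fun v => by
    obtain ⟨η, rfl⟩ := J.toEquiv.surjective v
    change (J.daggerMap (J.daggerMap x)).1 (J.toEquiv η) = _
    rw [daggerMap_apply, comp_daggerMap]

theorem dagger_apply (x : commutant τ) (η : Module.Dual K V) :
    (J.dagger.toLinearMap x).1 (J.toEquiv η) = J.toEquiv (η ∘ₗ x.1) := J.daggerMap_apply x η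

theorem comp_dagger (x : commutant τ) (η : Module.Dual K V) :
    J.toEquiv (η ∘ₗ (J.dagger.toLinearMap x).1) = x.1 (J.toEquiv η) := J.comp_daggerMap x η

end SkewIso

end Commutant

/-! ### The trace form of the commutant -/

section TraceForm

open AlgInvolution

variable {K G V W : Type*} [Field K] [Group G]
  [AddCommGroup V] [Module K V] [AddCommGroup W] [Module K W]

/-- The trace form on `End_G(V)`. -/
def commutantTrace (τ : Representation K G V) : commutant τ →ₗ[K] K :=
  LinearMap.trace K V ∘ₗ (commutant τ).val.toLinearMap

variable {τ : Representation K G V}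

/-- Summing the conjugates of an arbitrary y over G gives an element of the commutant, and since x
commutes with G the trace against x is |G| tr(x y). So x is orthogonal to all of End(V), and
rank-one maps y show x = 0. Invariance under the involution holds because it is a transpose
conjugated by J. -/
theorem isTraceForm_commutantTrace [CharZero K] [Finite G] [FiniteDimensional K V]
    (J : SkewIso τ) : IsTraceForm J.dagger (commutantTrace τ) where
  comm x y := LinearMap.trace_mul_comm K x.1 y.1
  map_involution x := by
    have h := LinearMap.trace_conj' (Module.Dual.transpose (R := K) x.1) J.toEquiv
    rw [LinearMap.trace_transpose'] at h
    exact h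
  eq_zero x h := by
    have := Fintype.ofFinite G
    have hxg : ∀ g, x.1 * τ g = τ g * x.1 := fun g => LinearMap.ext (mem_commutant.mp x.2 g)
    have htr : ∀ y : Module.End K V, LinearMap.trace K V (x.1 * y) = 0 := by
      intro y
      let z : commutant τ := ⟨∑ g : G, τ g * y * τ g⁻¹, by
        rw [commutant, Subalgebra.mem_centralizer_iff]
        rintro _ ⟨k, rfl⟩
        rw [Finset.mul_sum, Finset.sum_mul]
        refine Fintype.sum_equiv (Equiv.mulLeft k) _ _ fun g => ?_
        rw [Equiv.coe_mulLeft, mul_inv_rev, map_mul, map_mul]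
        have : τ k⁻¹ * τ k = 1 := by rw [← map_mul, inv_mul_cancel, _root_.map_one]
        rw [mul_assoc (τ k * τ g * y), mul_assoc (τ g⁻¹), this, mul_one]
        noncomm_ring⟩
      have h0 : LinearMap.trace K V (x.1 * ∑ g : G, τ g * y * τ g⁻¹) = 0 := h z
      have hg : ∀ g, LinearMap.trace K V (x.1 * (τ g * y * τ g⁻¹))
          = LinearMap.trace K V (x.1 * y) := by
        intro g
        have : τ g⁻¹ * τ g = 1 := by rw [← map_mul, inv_mul_cancel, _root_.map_one]
        rw [← mul_assoc, ← mul_assoc, hxg, mul_assoc, mul_assoc, LinearMap.trace_mul_comm,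
          mul_assoc, mul_assoc, this, mul_one]
      rw [Finset.mul_sum, map_sum] at h0
      simp only [hg, Finset.sum_const, Finset.card_univ, nsmul_eq_mul] at h0
      exact (mul_eq_zero.mp h0).resolve_left (Nat.cast_ne_zero.mpr Fintype.card_ne_zero)
    refine Subtype.ext (LinearMap.ext fun v => ?_)
    refine (Module.forall_dual_apply_eq_zero_iff K _).mp fun η => ?_
    have h1 := htr (η.smulRight v)
    rw [LinearMap.trace_mul_comm] at h1
    change LinearMap.trace K V ((η ∘ₗ x.1).smulRight v) = 0 at h1
    rwa [LinearMap.trace_smulRight] at h1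
  nilpotent x hx := by
    obtain ⟨k, hk⟩ := hx
    exact (LinearMap.isNilpotent_trace_of_isNilpotent
      ⟨k, congrArg Subtype.val hk⟩ : IsNilpotent (LinearMap.trace K V x.1)).eq_zero
  idempotent x hx h0 :=
    Subtype.ext ((LinearMap.IsIdempotentElem.trace_eq_zero_iff (congrArg Subtype.val hx)).mp h0)

end TraceForm

/-! ### A central skew unit when ρ is not self-dual -/

section NotSelfDual

open AlgInvolution

variable {K G V W : Type*} [Field K] [Group G]
  [AddCommGroup V] [Module K V] [AddCommGroup W] [Module K W]

theorem sum_comp_mem_commutant {τ : Representation K G V} {ρ : Representation K G W} {m : ℕ}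
    (π : Fin m → τ.IntertwiningMap ρ) (ι : Fin m → ρ.IntertwiningMap τ) :
    (∑ k, (ι k).toLinearMap ∘ₗ (π k).toLinearMap) ∈ commutant τ := by
  refine sum_mem fun k _ => mem_commutant.mpr fun g v => ?_
  change ι k (π k (τ g v)) = τ g (ι k (π k v))
  rw [(π k).isIntertwining, (ι k).isIntertwining]

/-- Let e, e' project to the ρ-part and the ρ*-part. There are no equivariant maps between ρ and ρ*,
so both are central. Dualising exchanges the two types, so the involution swaps e and e'. The unit
is z = e - e'. -/
theorem exists_unit_of_not_isSelfDual [FiniteDimensional K W] {τ : Representation K G V}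
    {ρ : Representation K G W} [ρ.IsIrreducible] {m : ℕ} (hτ : IsIsotypic τ ρ m)
    (hd : ¬ IsSelfDual ρ) (J : SkewIso τ) :
    ∃ z ∈ Subalgebra.center K (commutant τ), z ∈ Skew J.dagger ∧ z * z = 1 := by
  obtain ⟨π, ι, π', ι', hs⟩ := hτ.exists_coordinates' hd
  let e : commutant τ := ⟨_, sum_comp_mem_commutant π ι⟩
  let e' : commutant τ := ⟨_, sum_comp_mem_commutant π' ι'⟩
  have he : ∀ v, e.1 v = ∑ k, ι k (π k v) := fun v => LinearMap.sum_apply _ _ _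
  have he' : ∀ v, e'.1 v = ∑ k, ι' k (π' k v) := fun v => LinearMap.sum_apply _ _ _
  have hee : e + e' = 1 := Subtype.ext (LinearMap.ext fun v => by
    change e.1 v + e'.1 v = v
    rw [he, he', hs])
  have h1 : ∀ x : commutant τ, e * x * e' = 0 := by
    intro x
    refine Subtype.ext (LinearMap.ext fun v => ?_)
    change e.1 (x.1 (e'.1 v)) = 0
    rw [he, he']
    refine Finset.sum_eq_zero fun k _ => ?_
    rw [map_sum, map_sum, map_sum]
    refine Finset.sum_eq_zero fun l _ => ?_
    let f : ρ.dual.IntertwiningMap ρ := LinearMap.intertwiningMap_of_isIntertwiningMap _ _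
      ((π k).toLinearMap ∘ₗ x.1 ∘ₗ (ι' l).toLinearMap) fun g w => by
        change π k (x.1 (ι' l (ρ.dual g w))) = ρ g (π k (x.1 (ι' l w)))
        rw [(ι' l).isIntertwining, mem_commutant.mp x.2, (π k).isIntertwining]
    have : π k (x.1 (ι' l (π' l v))) = 0 :=
      DFunLike.congr_fun (eq_zero_of_not_isSelfDual' hd f) (π' l v)
    rw [this, map_zero]
  have h2 : ∀ x : commutant τ, e' * x * e = 0 := by
    intro x
    refine Subtype.ext (LinearMap.ext fun v => ?_)
    change e'.1 (x.1 (e.1 v)) = 0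
    rw [he, he']
    refine Finset.sum_eq_zero fun k _ => ?_
    rw [map_sum, map_sum, map_sum]
    refine Finset.sum_eq_zero fun l _ => ?_
    let f : ρ.IntertwiningMap ρ.dual := LinearMap.intertwiningMap_of_isIntertwiningMap _ _
      ((π' k).toLinearMap ∘ₗ x.1 ∘ₗ (ι l).toLinearMap) fun g w => by
        change π' k (x.1 (ι l (ρ g w))) = ρ.dual g (π' k (x.1 (ι l w)))
        rw [(ι l).isIntertwining, mem_commutant.mp x.2, (π' k).isIntertwining]
    have : π' k (x.1 (ι l (π l v))) = 0 :=
      DFunLike.congr_fun (eq_zero_of_not_isSelfDual hd f) (π l v)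
    rw [this, map_zero]
  have h3 : e * J.dagger.toLinearMap e = 0 := by
    refine Subtype.ext (LinearMap.ext fun v => ?_)
    obtain ⟨η, rfl⟩ := J.toEquiv.surjective v
    change e.1 ((J.dagger.toLinearMap e).1 (J.toEquiv η)) = 0
    rw [J.dagger_apply, he]
    refine Finset.sum_eq_zero fun k _ => ?_
    have hη : η ∘ₗ e.1 = ∑ l, (η ∘ₗ (ι l).toLinearMap) ∘ₗ (π l).toLinearMap := by
      refine LinearMap.ext fun v => ?_
      rw [LinearMap.comp_apply, he, map_sum, LinearMap.sum_apply]
      rfl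
    rw [hη, map_sum, map_sum, map_sum]
    refine Finset.sum_eq_zero fun l _ => ?_
    let f : ρ.dual.IntertwiningMap ρ := LinearMap.intertwiningMap_of_isIntertwiningMap _ _
      ((π k).toLinearMap ∘ₗ (J.toEquiv : _ →ₗ[K] V) ∘ₗ (π l).toLinearMap.dualMap) fun g ζ => by
        change π k (J.toEquiv (ρ.dual g ζ ∘ₗ (π l).toLinearMap))
          = ρ g (π k (J.toEquiv (ζ ∘ₗ (π l).toLinearMap)))
        have : ρ.dual g ζ ∘ₗ (π l).toLinearMap = τ.dual g (ζ ∘ₗ (π l).toLinearMap) := by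
          refine LinearMap.ext fun v => ?_
          change ζ (ρ g⁻¹ (π l v)) = ζ (π l (τ g⁻¹ v))
          rw [(π l).isIntertwining]
        rw [this, J.equivariant, (π k).isIntertwining]
    have : π k (J.toEquiv ((η ∘ₗ (ι l).toLinearMap) ∘ₗ (π l).toLinearMap)) = 0 :=
      DFunLike.congr_fun (eq_zero_of_not_isSelfDual' hd f) (η ∘ₗ (ι l).toLinearMap)
    rw [this, map_zero]
  have h4 : e' * J.dagger.toLinearMap e' = 0 := by
    refine Subtype.ext (LinearMap.ext fun v => ?_)
    obtain ⟨η, rfl⟩ := J.toEquiv.surjective v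
    change e'.1 ((J.dagger.toLinearMap e').1 (J.toEquiv η)) = 0
    rw [J.dagger_apply, he']
    refine Finset.sum_eq_zero fun k _ => ?_
    have hη : η ∘ₗ e'.1 = ∑ l, (η ∘ₗ (ι' l).toLinearMap) ∘ₗ (π' l).toLinearMap := by
      refine LinearMap.ext fun v => ?_
      rw [LinearMap.comp_apply, he', map_sum, LinearMap.sum_apply]
      rfl
    rw [hη, map_sum, map_sum, map_sum]
    refine Finset.sum_eq_zero fun l _ => ?_
    let f : ρ.IntertwiningMap ρ.dual := LinearMap.intertwiningMap_of_isIntertwiningMap _ _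
      ((π' k).toLinearMap ∘ₗ (J.toEquiv : _ →ₗ[K] V) ∘ₗ (π' l).toLinearMap.dualMap ∘ₗ
        Module.Dual.eval K W) fun g w => by
        change π' k (J.toEquiv (Module.Dual.eval K W (ρ g w) ∘ₗ (π' l).toLinearMap))
          = ρ.dual g (π' k (J.toEquiv (Module.Dual.eval K W w ∘ₗ (π' l).toLinearMap)))
        have : Module.Dual.eval K W (ρ g w) ∘ₗ (π' l).toLinearMap =
            τ.dual g (Module.Dual.eval K W w ∘ₗ (π' l).toLinearMap) := by
          refine LinearMap.ext fun v => ?_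
          change π' l v (ρ g w) = π' l (τ g⁻¹ v) w
          rw [(π' l).isIntertwining]
          change π' l v (ρ g w) = π' l v (ρ g⁻¹⁻¹ w)
          rw [inv_inv]
        rw [this, J.equivariant, (π' k).isIntertwining]
    -- Functionals on W* are evaluations, which reduces the claim to equivariant maps ρ → ρ*.
    obtain ⟨w, hw⟩ := (Module.evalEquiv K W).surjective (η ∘ₗ (ι' l).toLinearMap)
    have : π' k (J.toEquiv ((η ∘ₗ (ι' l).toLinearMap) ∘ₗ (π' l).toLinearMap)) = 0 := by
      rw [← hw]
      exact DFunLike.congr_fun (eq_zero_of_not_isSelfDual hd f) w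
    rw [this, map_zero]
  obtain he'' : e' = 1 - e := eq_sub_of_add_eq' hee
  rw [he''] at h1 h2 h4
  have h5 : e * e = e := by
    have := h1 1
    rw [mul_one, mul_sub, mul_one, sub_eq_zero] at this
    exact this.symm
  have h6 : J.dagger.toLinearMap e = 1 - e := by
    rw [map_sub, AlgInvolution.map_one, mul_sub, sub_mul, sub_mul, h3, one_mul, mul_one,
      sub_zero] at h4
    exact (sub_eq_zero.mp h4).symm
  refine ⟨e - (1 - e), ?_, ?_, ?_⟩
  · have hc : ∀ x, x * e = e * x := by
      intro x
      have a1 := h1 x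
      have a2 := h2 x
      rw [mul_sub, mul_one, sub_eq_zero] at a1
      rw [sub_mul, one_mul, sub_mul, sub_eq_zero] at a2
      rw [a1, a2]
    rw [Subalgebra.mem_center_iff]
    intro x
    rw [mul_sub, mul_sub, sub_mul, sub_mul, hc, mul_one, one_mul]
  · rw [AlgInvolution.mem_Skew, map_sub, map_sub, AlgInvolution.map_one, h6]
    abel
  · have h7 : e * (1 - e) = 0 := by rw [mul_sub, mul_one, h5, sub_self]
    have h8 : (1 - e) * e = 0 := by rw [sub_mul, one_mul, h5, sub_self]
    have h9 : (1 - e) * (1 - e) = 1 - e := by rw [mul_sub, mul_one, h8, sub_zero]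
    rw [sub_mul, mul_sub e e, mul_sub (1 - e) e, h5, h7, h8, h9]
    abel

end NotSelfDual

/-! ### The isomorphism of Ã with M₂(End_G(V)) -/

section TildeIso

open AlgInvolution Matrix

variable {K G V W : Type*} [Field K] [Group G]
  [AddCommGroup V] [Module K V] [AddCommGroup W] [Module K W]
  {τ : Representation K G V} (J : SkewIso τ)

/-- The endomorphism of `Ṽ` defined by a matrix over `End_G(V)`, if `Ṽ` is identified with `V²`. -/
def matrixMap (X : Matrix (Fin 2) (Fin 2) (commutant τ)) : Module.End K (Tilde K V) :=
  LinearMap.prod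
    ((X 0 0).1 ∘ₗ Tilde.fst K V + (X 0 1).1 ∘ₗ (J.toEquiv : _ →ₗ[K] V) ∘ₗ Tilde.snd K V)
    ((J.toEquiv.symm : V →ₗ[K] _) ∘ₗ
      ((X 1 0).1 ∘ₗ Tilde.fst K V + (X 1 1).1 ∘ₗ (J.toEquiv : _ →ₗ[K] V) ∘ₗ Tilde.snd K V))

theorem fst_matrixMap (X : Matrix (Fin 2) (Fin 2) (commutant τ)) (z : Tilde K V) :
    Tilde.fst K V (matrixMap J X z) =
      (X 0 0).1 (Tilde.fst K V z) + (X 0 1).1 (J.toEquiv (Tilde.snd K V z)) := rfl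

theorem snd_matrixMap (X : Matrix (Fin 2) (Fin 2) (commutant τ)) (z : Tilde K V) :
    Tilde.snd K V (matrixMap J X z) = J.toEquiv.symm
      ((X 1 0).1 (Tilde.fst K V z) + (X 1 1).1 (J.toEquiv (Tilde.snd K V z))) := rfl

theorem tilde_ext {z z' : Tilde K V} (h : Tilde.fst K V z = Tilde.fst K V z')
    (h' : J.toEquiv (Tilde.snd K V z) = J.toEquiv (Tilde.snd K V z')) : z = z' :=
  Prod.ext h (J.toEquiv.injective h')

theorem fst_tilde_apply (g : G) (z : Tilde K V) :
    Tilde.fst K V (tilde τ g z) = τ g (Tilde.fst K V z) := rfl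

theorem snd_tilde_apply (g : G) (z : Tilde K V) :
    Tilde.snd K V (tilde τ g z) = τ.dual g (Tilde.snd K V z) := rfl

/-- `matrixMap` as a homomorphism of algebras. -/
def matrixHom : Matrix (Fin 2) (Fin 2) (commutant τ) →ₐ[K] Module.End K (Tilde K V) :=
  AlgHom.ofLinearMap
    { toFun := matrixMap J
      map_add' := fun X Y => LinearMap.ext fun z => by
        refine tilde_ext J ?_ ?_
        · rw [LinearMap.add_apply, map_add]
          simp only [fst_matrixMap, Matrix.add_apply]
          change ((X 0 0).1 + (Y 0 0).1) _ + ((X 0 1).1 + (Y 0 1).1) _ = _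
          simp only [LinearMap.add_apply]
          abel
        · rw [LinearMap.add_apply, map_add]
          simp only [snd_matrixMap, Matrix.add_apply, map_add, LinearEquiv.apply_symm_apply]
          change ((X 1 0).1 + (Y 1 0).1) _ + ((X 1 1).1 + (Y 1 1).1) _ = _
          simp only [LinearMap.add_apply]
          abel
      map_smul' := fun c X => LinearMap.ext fun z => by
        refine tilde_ext J ?_ ?_
        · rw [RingHom.id_apply, LinearMap.smul_apply, map_smul]
          simp only [fst_matrixMap, Matrix.smul_apply, smul_add]
          rfl
        · rw [RingHom.id_apply, LinearMap.smul_apply, map_smul, map_smul]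
          simp only [snd_matrixMap, Matrix.smul_apply, LinearEquiv.apply_symm_apply, smul_add]
          rfl }
    (LinearMap.ext fun z => by
      refine tilde_ext J ?_ ?_
      · change (1 : Module.End K V) (Tilde.fst K V z) +
          (0 : Module.End K V) (J.toEquiv (Tilde.snd K V z)) = Tilde.fst K V z
        simp
      · change J.toEquiv (J.toEquiv.symm ((0 : Module.End K V) (Tilde.fst K V z) +
          (1 : Module.End K V) (J.toEquiv (Tilde.snd K V z)))) = J.toEquiv (Tilde.snd K V z)
        simp)
    (fun X Y => LinearMap.ext fun z => by
      refine tilde_ext J ?_ ?_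
      · change Tilde.fst K V (matrixMap J (X * Y) z) =
          Tilde.fst K V (matrixMap J X (matrixMap J Y z))
        simp only [fst_matrixMap, snd_matrixMap, LinearEquiv.apply_symm_apply, Matrix.mul_apply,
          Fin.sum_univ_two, map_add]
        change ((X 0 0).1 * (Y 0 0).1 + (X 0 1).1 * (Y 1 0).1) _ +
          ((X 0 0).1 * (Y 0 1).1 + (X 0 1).1 * (Y 1 1).1) _ = _
        simp only [LinearMap.add_apply, Module.End.mul_apply]
        abel
      · change J.toEquiv (Tilde.snd K V (matrixMap J (X * Y) z)) =
          J.toEquiv (Tilde.snd K V (matrixMap J X (matrixMap J Y z)))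
        simp only [fst_matrixMap, snd_matrixMap, LinearEquiv.apply_symm_apply, Matrix.mul_apply,
          Fin.sum_univ_two, map_add]
        change ((X 1 0).1 * (Y 0 0).1 + (X 1 1).1 * (Y 1 0).1) _ +
          ((X 1 0).1 * (Y 0 1).1 + (X 1 1).1 * (Y 1 1).1) _ = _
        simp only [LinearMap.add_apply, Module.End.mul_apply]
        abel)

theorem matrixHom_apply (X : Matrix (Fin 2) (Fin 2) (commutant τ)) :
    matrixHom J X = matrixMap J X := rfl

theorem matrixHom_comm (X : Matrix (Fin 2) (Fin 2) (commutant τ)) (g : G) :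
    matrixHom J X * tilde τ g = tilde τ g * matrixHom J X := by
  refine LinearMap.ext fun z => tilde_ext J ?_ ?_
  · change Tilde.fst K V (matrixMap J X (tilde τ g z)) = τ g (Tilde.fst K V (matrixMap J X z))
    rw [fst_matrixMap, fst_matrixMap, fst_tilde_apply, snd_tilde_apply, J.equivariant,
      mem_commutant.mp (X 0 0).2, mem_commutant.mp (X 0 1).2, map_add]
  · change J.toEquiv (Tilde.snd K V (matrixMap J X (tilde τ g z))) =
      J.toEquiv (τ.dual g (Tilde.snd K V (matrixMap J X z)))
    rw [J.equivariant, snd_matrixMap, snd_matrixMap, LinearEquiv.apply_symm_apply,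
      LinearEquiv.apply_symm_apply, fst_tilde_apply, snd_tilde_apply, J.equivariant,
      mem_commutant.mp (X 1 0).2, mem_commutant.mp (X 1 1).2, map_add]

theorem matrixHom_injective : Function.Injective (matrixHom J) := by
  rw [injective_iff_map_eq_zero]
  intro X hX
  have hf : ∀ z, Tilde.fst K V (matrixMap J X z) = 0 := fun z => by
    rw [← matrixHom_apply, hX]; rfl
  have hs : ∀ z, Tilde.snd K V (matrixMap J X z) = 0 := fun z => by
    rw [← matrixHom_apply, hX]; rfl
  simp only [fst_matrixMap] at hf
  simp only [snd_matrixMap, LinearEquiv.map_eq_zero_iff] at hs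
  have h1 : ∀ (x y : commutant τ), (∀ z : Tilde K V, x.1 (Tilde.fst K V z) +
      y.1 (J.toEquiv (Tilde.snd K V z)) = 0) → x = 0 ∧ y = 0 := by
    intro x y h
    constructor
    · refine Subtype.ext (LinearMap.ext fun v => ?_)
      have h0 : x.1 v + y.1 (J.toEquiv 0) = 0 := h (Tilde.mk v 0)
      rwa [map_zero, map_zero, add_zero] at h0
    · refine Subtype.ext (LinearMap.ext fun v => ?_)
      have h0 : x.1 0 + y.1 (J.toEquiv (J.toEquiv.symm v)) = 0 := h (Tilde.mk 0 (J.toEquiv.symm v))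
      rwa [map_zero, zero_add, LinearEquiv.apply_symm_apply] at h0
  obtain ⟨e1, e2⟩ := h1 _ _ hf
  obtain ⟨e3, e4⟩ := h1 _ _ hs
  rw [Matrix.eta_fin_two X, e1, e2, e3, e4]
  ext i j
  fin_cases i <;> fin_cases j <;> rfl

theorem exists_matrixHom_eq {f : Module.End K (Tilde K V)}
    (hf : ∀ g, f * tilde τ g = tilde τ g * f) : ∃ X, matrixHom J X = f := by
  have hf' : ∀ g z, f (tilde τ g z) = tilde τ g (f z) := fun g z => LinearMap.congr_fun (hf g) z
  let inl : V →ₗ[K] Tilde K V := LinearMap.inl K V (Module.Dual K V)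
  let inr : V →ₗ[K] Tilde K V :=
    LinearMap.inr K V (Module.Dual K V) ∘ₗ (J.toEquiv.symm : V →ₗ[K] Module.Dual K V)
  have hsymm : ∀ g v, J.toEquiv.symm (τ g v) = τ.dual g (J.toEquiv.symm v) := by
    intro g v
    rw [LinearEquiv.symm_apply_eq, J.equivariant, LinearEquiv.apply_symm_apply]
  have hinl : ∀ g v, inl (τ g v) = tilde τ g (inl v) := fun g v =>
    Prod.ext rfl (map_zero (τ.dual g)).symm
  have hinr : ∀ g v, inr (τ g v) = tilde τ g (inr v) := fun g v =>
    Prod.ext (map_zero (τ g)).symm (hsymm g v)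
  let snd : Tilde K V →ₗ[K] V := (J.toEquiv : _ →ₗ[K] V) ∘ₗ Tilde.snd K V
  have hsnd : ∀ g z, snd (tilde τ g z) = τ g (snd z) := fun g z => J.equivariant g _
  have hsum : ∀ z, inl (Tilde.fst K V z) + inr (snd z) = z := by
    intro z
    refine Prod.ext (add_zero _) ?_
    change 0 + J.toEquiv.symm (J.toEquiv (Tilde.snd K V z)) = Tilde.snd K V z
    rw [zero_add, LinearEquiv.symm_apply_apply]
  refine ⟨!![⟨Tilde.fst K V ∘ₗ f ∘ₗ inl, ?_⟩, ⟨Tilde.fst K V ∘ₗ f ∘ₗ inr, ?_⟩;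
    ⟨snd ∘ₗ f ∘ₗ inl, ?_⟩, ⟨snd ∘ₗ f ∘ₗ inr, ?_⟩], ?_⟩
  · rw [mem_commutant]
    intro g v
    simp only [LinearMap.comp_apply, hinl, hf', fst_tilde_apply]
  · rw [mem_commutant]
    intro g v
    simp only [LinearMap.comp_apply, hinr, hf', fst_tilde_apply]
  · rw [mem_commutant]
    intro g v
    simp only [LinearMap.comp_apply, hinl, hf', hsnd]
  · rw [mem_commutant]
    intro g v
    simp only [LinearMap.comp_apply, hinr, hf', hsnd]
  · refine LinearMap.ext fun z => tilde_ext J ?_ ?_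
    · change Tilde.fst K V (f (inl (Tilde.fst K V z))) + Tilde.fst K V (f (inr (snd z))) = _
      rw [← map_add, ← map_add, hsum]
    · change J.toEquiv (J.toEquiv.symm (snd (f (inl (Tilde.fst K V z))) + snd (f (inr (snd z)))))
        = snd (f z)
      rw [LinearEquiv.apply_symm_apply, ← map_add, ← map_add, hsum]

variable [FiniteDimensional K V]

/-- Under J the form b becomes the hyperbolic form built from the alternating form on V whose
adjoint is `dagger`. Alternation produces the signs off the diagonal. -/
theorem adj_matrixHom (X : Matrix (Fin 2) (Fin 2) (commutant τ)) :
    adj (matrixHom J X) = matrixHom J ((doubleInvolution J.dagger).toLinearMap X) := by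
  refine (eq_adj fun z z' => ?_).symm
  rw [tildeForm_apply, tildeForm_apply, matrixHom_apply, matrixHom_apply, doubleInvolution_apply]
  simp only [fst_matrixMap, snd_matrixMap]
  obtain ⟨ζ, hζ⟩ := J.toEquiv.surjective (Tilde.fst K V z)
  rw [← hζ]
  set η := Tilde.snd K V z
  set v' := Tilde.fst K V z'
  set η' := Tilde.snd K V z'
  change J.toEquiv.symm ((-(J.dagger.toLinearMap (X 1 0)).1) (J.toEquiv ζ) +
      (J.dagger.toLinearMap (X 0 0)).1 (J.toEquiv η)) v' +
    η' ((J.dagger.toLinearMap (X 1 1)).1 (J.toEquiv ζ) +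
      (-(J.dagger.toLinearMap (X 0 1)).1) (J.toEquiv η)) = _
  have hsk : ∀ v, J.toEquiv.symm v (J.toEquiv ζ) = -ζ v := by
    intro v
    rw [J.skew, LinearEquiv.apply_symm_apply]
  rw [hsk, LinearMap.neg_apply, LinearMap.neg_apply, J.dagger_apply, J.dagger_apply, J.dagger_apply,
    J.dagger_apply, ← map_neg, ← map_add, LinearEquiv.symm_apply_apply, map_add η', map_neg η',
    J.skew (ζ ∘ₗ _), J.skew (η ∘ₗ _)]
  simp only [LinearMap.add_apply, LinearMap.neg_apply, LinearMap.comp_apply, map_add]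
  ring

/-- The algebra `Ã` is isomorphic to `M₂(End_G(V))`. -/
def tildeEquiv [CharZero K] [Finite G] [FiniteDimensional K W] {ρ : Representation K G W} {m : ℕ}
    (hτ : IsIsotypic τ ρ m) : Matrix (Fin 2) (Fin 2) (commutant τ) ≃ₐ[K] tildeA τ ρ :=
  AlgEquiv.ofBijective
    ((matrixHom J).codRestrict (tildeA τ ρ) fun X => (mem_tildeA_iff hτ).mpr (matrixHom_comm J X))
    ⟨fun X Y h => matrixHom_injective J (congrArg Subtype.val h), fun f => by
      obtain ⟨X, hX⟩ := exists_matrixHom_eq J ((mem_tildeA_iff hτ).mp f.2)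
      exact ⟨X, Subtype.ext hX⟩⟩

theorem tildeEquiv_involution [CharZero K] [Finite G] [FiniteDimensional K W]
    {ρ : Representation K G W} {m : ℕ} (hτ : IsIsotypic τ ρ m)
    (X : Matrix (Fin 2) (Fin 2) (commutant τ)) :
    tildeEquiv J hτ ((doubleInvolution J.dagger).toLinearMap X) =
      (tildeSigma τ ρ).toLinearMap (tildeEquiv J hτ X) :=
  Subtype.ext (adj_matrixHom J X).symm

end TildeIso

/-! ### The grading as an eigenspace decomposition -/

section Grading

open ExteriorAlgebra

variable {K V : Type*} [Field K] [AddCommGroup V] [Module K V]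

instance : DirectSum.Decomposition (extGrading K V) :=
  inferInstanceAs (DirectSum.Decomposition fun n : ℕ => ⋀[K]^n V)

instance [FiniteDimensional K V] : FiniteDimensional K (ExteriorAlgebra K V) :=
  Module.Finite.of_basis (Module.finBasis K V).ExteriorAlgebra

theorem map_mem_extGrading (f : V →ₗ[K] V) {i : ℕ} {x : ExteriorAlgebra K V}
    (hx : x ∈ extGrading K V i) : ExteriorAlgebra.map f x ∈ extGrading K V i := by
  induction i generalizing x with
  | zero =>
    obtain ⟨c, rfl⟩ := mem_extGrading_zero.mp hx
    exact mem_extGrading_zero.mpr ⟨c, by rw [map_smul, map_one]⟩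
  | succ i ih =>
    refine extGrading_succ_induction (fun v y hy => ?_) (fun x y hx hy => ?_) hx
    · rw [map_mul, map_apply_ι]
      exact ι_mul_mem _ (ih hy)
    · rw [map_add]
      exact Submodule.add_mem _ hx hy

theorem decompose_of_homogeneous {L : Module.End K (ExteriorAlgebra K V)}
    (hL : ∀ i, ∀ x ∈ extGrading K V i, L x ∈ extGrading K V i) (y : ExteriorAlgebra K V) (i : ℕ) :
    (DirectSum.decompose (extGrading K V) (L y) i : ExteriorAlgebra K V) =
      L (DirectSum.decompose (extGrading K V) y i) := by
  induction y using DirectSum.Decomposition.inductionOn (extGrading K V) with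
  | zero => simp
  | @homogeneous j y =>
    by_cases hij : j = i
    · subst hij
      rw [DirectSum.decompose_of_mem_same _ (hL _ _ y.2), DirectSum.decompose_of_mem_same _ y.2]
    · rw [DirectSum.decompose_of_mem_ne _ (hL _ _ y.2) hij,
        DirectSum.decompose_of_mem_ne _ y.2 hij, map_zero]
  | add x y hx hy =>
    rw [map_add, DirectSum.decompose_add, DirectSum.decompose_add, DirectSum.add_apply,
      DirectSum.add_apply, Submodule.coe_add, Submodule.coe_add, map_add, hx, hy]

theorem mem_of_decompose_eq_zero {N : Submodule K (ExteriorAlgebra K V)} {y : ExteriorAlgebra K V}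
    (h : ∀ i, (DirectSum.decompose (extGrading K V) y i : ExteriorAlgebra K V) ∈ N) : y ∈ N := by
  classical
  rw [← DirectSum.sum_support_decompose (extGrading K V) y]
  exact sum_mem fun i _ => h i

variable [FiniteDimensional K V]

/-- A space whose exterior algebra has depth `n` has dimension `2n`. -/
theorem finrank_eq_of_hasDepth {n : ℕ} (h : HasDepth (extGrading K V) n) :
    Module.finrank K V = 2 * n := by
  have hr : ∀ i, extGrading K V i = ⊥ ↔ (Module.finrank K V).choose i = 0 := by
    intro i
    rw [← Submodule.finrank_eq_zero, ← exteriorPower.finrank_eq (R := K) (M := V)]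
    rfl
  refine le_antisymm ?_ ?_
  · by_contra! hlt
    have := (hr _).mp (h.1 _ hlt)
    rw [Nat.choose_self] at this
    omega
  · by_contra! hlt
    exact h.2 ((hr _).mpr (Nat.choose_eq_zero_of_lt hlt))

variable [CharZero K]

/-- A component of degree i has eigenvalue i - n, so in characteristic zero only i = n + k survives.
For n + k < 0 nothing does, in line with the zero pieces of `shift`. -/
theorem mem_shift_of_spin_gradOp {n : ℕ} (hn : Module.finrank K V = 2 * n) {k : ℤ}
    {y : ExteriorAlgebra K V} (hy : spin (gradOp K V) y = (k : K) • y) :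
    y ∈ shift (extGrading K V) n k := by
  refine mem_of_decompose_eq_zero fun i => ?_
  have hhom : ∀ i, ∀ x ∈ extGrading K V i, spin (gradOp K V) x ∈ extGrading K V i := by
    intro i x hx
    rw [spin_gradOp hx]
    exact Submodule.smul_mem _ _ hx
  have h := decompose_of_homogeneous hhom y i
  rw [hy, DirectSum.decompose_smul, spin_gradOp (Subtype.mem _), hn] at h
  have h1 : ((i : K) - ((2 * n : ℕ) : K) / 2 - k) •
      (DirectSum.decompose (extGrading K V) y i : ExteriorAlgebra K V) = 0 := by
    rw [sub_smul, ← h]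
    exact sub_self _
  rcases smul_eq_zero.mp h1 with h2 | h2
  · have h3 : (i : ℤ) = n + k := by
      have : (i : K) - n - k = 0 := by
        rw [← h2]
        push_cast
        rw [mul_div_cancel_left₀ _ (two_ne_zero' K)]
      have h4 : ((i - n - k : ℤ) : K) = 0 := by exact_mod_cast this
      have h5 := Int.cast_eq_zero.mp h4
      omega
    rw [shift, if_pos (by omega), ← h3, Int.toNat_natCast]
    exact Subtype.mem _
  · rw [h2]
    exact Submodule.zero_mem _

theorem spin_gradOp_of_mem_shift {n : ℕ} (hn : Module.finrank K V = 2 * n) {k : ℤ}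
    {y : ExteriorAlgebra K V} (hy : y ∈ shift (extGrading K V) n k) :
    spin (gradOp K V) y = (k : K) • y := by
  rw [shift] at hy
  split_ifs at hy with hk
  · rw [spin_gradOp hy, hn]
    congr 1
    have h1 : ((((n : ℤ) + k).toNat : ℤ) : K) = n + k := by
      rw [Int.toNat_of_nonneg hk]
      push_cast
      rfl
    rw [Int.cast_natCast] at h1
    rw [h1]
    push_cast
    rw [mul_div_cancel_left₀ _ (two_ne_zero' K)]
    ring
  · rw [(Submodule.mem_bot K).mp hy, map_zero, smul_zero]

end Grading

/-! ### The spin representation on (⋀V)^G -/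

section Invariants

open ExteriorAlgebra AlgInvolution

variable {K G V : Type*} [Field K] [Group G] [AddCommGroup V] [Module K V]
  {τ : Representation K G V}

theorem mem_shift_extInvariantsGrading {n : ℕ} {k : ℤ} {x : extInvariants τ} :
    x ∈ shift (extInvariantsGrading τ) n k ↔
      (x : ExteriorAlgebra K V) ∈ shift (extGrading K V) n k := by
  rw [shift, shift]
  split_ifs with h
  · rfl
  · rw [Submodule.mem_bot, Submodule.mem_bot, ZeroMemClass.coe_eq_zero]

/-- The group preserves degrees, so homogeneous components of invariants are invariant. This makes
the grading operator on (⋀V)^G unique. -/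
theorem iSup_shift_extInvariantsGrading (τ : Representation K G V) (n : ℕ) :
    ⨆ k, shift (extInvariantsGrading τ) n k = ⊤ := by
  classical
  rw [eq_top_iff]
  rintro x -
  have hx : ∀ i, (DirectSum.decompose (extGrading K V) (x : ExteriorAlgebra K V) i :
      ExteriorAlgebra K V) ∈ extInvariants τ := by
    intro i g
    have h := decompose_of_homogeneous
      (L := (ExteriorAlgebra.map (τ g)).toLinearMap) (fun i x => map_mem_extGrading (τ g)) x i
    have hg : (ExteriorAlgebra.map (τ g)).toLinearMap (x : ExteriorAlgebra K V) = x := x.2 g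
    rw [hg] at h
    exact h.symm
  have hsum : x = ∑ i ∈ (DirectSum.decompose (extGrading K V) (x : ExteriorAlgebra K V)).support,
      (⟨_, hx i⟩ : extInvariants τ) := by
    refine Subtype.ext ?_
    conv_lhs => rw [← DirectSum.sum_support_decompose (extGrading K V) (x : ExteriorAlgebra K V)]
    rw [AddSubmonoidClass.coe_finsetSum]
  rw [hsum]
  refine sum_mem fun i _ => Submodule.mem_iSup_of_mem ((i : ℤ) - n) ?_
  rw [mem_shift_extInvariantsGrading, shift, if_pos (by omega)]
  have : ((n : ℤ) + ((i : ℤ) - n)).toNat = i := by omega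
  rw [this]
  exact Subtype.mem _

/-- The equivariant map `V* → V` defined by an invariant bivector. -/
theorem bivectorMap_equivariant {b : ExteriorAlgebra K V} (hb : b ∈ extInvariants τ)
    (hb2 : b ∈ extGrading K V 2) (g : G) (η : Module.Dual K V) :
    bivectorMap b (τ.dual g η) = τ g (bivectorMap b η) := by
  have h := map_contract (τ g) (τ.dual g η) b
  have he : τ.dual g η ∘ₗ τ g = η := by
    refine LinearMap.ext fun v => ?_
    change η (τ g⁻¹ (τ g v)) = η v
    rw [← Module.End.mul_apply, ← map_mul, inv_mul_cancel, _root_.map_one, Module.End.one_apply]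
  rw [he, hb g, contract_eq_bivectorMap hb2, contract_eq_bivectorMap hb2, map_neg, map_apply_ι,
    neg_inj] at h
  exact (ι_leftInverse.injective h).symm

variable [FiniteDimensional K V]

/-- The isomorphism `V* → V` defined by an invariant bivector `a` with `a ^ n ≠ 0`. -/
def SkewIso.ofBivector {b : ExteriorAlgebra K V} (hb : b ∈ extInvariants τ)
    (hb2 : b ∈ extGrading K V 2) (hinj : Function.Injective (bivectorMap b)) : SkewIso τ where
  toEquiv := LinearEquiv.ofInjectiveOfFinrankEq (bivectorMap b) hinj Subspace.dual_finrank_eq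
  skew := bivectorMap_skew hb2
  equivariant := bivectorMap_equivariant hb hb2

variable [CharZero K] (J : SkewIso τ)

/-- The action of `M₂(End_G(V))` on `(⋀ V)^G` by the spin representation. -/
def spinInvariants : Matrix (Fin 2) (Fin 2) (commutant τ) →ₗ[K] Module.End K (extInvariants τ) where
  toFun X := (spin (matrixHom J X)).restrict (p := Subalgebra.toSubmodule (extInvariants τ))
    (q := Subalgebra.toSubmodule (extInvariants τ)) fun x hx g => by
      rw [map_spin τ g (matrixHom_comm J X g), hx g]
  map_add' X Y := LinearMap.ext fun x => Subtype.ext <| by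
    change spin (matrixHom J (X + Y)) _ = spin (matrixHom J X) _ + spin (matrixHom J Y) _
    rw [map_add, map_add, LinearMap.add_apply]
  map_smul' c X := LinearMap.ext fun x => Subtype.ext <| by
    change spin (matrixHom J (c • X)) _ = c • spin (matrixHom J X) _
    rw [map_smul, map_smul, LinearMap.smul_apply]

omit [CharZero K] in
theorem adj_matrixHom_of_skew (X : Skew (doubleInvolution J.dagger)) :
    adj (matrixHom J X.1) = -matrixHom J X.1 := by
  rw [adj_matrixHom, mem_Skew.mp X.2, map_neg]

/-- The spin representation on `(⋀ V)^G`. -/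
def spinRep : Skew (doubleInvolution J.dagger) →ₗ⁅K⁆ Module.End K (extInvariants τ) where
  toLinearMap := spinInvariants J ∘ₗ (Skew (doubleInvolution J.dagger)).toSubmodule.subtype
  map_lie' {X Y} := LinearMap.ext fun x => Subtype.ext <| by
    have h := LinearMap.congr_fun
      (lie_spin_spin (T := matrixHom J Y.1) (adj_matrixHom_of_skew J X)) (x : ExteriorAlgebra K V)
    change spin (matrixHom J (X.1 * Y.1 - Y.1 * X.1)) _ = _
    rw [map_sub, map_mul, map_mul]
    exact h.symm

theorem coe_spinRep (X : Skew (doubleInvolution J.dagger)) (x : extInvariants τ) :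
    (spinRep J X x : ExteriorAlgebra K V) = spin (matrixHom J X.1) x := rfl

omit [FiniteDimensional K V] [CharZero K] in
theorem matrixHom_upper (s : J.dagger.sym) :
    matrixHom J (block J.dagger 0 s 0).1 = upperMap (s.1.1 ∘ₗ (J.toEquiv : _ →ₗ[K] V)) := by
  refine LinearMap.ext fun z => tilde_ext J ?_ ?_
  · change (0 : Module.End K V) (Tilde.fst K V z) + s.1.1 (J.toEquiv (Tilde.snd K V z)) =
      s.1.1 (J.toEquiv (Tilde.snd K V z))
    rw [LinearMap.zero_apply, zero_add]
  · change J.toEquiv (J.toEquiv.symm ((0 : Module.End K V) (Tilde.fst K V z) +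
      (-J.dagger.toLinearMap 0).1 (J.toEquiv (Tilde.snd K V z)))) = J.toEquiv 0
    rw [map_zero, neg_zero, LinearMap.zero_apply, zero_add]
    simp

omit [FiniteDimensional K V] [CharZero K] in
theorem matrixHom_one_block : matrixHom J (block J.dagger 1 0 0).1 = gradOp K V := by
  refine LinearMap.ext fun z => tilde_ext J ?_ ?_
  · change (1 : Module.End K V) (Tilde.fst K V z) + (0 : Module.End K V)
      (J.toEquiv (Tilde.snd K V z)) = Tilde.fst K V z
    rw [LinearMap.zero_apply, add_zero, Module.End.one_apply]
  · change J.toEquiv (J.toEquiv.symm ((0 : Module.End K V) (Tilde.fst K V z) +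
      (-J.dagger.toLinearMap 1).1 (J.toEquiv (Tilde.snd K V z)))) =
        J.toEquiv (-Tilde.snd K V z)
    rw [AlgInvolution.map_one, LinearMap.zero_apply, zero_add, LinearEquiv.apply_symm_apply,
      map_neg]
    rfl

/-- The bivector defined by a symmetric endomorphism. -/
def symBivector (s : J.dagger.sym) : ExteriorAlgebra K V :=
  toBivector (s.1.1 ∘ₗ (J.toEquiv : _ →ₗ[K] V))

theorem symBivector_mem (s : J.dagger.sym) : symBivector J s ∈ extInvariants τ := by
  intro g
  have h := map_spin τ g (matrixHom_comm J (block J.dagger 0 s 0).1 g) 1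
  rw [matrixHom_upper, spin_upperMap, _root_.map_one, spin_upperMap, mul_one] at h
  exact h

theorem spinRep_upper (s : J.dagger.sym) (x : extInvariants τ) :
    (spinRep J (block J.dagger 0 s 0) x : ExteriorAlgebra K V) = symBivector J s * x := by
  rw [coe_spinRep, matrixHom_upper, spin_upperMap]
  rfl

theorem bivectorMap_symBivector (s : J.dagger.sym) :
    bivectorMap (symBivector J s) = s.1.1 ∘ₗ (J.toEquiv : _ →ₗ[K] V) := by
  refine bivectorMap_toBivector fun η η' => ?_
  change η' (s.1.1 (J.toEquiv η)) = -η (s.1.1 (J.toEquiv η'))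
  rw [← J.comp_dagger, mem_sym.mp s.2, J.skew]
  rfl

/-- Take s to be `bivectorMap b` composed with J⁻¹; it is symmetric because both maps are skew. -/
theorem exists_sym_of_bivector {b : ExteriorAlgebra K V} (hb : b ∈ extInvariants τ)
    (hb2 : b ∈ extGrading K V 2) : ∃ s, symBivector J s = b := by
  let s : commutant τ := ⟨bivectorMap b ∘ₗ (J.toEquiv.symm : V →ₗ[K] _), by
    rw [mem_commutant]
    intro g v
    obtain ⟨η, rfl⟩ := J.toEquiv.surjective v
    rw [← J.equivariant]
    simp only [LinearMap.comp_apply, LinearEquiv.coe_coe, LinearEquiv.symm_apply_apply]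
    exact bivectorMap_equivariant hb hb2 g η⟩
  have hsJ : ∀ η, s.1 (J.toEquiv η) = bivectorMap b η := by
    intro η
    change bivectorMap b (J.toEquiv.symm (J.toEquiv η)) = _
    rw [LinearEquiv.symm_apply_apply]
  have hs : s ∈ J.dagger.sym := by
    rw [mem_sym]
    refine Subtype.ext (LinearMap.ext fun v => ?_)
    obtain ⟨η, rfl⟩ := J.toEquiv.surjective v
    rw [J.dagger_apply, hsJ, ← sub_eq_zero, ← Module.forall_dual_apply_eq_zero_iff K]
    intro η'
    rw [map_sub, J.skew, LinearMap.comp_apply, hsJ, bivectorMap_skew hb2 η', neg_neg, sub_self]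
  refine ⟨⟨s, hs⟩, ?_⟩
  have : s.1 ∘ₗ (J.toEquiv : _ →ₗ[K] V) = bivectorMap b := LinearMap.ext hsJ
  rw [symBivector, this, toBivector_bivectorMap hb2]

/-- Applying the operator to 1 recovers the bivector, which determines s. -/
theorem eq_zero_of_spinRep_upper (s : J.dagger.sym) (h : spinRep J (block J.dagger 0 s 0) = 0) :
    s = 0 := by
  have h1 := spinRep_upper J s 1
  rw [h] at h1
  have h2 : symBivector J s = 0 := by
    rw [← mul_one (symBivector J s)]
    exact h1.symm
  have h3 := bivectorMap_symBivector J s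
  rw [h2, map_zero] at h3
  refine Subtype.ext (Subtype.ext (LinearMap.ext fun v => ?_))
  obtain ⟨η, rfl⟩ := J.toEquiv.surjective v
  exact (LinearMap.congr_fun h3 η).symm

theorem mem_shift_iff {n : ℕ} (hn : Module.finrank K V = 2 * n) (k : ℤ) (x : extInvariants τ) :
    x ∈ shift (extInvariantsGrading τ) n k ↔
      spinRep J (block J.dagger 1 0 0) x = (k : K) • x := by
  rw [mem_shift_extInvariantsGrading, Subtype.ext_iff, coe_spinRep, matrixHom_one_block]
  exact ⟨spin_gradOp_of_mem_shift hn, mem_shift_of_spin_gradOp hn⟩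

theorem slTwoRelations_of_mul_eq_one {s t : J.dagger.sym} (hst : (s * t : commutant τ) = 1) :
    SlTwoRelations (spinRep J (block J.dagger 0 s 0)) (spinRep J (block J.dagger 1 0 0))
      (spinRep J (block J.dagger 0 0 t)) where
  lie_h_e := by
    rw [← LieHom.map_lie, lie_one_block, ← map_smul, block_smul, two_smul, two_smul, two_smul]
    simp
  lie_h_f := by
    rw [← LieHom.map_lie, lie_one_block, ← map_smul, ← map_neg, ← neg_smul, block_smul]
    simp [two_smul]
  lie_e_f := by rw [← LieHom.map_lie, lie_upper_lower, hst]

end Invariants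

/-! ### The LLV algebra as an image of the spin representation -/

section Comparison

open ExteriorAlgebra AlgInvolution

/-- Left multiplication by x has finitely many eigenvalues, and K is infinite. -/
theorem exists_add_smul_one_isUnit {K A : Type*} [Field K] [CharZero K] [Ring A] [Algebra K A]
    [FiniteDimensional K A] (x : A) :
    ∃ (c : K) (y : A), (x + c • 1) * y = 1 ∧ y * (x + c • 1) = 1 := by
  have : IsArtinianRing A := IsArtinianRing.of_finite K A
  obtain ⟨c, hc⟩ := (Module.End.finite_hasEigenvalue (LinearMap.mulLeft K x)).exists_notMem
  have hinj : Function.Injective (LinearMap.mulLeft K (x + (-c) • 1)) := by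
    rw [injective_iff_map_eq_zero]
    intro y hy
    by_contra hne
    refine hc (Module.End.hasEigenvalue_of_hasEigenvector
      (Module.End.hasEigenvector_iff.mpr ⟨Module.End.mem_eigenspace_iff.mpr ?_, hne⟩))
    rw [LinearMap.mulLeft_apply, add_mul, neg_smul, neg_mul, smul_mul_assoc, one_mul] at hy
    rw [LinearMap.mulLeft_apply]
    exact add_neg_eq_zero.mp hy
  obtain ⟨y, hy⟩ := LinearMap.surjective_of_injective hinj 1
  rw [LinearMap.mulLeft_apply] at hy
  exact ⟨-c, y, hy, mul_eq_one_comm.mp hy⟩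

theorem AlgInvolution.mem_sym_of_mul_eq_one {K A : Type*} [Field K] [Ring A] [Algebra K A]
    {σ : AlgInvolution K A} {s t : A} (hs : s ∈ σ.sym) (hst : s * t = 1) :
    t ∈ σ.sym := by
  rw [mem_sym] at hs ⊢
  have h := congrArg σ.toLinearMap hst
  rw [map_mul_rev, hs, AlgInvolution.map_one] at h
  exact left_inv_eq_right_inv h hst

variable {K G V : Type*} [Field K] [CharZero K] [Group G] [AddCommGroup V] [Module K V]
  [FiniteDimensional K V] {τ : Representation K G V} (J : SkewIso τ) {n : ℕ}

theorem symBivector_mem_grading (s : J.dagger.sym) :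
    (⟨symBivector J s, symBivector_mem J s⟩ : extInvariants τ) ∈ extInvariantsGrading τ 2 :=
  toBivector_mem _

theorem mulAction_eq_spinRep (b : extInvariantsGrading τ 2) (s : J.dagger.sym)
    (hs : symBivector J s = b.1.1) :
    mulAction (extInvariantsGrading τ) b = spinRep J (block J.dagger 0 s 0) := by
  refine LinearMap.ext fun x => Subtype.ext ?_
  rw [spinRep_upper, hs]
  rfl

omit [CharZero K] [FiniteDimensional K V] in
-- The unit 1 lies in degree -n of the shifted grading, where the n-th power of b acts injectively.
theorem pow_ne_zero_of_hardLefschetz {b : extInvariantsGrading τ 2}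
    (h : HardLefschetz (shift (extInvariantsGrading τ) n) (mulAction (extInvariantsGrading τ) b)) :
    (b.1.1 : ExteriorAlgebra K V) ^ n ≠ 0 := by
  intro h0
  have hb : (b.1 : extInvariants τ) ^ n = 0 := Subtype.ext h0
  have h1 : (1 : extInvariants τ) ∈ shift (extInvariantsGrading τ) n (-n) := by
    rw [mem_shift_extInvariantsGrading, shift, if_pos (by omega), add_neg_cancel]
    exact mem_extGrading_zero.mpr ⟨1, (one_smul _ _).symm⟩
  have hpow : ∀ x, (mulAction (extInvariantsGrading τ) b ^ n) x = b.1 ^ n * x := by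
    intro x
    change (LinearMap.mulLeft K b.1 ^ n) x = _
    rw [LinearMap.pow_mulLeft, LinearMap.mulLeft_apply]
  have h2 := (h.bijOn n).injOn h1 (Submodule.zero_mem _) (by rw [hpow, hpow, hb, zero_mul, zero_mul])
  exact one_ne_zero (congrArg Subtype.val h2)

/-- A nonzero top power makes the bivector nondegenerate, so s is injective and hence invertible in
the finite-dimensional commutant. Its inverse is symmetric again. -/
theorem exists_sym_unit_of_hardLefschetz (hdepth : HasDepth (extGrading K V) n)
    (b : extInvariantsGrading τ 2)
    (h : HardLefschetz (shift (extInvariantsGrading τ) n) (mulAction (extInvariantsGrading τ) b)) :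
    ∃ s t : J.dagger.sym, (s * t : commutant τ) = 1 ∧
      mulAction (extInvariantsGrading τ) b = spinRep J (block J.dagger 0 s 0) := by
  obtain ⟨s, hs⟩ := exists_sym_of_bivector J b.1.2 b.2
  have hinj := bivectorMap_injective (hdepth.1 _ (by omega)) b.2 (pow_ne_zero_of_hardLefschetz h)
  change Function.Injective (bivectorMap (b.1.1 : ExteriorAlgebra K V)) at hinj
  rw [← hs, bivectorMap_symBivector] at hinj
  have hsinj : Function.Injective (LinearMap.mulLeft K (s : commutant τ)) := by
    rw [injective_iff_map_eq_zero]
    intro y hy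
    refine Subtype.ext (LinearMap.ext fun v => ?_)
    obtain ⟨η, hη⟩ := J.toEquiv.surjective (y.1 v)
    have h0 : s.1.1 (y.1 v) = 0 := LinearMap.congr_fun (congrArg Subtype.val hy) v
    have h1 : η = 0 := by
      refine hinj ?_
      rw [map_zero]
      change s.1.1 (J.toEquiv η) = 0
      rw [hη, h0]
    rw [← hη, h1, map_zero]
    rfl
  obtain ⟨t, ht⟩ := LinearMap.surjective_of_injective hsinj 1
  rw [LinearMap.mulLeft_apply] at ht
  have : IsArtinianRing (commutant τ) := IsArtinianRing.of_finite K _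
  exact ⟨s, ⟨t, mem_sym_of_mul_eq_one s.2 ht⟩, ht,
    mulAction_eq_spinRep J b s hs⟩

/-- An invertible s gives an sl₂-triple whose h is the grading operator, so hard Lefschetz is
automatic. -/
theorem upper_lower_mem_llvAlgebra (hdepth : HasDepth (extGrading K V) n) {s t : J.dagger.sym}
    (hst : (s * t : commutant τ) = 1) :
    spinRep J (block J.dagger 0 s 0) ∈ llvAlgebra (extInvariantsGrading τ) n ∧
      spinRep J (block J.dagger 0 0 t) ∈ llvAlgebra (extInvariantsGrading τ) n := by
  have htriple := (slTwoRelations_of_mul_eq_one J hst).isLefschetzTriple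
    (mem_shift_iff J (finrank_eq_of_hasDepth hdepth))
  rw [← mulAction_eq_spinRep J ⟨⟨_, symBivector_mem J s⟩, symBivector_mem_grading J s⟩ s rfl]
    at htriple ⊢
  exact ⟨LieSubalgebra.subset_lieSpan ⟨_, _, _, htriple, Or.inl rfl⟩,
    LieSubalgebra.subset_lieSpan ⟨_, _, _, htriple, Or.inr (Or.inr rfl)⟩⟩

/-- The LLV algebra is generated by the images of the strictly triangular elements under the
spin representation. -/
theorem llvAlgebra_eq_map (hdepth : HasDepth (extGrading K V) n) :
    llvAlgebra (extInvariantsGrading τ) n = (triangularSpan J.dagger).map (spinRep J) := by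
  apply le_antisymm
  · refine LieSubalgebra.lieSpan_le.mpr ?_
    rintro x ⟨b, h, f, htriple, hx⟩
    obtain ⟨s, t, hst, hb⟩ := exists_sym_unit_of_hardLefschetz J hdepth b htriple.hardLefschetz
    have hrel := slTwoRelations_of_mul_eq_one J hst
    have hh : h = spinRep J (block J.dagger 1 0 0) :=
      htriple.grading.unique (iSup_shift_extInvariantsGrading τ n) fun k x hx =>
        (mem_shift_iff J (finrank_eq_of_hasDepth hdepth) k x).mp hx
    subst hh
    have hrel' := htriple.slTwoRelations
    rw [hb] at hrel' hx
    -- The operator f is determined by e and h, so it is the image of the strictly lower triangular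
    -- matrix of t.
    rw [hrel.f_unique hrel'] at hx
    have hone : block J.dagger 1 0 0 ∈ triangularSpan J.dagger := by
      rw [← hst, ← lie_upper_lower]
      exact (triangularSpan J.dagger).lie_mem (upper_mem s) (lower_mem t)
    rcases hx with rfl | rfl | rfl
    · exact ⟨_, upper_mem s, rfl⟩
    · exact ⟨_, hone, rfl⟩
    · exact ⟨_, lower_mem t, rfl⟩
  · have hle : triangularSpan J.dagger ≤
        (llvAlgebra (extInvariantsGrading τ) n).comap (spinRep J) := by
      refine LieSubalgebra.lieSpan_le.mpr ?_
      have hone : ((⟨1, one_mem_sym⟩ : J.dagger.sym) * (⟨1, one_mem_sym⟩ : J.dagger.sym) :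
          commutant τ) = 1 := one_mul 1
      have h1 := upper_lower_mem_llvAlgebra J hdepth hone
      -- Every symmetric element is an invertible symmetric element plus a multiple of 1.
      have key : ∀ s : J.dagger.sym, ∃ (c : K) (s' t : J.dagger.sym),
          s = s' + c • ⟨1, one_mem_sym⟩ ∧ (s' * t : commutant τ) = 1 ∧
            (t * s' : commutant τ) = 1 := by
        intro s
        obtain ⟨c, y, hy, hy'⟩ := exists_add_smul_one_isUnit (K := K) (s : commutant τ)
        have hs' : (s : commutant τ) + c • 1 ∈ J.dagger.sym :=
          add_mem s.2 (Submodule.smul_mem _ c one_mem_sym)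
        refine ⟨-c, ⟨_, hs'⟩, ⟨y, mem_sym_of_mul_eq_one hs' hy⟩, Subtype.ext ?_, hy, hy'⟩
        change (s : commutant τ) = s + c • 1 + (-c) • 1
        rw [neg_smul, add_neg_cancel_right]
      rintro _ ⟨s, rfl | rfl⟩
      · obtain ⟨c, s', t, rfl, hst, -⟩ := key s
        have : block J.dagger 0 (s' + c • ⟨1, one_mem_sym⟩) 0 =
            block J.dagger 0 s' 0 + c • block J.dagger 0 ⟨1, one_mem_sym⟩ 0 := by
          rw [block_smul, block_add, smul_zero, smul_zero, add_zero, add_zero]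
        change spinRep J _ ∈ llvAlgebra (extInvariantsGrading τ) n
        rw [this, map_add, map_smul]
        exact add_mem (upper_lower_mem_llvAlgebra J hdepth hst).1
          ((llvAlgebra (extInvariantsGrading τ) n).smul_mem c h1.1)
      · obtain ⟨c, s', t, rfl, -, hts⟩ := key s
        have : block J.dagger 0 0 (s' + c • ⟨1, one_mem_sym⟩) =
            block J.dagger 0 0 s' + c • block J.dagger 0 0 ⟨1, one_mem_sym⟩ := by
          rw [block_smul, block_add, smul_zero, smul_zero, add_zero, add_zero]
        change spinRep J _ ∈ llvAlgebra (extInvariantsGrading τ) n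
        rw [this, map_add, map_smul]
        exact add_mem (upper_lower_mem_llvAlgebra J hdepth hts).2
          ((llvAlgebra (extInvariantsGrading τ) n).smul_mem c h1.2)
    rintro _ ⟨X, hX, rfl⟩
    exact hle hX

theorem nonempty_llvAlgebra_equiv (hdepth : HasDepth (extGrading K V) n)
    (hC : ∀ x ∈ symCommutators J.dagger, (∀ s ∈ J.dagger.sym, x * s = s * x) → x = 0) :
    Nonempty (llvAlgebra (extInvariantsGrading τ) n ≃ₗ⁅K⁆ triangularSpan J.dagger) := by
  rw [llvAlgebra_eq_map J hdepth]
  exact nonempty_equiv_map_of_injOn _ _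
    (injOn_triangularSpan (spinRep J) (eq_zero_of_spinRep_upper J) hC)

end Comparison

/-! ### Transport of derived algebras -/

section Derived

open AlgInvolution

variable {K : Type*} [Field K]

theorem map_mem_derived {L L' : Type*} [LieRing L] [LieAlgebra K L] [LieRing L'] [LieAlgebra K L']
    (e : L →ₗ⁅K⁆ L') {x : L} (hx : x ∈ ⁅(⊤ : LieIdeal K L), (⊤ : LieIdeal K L)⁆) :
    e x ∈ ⁅(⊤ : LieIdeal K L'), (⊤ : LieIdeal K L')⁆ := by
  rw [← LieSubmodule.mem_toSubmodule, LieSubmodule.lieIdeal_oper_eq_linear_span'] at hx ⊢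
  induction hx using Submodule.span_induction with
  | zero => rw [map_zero]; exact Submodule.zero_mem _
  | add x y _ _ hx hy => rw [map_add]; exact Submodule.add_mem _ hx hy
  | smul c x _ hx => rw [map_smul]; exact Submodule.smul_mem _ c hx
  | mem x hx =>
    obtain ⟨y, -, z, -, rfl⟩ := hx
    rw [LieHom.map_lie]
    exact Submodule.subset_span ⟨_, LieSubmodule.mem_top _, _, LieSubmodule.mem_top _, rfl⟩

theorem nonempty_derived_equiv {L L' : Type*} [LieRing L] [LieAlgebra K L] [LieRing L']
    [LieAlgebra K L'] (e : L ≃ₗ⁅K⁆ L') :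
    Nonempty ((⁅(⊤ : LieIdeal K L), (⊤ : LieIdeal K L)⁆ : LieIdeal K L) ≃ₗ⁅K⁆
      (⁅(⊤ : LieIdeal K L'), (⊤ : LieIdeal K L')⁆ : LieIdeal K L')) :=
  ⟨{ toFun := fun x => ⟨e x.1, map_mem_derived e.toLieHom x.2⟩
     map_add' := fun x y => Subtype.ext (map_add e x.1 y.1)
     map_smul' := fun c x => Subtype.ext (map_smul e c x.1)
     map_lie' := fun {x y} => Subtype.ext (LieEquiv.map_lie e x.1 y.1)
     invFun := fun x => ⟨e.symm x.1, map_mem_derived e.symm.toLieHom x.2⟩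
     left_inv := fun x => Subtype.ext (e.symm_apply_apply x.1)
     right_inv := fun x => Subtype.ext (e.apply_symm_apply x.1) }⟩

theorem nonempty_equiv_of_mem_iff {L : Type*} [LieRing L] [LieAlgebra K L] (A : LieSubalgebra K L)
    (I : LieIdeal K L) (h : ∀ x, x ∈ A ↔ x ∈ I) : Nonempty (A ≃ₗ⁅K⁆ I) :=
  ⟨{ toFun := fun x => ⟨x.1, (h _).mp x.2⟩
     map_add' := fun _ _ => rfl
     map_smul' := fun _ _ => rfl
     map_lie' := fun {_ _} => rfl
     invFun := fun x => ⟨x.1, (h _).mpr x.2⟩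
     left_inv := fun _ => rfl
     right_inv := fun _ => rfl }⟩

/-- An isomorphism of algebras with involution induces an isomorphism of the skew elements. -/
def skewEquiv {A B : Type*} [Ring A] [Algebra K A] [Ring B] [Algebra K B] {σ : AlgInvolution K A}
    {σ' : AlgInvolution K B} (ψ : A ≃ₐ[K] B)
    (h : ∀ x, ψ (σ.toLinearMap x) = σ'.toLinearMap (ψ x)) : Skew σ ≃ₗ⁅K⁆ Skew σ' where
  toFun x := ⟨ψ x.1, by rw [mem_Skew, ← h, mem_Skew.mp x.2, map_neg]⟩
  map_add' x y := Subtype.ext (map_add ψ x.1 y.1)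
  map_smul' c x := Subtype.ext (map_smul ψ c x.1)
  map_lie' {x y} := Subtype.ext <| by
    change ψ (x.1 * y.1 - y.1 * x.1) = ψ x.1 * ψ y.1 - ψ y.1 * ψ x.1
    rw [map_sub, map_mul, map_mul]
  invFun y := ⟨ψ.symm y.1, by
    rw [mem_Skew]
    apply ψ.injective
    rw [h, map_neg, ψ.apply_symm_apply, mem_Skew.mp y.2]⟩
  left_inv x := Subtype.ext (ψ.symm_apply_apply x.1)
  right_inv y := Subtype.ext (ψ.apply_symm_apply y.1)

variable {E : Type*} [Ring E] [Algebra K E] {σ : AlgInvolution K E} {t : E →ₗ[K] K}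

/-- Commutators are trace-orthogonal to the centre, and the form is nondegenerate there. -/
theorem IsTraceForm.eq_zero_of_mem_symCommutators [CharZero K] [FiniteDimensional K E]
    (ht : IsTraceForm σ t) {x : E} (hx : x ∈ symCommutators σ) (hc : ∀ y, x * y = y * x) :
    x = 0 := by
  refine ht.eq_zero_of_center (Subalgebra.mem_center_iff.mpr fun y => (hc y).symm) ?_
  clear hc
  intro y hy
  induction hx using Submodule.span_induction with
  | zero => rw [zero_mul, map_zero]
  | add x z _ _ hx hz => rw [add_mul, map_add, hx, hz, add_zero]
  | smul c x _ hx => rw [smul_mul_assoc, map_smul, hx, smul_zero]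
  | mem x hx =>
    obtain ⟨s, -, u, -, rfl⟩ := hx
    rw [ht.apply_commutator, Subalgebra.mem_center_iff.mp hy u, sub_self, mul_zero, map_zero]

end Derived

/-! ### The two forms of the LLV algebra -/

section Cases

open AlgInvolution

variable {K G V W : Type*} [Field K] [CharZero K] [Group G] [Finite G] [AddCommGroup V] [Module K V]
  [FiniteDimensional K V] [AddCommGroup W] [Module K W] [FiniteDimensional K W]
  {τ : Representation K G V} {ρ : Representation K G W} (J : SkewIso τ) {m n : ℕ}

/-- The condition `hcent` serves twice: for the faithfulness of the spin representation on L, and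
for identifying L with the derived algebra. -/
theorem nonempty_llvAlgebra_equiv_derivedSkew (hτ : IsIsotypic τ ρ m)
    (hdepth : HasDepth (extGrading K V) n)
    (hcent : ∀ k ∈ Skew J.dagger, (∀ s ∈ J.dagger.sym, k * s = s * k) → ∀ x, k * x = x * k) :
    Nonempty (llvAlgebra (extInvariantsGrading τ) n ≃ₗ⁅K⁆ derivedSkew (tildeSigma τ ρ)) := by
  have ht := isTraceForm_commutantTrace J
  obtain ⟨e1⟩ := nonempty_llvAlgebra_equiv J hdepth fun x hx hxs =>
    ht.eq_zero_of_mem_symCommutators hx (hcent x (symCommutators_le_Skew hx) hxs)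
  obtain ⟨e2⟩ := nonempty_equiv_of_mem_iff _ _ (triangularSpan_eq_derivedSkew (σ := J.dagger)
    fun k hk l hl => ht.commutator_skew_mem hcent hk hl)
  obtain ⟨e3⟩ := nonempty_derived_equiv
    (skewEquiv (tildeEquiv J hτ) (tildeEquiv_involution J hτ))
  exact ⟨(e1.trans e2).trans e3⟩

omit [Finite G] in
theorem nonempty_llvAlgebra_equiv_sl2 (hdepth : HasDepth (extGrading K V) n) {F : Type*}
    [CommRing F] [Algebra K F] (ι : F →ₐ[K] commutant τ) (hι : Function.Injective ι)
    (hF : ∀ x, x ∈ J.dagger.sym ↔ ∃ c, ι c = x) :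
    Nonempty (llvAlgebra (extInvariantsGrading τ) n ≃ₗ⁅K⁆ sl2 K F) := by
  have hzero : symCommutators J.dagger = ⊥ := by
    rw [symCommutators, Submodule.span_eq_bot]
    rintro _ ⟨s, hs, t, ht, rfl⟩
    obtain ⟨c, rfl⟩ := (hF s).mp hs
    obtain ⟨d, rfl⟩ := (hF t).mp ht
    rw [← map_mul, ← map_mul, mul_comm, sub_self]
  obtain ⟨e1⟩ := nonempty_llvAlgebra_equiv J hdepth fun x hx _ => by
    rwa [hzero, Submodule.mem_bot] at hx
  obtain ⟨e2⟩ := nonempty_triangularSpan_equiv_sl2 ι hι hF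
  exact ⟨e1.trans e2⟩

end Cases

/-! ### Centres and change of base field -/

section Splitting

open AlgInvolution

variable {K E : Type*} [Field K] [Ring E] [Algebra K E]

/-- The centre of a finite-dimensional prime algebra is a field. -/
theorem isField_center [Nontrivial E] [FiniteDimensional K E]
    (hprime : ∀ x y : E, (∀ z, x * z * y = 0) → x = 0 ∨ y = 0) :
    IsField (Subalgebra.center K E) := by
  have hnzd : NoZeroDivisors (Subalgebra.center K E) := ⟨fun {x y} hxy => by
    have h0 : (x * y : E) = 0 := congrArg Subtype.val hxy
    have h1 := hprime x y fun z => by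
      rw [← Subalgebra.mem_center_iff.mp x.2 z, mul_assoc, h0, mul_zero]
    simpa only [ZeroMemClass.coe_eq_zero] using h1⟩
  have : IsDomain (Subalgebra.center K E) := NoZeroDivisors.to_isDomain _
  have : IsArtinianRing (Subalgebra.center K E) := IsArtinianRing.of_finite K _
  exact IsArtinianRing.isField_of_isDomain _

/-- The centre of `M₂(E)`. -/
def centerEquiv {B : Type*} [Ring B] [Algebra K B] (ψ : Matrix (Fin 2) (Fin 2) E ≃ₐ[K] B) :
    Subalgebra.center K E ≃ₐ[K] Subalgebra.center K B :=
  AlgEquiv.ofBijective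
    ((ψ.toAlgHom.comp ((Matrix.scalarAlgHom (Fin 2) K).comp (Subalgebra.center K E).val)).codRestrict
      (Subalgebra.center K B) fun r => by
        rw [Subalgebra.mem_center_iff]
        intro b
        obtain ⟨X, rfl⟩ := ψ.surjective b
        change ψ X * ψ (Matrix.scalar (Fin 2) (r : E)) = ψ (Matrix.scalar (Fin 2) (r : E)) * ψ X
        rw [← map_mul, ← map_mul]
        congr 1
        exact ((Matrix.scalar_commute _ (fun y => Subalgebra.mem_center_iff.mp r.2 y |>.symm) X)
          |>.symm).eq)
    ⟨fun r s h => by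
      have h1 : ψ (Matrix.scalar (Fin 2) (r : E)) = ψ (Matrix.scalar (Fin 2) (s : E)) :=
        congrArg Subtype.val h
      exact Subtype.ext (Matrix.scalar_inj.mp (ψ.injective h1)), fun z => by
      have hz : ψ.symm z ∈ Set.center (Matrix (Fin 2) (Fin 2) E) := by
        rw [Semigroup.mem_center_iff]
        intro X
        apply ψ.injective
        rw [map_mul, map_mul, ψ.apply_symm_apply]
        exact Subalgebra.mem_center_iff.mp z.2 (ψ X)
      rw [Matrix.center_eq_scalar_image] at hz
      obtain ⟨r, hr, hrz⟩ := hz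
      refine ⟨⟨r, hr⟩, Subtype.ext ?_⟩
      change ψ (Matrix.scalar (Fin 2) r) = z
      rw [hrz, ψ.apply_symm_apply]⟩

theorem coe_centerEquiv {B : Type*} [Ring B] [Algebra K B]
    (ψ : Matrix (Fin 2) (Fin 2) E ≃ₐ[K] B) (r : Subalgebra.center K E) :
    (centerEquiv ψ r : B) = ψ (Matrix.scalar (Fin 2) (r : E)) := rfl

/-- An involution that fixes a subfield of the centre, as an involution over this field. -/
def AlgInvolution.extendScalars {F : Type*} [Field F] [Algebra F E] (σ : AlgInvolution K E)
    (h : ∀ c : F, σ.toLinearMap (algebraMap F E c) = algebraMap F E c) : AlgInvolution F E where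
  toFun := σ.toLinearMap
  map_add' := map_add _
  map_smul' c x := by
    rw [Algebra.smul_def, map_mul_rev, h, RingHom.id_apply, Algebra.smul_def, Algebra.commutes]
  map_mul_rev' := σ.map_mul_rev
  apply_apply' := σ.apply_apply

variable {F B : Type*} [Field F] [CharZero F] [Ring B] [Algebra F B] {σ : AlgInvolution K E}

/-- Version of `exists_split_orthogonal` for a field F that only embeds in the centre of E. It is
meant for the centre of M₂(E); the F-algebra structure on E is installed locally. -/
theorem exists_split_of_sym_eq_range (e : F →+* E) (he : ∀ c x, e c * x = x * e c)
    (hσ : ∀ c, σ.toLinearMap (e c) = e c) (ψ : B ≃+* Matrix (Fin 2) (Fin 2) E)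
    (hψ : ∀ c, ψ (algebraMap F B c) = Matrix.scalar (Fin 2) (e c)) (L : Type*) [Field L]
    [Algebra F L] [IsAlgClosed L] (τ : B → B)
    (hτ : ∀ x, ψ (τ x) = (doubleInvolution σ).toLinearMap (ψ x))
    (hS : ∀ x ∈ σ.sym, ∃ c, x = e c)
    (hprime : ∀ x y : E, (∀ z, x * z * y = 0) → x = 0 ∨ y = 0)
    (hnc : ∃ x y : E, x * y ≠ y * x) :
    Module.finrank F B = 16 ∧
    ∃ (φ : (L ⊗[F] B) ≃ₐ[L] Matrix (Fin 4) (Fin 4) L) (S : Matrix (Fin 4) (Fin 4) L),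
      S.IsSymm ∧ IsUnit S.det ∧
      ∀ a : B, φ (1 ⊗ₜ τ a) = S⁻¹ * (φ (1 ⊗ₜ a)).transpose * S := by
  let _ : Algebra F E := RingHom.toAlgebra' e he
  exact exists_split_orthogonal (σ := σ.extendScalars (F := F) hσ) L
    (AlgEquiv.ofRingEquiv (f := ψ) hψ) τ hτ
    (fun x hx => by
      obtain ⟨c, hc⟩ := hS x hx
      exact ⟨c, by rw [hc, ← Algebra.algebraMap_eq_smul_one]; rfl⟩) hprime hnc

theorem sym_eq_range_of_split (e : F →+* E) (he : ∀ c x, e c * x = x * e c)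
    (hσ : ∀ c, σ.toLinearMap (e c) = e c) (ψ : B ≃+* Matrix (Fin 2) (Fin 2) E)
    (hψ : ∀ c, ψ (algebraMap F B c) = Matrix.scalar (Fin 2) (e c)) {L : Type*} [Field L]
    [Algebra F L] (τ : B → B) (hτ : ∀ x, ψ (τ x) = (doubleInvolution σ).toLinearMap (ψ x)) {d : ℕ}
    (φ : (L ⊗[F] B) ≃ₐ[L] Matrix (Fin d) (Fin d) L) {S : Matrix (Fin d) (Fin d) L}
    (hS : S.IsSymm) (hdet : IsUnit S.det)
    (h : ∀ a : B, φ (1 ⊗ₜ τ a) = S⁻¹ * (φ (1 ⊗ₜ a)).transpose * S)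
    (hdeg : Nat.sqrt (Module.finrank F B) = 4) {x : E} (hx : x ∈ σ.sym) : ∃ c, x = e c := by
  let _ : Algebra F E := RingHom.toAlgebra' e he
  let ψ' : B ≃ₐ[F] Matrix (Fin 2) (Fin 2) E := AlgEquiv.ofRingEquiv (f := ψ) hψ
  let σ' := σ.extendScalars (F := F) hσ
  let τ' : B →ₗ[F] B := ψ'.symm.toLinearMap ∘ₗ (doubleInvolution σ').toLinearMap ∘ₗ ψ'.toLinearMap
  have hττ : ∀ x, τ' x = τ x := fun x => by
    apply ψ'.injective
    change ψ' (ψ'.symm ((doubleInvolution σ').toLinearMap (ψ' x))) = ψ' (τ x)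
    rw [ψ'.apply_symm_apply]
    exact (hτ x).symm
  obtain ⟨c, hc⟩ := sym_scalar_of_orthogonal (σ := σ') ψ' τ'
    (fun x => by rw [hττ]; exact hτ x) φ hS hdet (fun a => by rw [hττ, h]) hdeg x hx
  exact ⟨c, by rw [hc, ← Algebra.algebraMap_eq_smul_one]; rfl⟩

end Splitting

/-! ### Orthogonality in degree four versus central symmetric elements -/

section Orthogonal

open AlgInvolution

variable {K E B : Type*} [Field K] [CharZero K] [Ring E] [Algebra K E] [FiniteDimensional K E]
  [Ring B] [Algebra K B] {σ : AlgInvolution K E} {σ' : AlgInvolution K B}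

omit [CharZero K] [FiniteDimensional K E] in
theorem doubleInvolution_scalar (x : E) :
    (doubleInvolution σ).toLinearMap (Matrix.scalar (Fin 2) x) =
      Matrix.scalar (Fin 2) (σ.toLinearMap x) := by
  rw [doubleInvolution_apply]
  ext i j
  fin_cases i <;> fin_cases j <;> simp

/-- If the symmetric elements are central, the algebra `M₂(E)` has degree `4` and its involution
is orthogonal. -/
theorem degree_eq_four_and_isOrthogonal (ψ : Matrix (Fin 2) (Fin 2) E ≃ₐ[K] B)
    (h : ∀ X, ψ ((doubleInvolution σ).toLinearMap X) = σ'.toLinearMap (ψ X))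
    (hprime : ∀ x y : E, (∀ z, x * z * y = 0) → x = 0 ∨ y = 0)
    (htriv : ∀ z ∈ Subalgebra.center K E, σ.toLinearMap z = z)
    (hS : ∀ x ∈ σ.sym, x ∈ Subalgebra.center K E) (hnc : ∃ x y : E, x * y ≠ y * x) :
    degree K B = 4 ∧ IsOrthogonal σ' := by
  have : Nontrivial E := by
    obtain ⟨x, y, hxy⟩ := hnc
    exact ⟨_, _, hxy⟩
  let c := centerEquiv ψ
  let e : Subalgebra.center K B →+* E :=
    (Subalgebra.center K E).val.toRingHom.comp c.symm.toAlgHom.toRingHom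
  let _ : Field (Subalgebra.center K B) :=
    (c.symm.toMulEquiv.isField (isField_center hprime)).toField
  have : CharZero (Subalgebra.center K B) := charZero_of_injective_algebraMap
    (algebraMap K (Subalgebra.center K B)).injective
  have hs : ∀ x, ψ.symm (σ'.toLinearMap x) = (doubleInvolution σ).toLinearMap (ψ.symm x) := by
    intro x
    apply ψ.injective
    rw [h, ψ.apply_symm_apply, ψ.apply_symm_apply]
  obtain ⟨hrank, φ, S, hS1, hS2, hφ⟩ := exists_split_of_sym_eq_range (σ := σ) e
    (fun z x => (Subalgebra.mem_center_iff.mp (c.symm z).2 x).symm)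
    (fun z => htriv _ (c.symm z).2) (ψ.symm : _ ≃+* _)
    (fun z => by
      apply ψ.injective
      change ψ (ψ.symm z.1) = (c (c.symm z)).1
      rw [ψ.apply_symm_apply, c.apply_symm_apply])
    (AlgebraicClosure (Subalgebra.center K B)) σ'.toLinearMap hs
    (fun x hx => ⟨c ⟨x, hS x hx⟩, by
      change x = (c.symm (c ⟨x, hS x hx⟩)).1
      rw [c.symm_apply_apply]⟩) hprime hnc
  refine ⟨?_, fun z hz => ?_, _, _, _, 4, φ, S, hS1, hS2, hφ⟩
  · rw [degree, hrank]
    norm_num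
  · have hz' : z = ψ (Matrix.scalar (Fin 2) ((c.symm ⟨z, hz⟩).1)) := by
      rw [← coe_centerEquiv]
      exact congrArg Subtype.val (c.apply_symm_apply ⟨z, hz⟩).symm
    rw [hz', ← h, doubleInvolution_scalar, htriv _ (c.symm ⟨z, hz⟩).2]

/-- The dimension count of `sym_scalar_of_orthogonal`, performed over the centre of B, which is a
field by primeness and is identified with the centre of E. -/
theorem mem_center_of_isOrthogonal [Nontrivial E] (ψ : Matrix (Fin 2) (Fin 2) E ≃ₐ[K] B)
    (h : ∀ X, ψ ((doubleInvolution σ).toLinearMap X) = σ'.toLinearMap (ψ X))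
    (hprime : ∀ x y : E, (∀ z, x * z * y = 0) → x = 0 ∨ y = 0)
    (htriv : ∀ z ∈ Subalgebra.center K E, σ.toLinearMap z = z)
    (hdeg : degree K B = 4) (horth : IsOrthogonal σ') {x : E} (hx : x ∈ σ.sym) :
    x ∈ Subalgebra.center K E := by
  let c := centerEquiv ψ
  let e : Subalgebra.center K B →+* E :=
    (Subalgebra.center K E).val.toRingHom.comp c.symm.toAlgHom.toRingHom
  let _ : Field (Subalgebra.center K B) :=
    (c.symm.toMulEquiv.isField (isField_center hprime)).toField
  have : CharZero (Subalgebra.center K B) := charZero_of_injective_algebraMap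
    (algebraMap K (Subalgebra.center K B)).injective
  have hs : ∀ x, ψ.symm (σ'.toLinearMap x) = (doubleInvolution σ).toLinearMap (ψ.symm x) := by
    intro x
    apply ψ.injective
    rw [h, ψ.apply_symm_apply, ψ.apply_symm_apply]
  obtain ⟨-, L, _, _, d, φ, S, hS1, hS2, hφ⟩ := horth
  obtain ⟨z, rfl⟩ := sym_eq_range_of_split (σ := σ) e
    (fun z x => (Subalgebra.mem_center_iff.mp (c.symm z).2 x).symm)
    (fun z => htriv _ (c.symm z).2) (ψ.symm : _ ≃+* _)
    (fun z => by
      apply ψ.injective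
      change ψ (ψ.symm z.1) = (c (c.symm z)).1
      rw [ψ.apply_symm_apply, c.apply_symm_apply])
    σ'.toLinearMap hs φ hS1 hS2 hφ hdeg hx
  exact (c.symm z).2

end Orthogonal

/-! ### The dichotomy and the main theorem -/

section Main

open AlgInvolution

variable {K G V W : Type*} [Field K] [CharZero K] [Group G] [Finite G] [AddCommGroup V] [Module K V]
  [FiniteDimensional K V] [AddCommGroup W] [Module K W] [FiniteDimensional K W]
  {τ : Representation K G V} {ρ : Representation K G W} {m : ℕ}

omit [CharZero K] [Finite G] in
/-- Either the centre of `End_G(V)` has a skew unit, or `End_G(V)` is a nontrivial prime algebra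
with an involution of the first kind. -/
theorem exists_unit_or_prime [ρ.IsIrreducible] (hτ : IsIsotypic τ ρ m) (J : SkewIso τ) :
    (∃ z ∈ Subalgebra.center K (commutant τ), ∃ w, z ∈ Skew J.dagger ∧ z * w = 1) ∨
    (Nontrivial (commutant τ) ∧ (∀ x y : commutant τ, (∀ z, x * z * y = 0) → x = 0 ∨ y = 0) ∧
      ∀ z ∈ Subalgebra.center K (commutant τ), J.dagger.toLinearMap z = z) := by
  by_cases hd : IsSelfDual ρ
  swap
  · obtain ⟨z, hz, hz', hzz⟩ := exists_unit_of_not_isSelfDual hτ hd J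
    exact Or.inl ⟨z, hz, z, hz', hzz⟩
  rcases subsingleton_or_nontrivial (commutant τ) with hsub | hnt
  -- In the zero ring 0 = 1 is a skew unit.
  · exact Or.inl ⟨0, zero_mem _, 0, zero_mem _, Subsingleton.elim _ _⟩
  obtain ⟨π, ι, hs⟩ := hτ.exists_coordinates hd
  have hprime := commutant_prime hs
  by_cases htriv : ∀ z ∈ Subalgebra.center K (commutant τ), J.dagger.toLinearMap z = z
  · exact Or.inr ⟨hnt, hprime, htriv⟩
  · push Not at htriv
    obtain ⟨z, hz, hne⟩ := htriv
    have hc : z - J.dagger.toLinearMap z ∈ Subalgebra.center K (commutant τ) :=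
      sub_mem hz (map_mem_center _ hz)
    -- If σ moves z, the skew element z - σ(z) is nonzero in the centre, which is a field.
    have h0 : (⟨_, hc⟩ : Subalgebra.center K (commutant τ)) ≠ 0 := fun h0 =>
      hne (sub_eq_zero.mp (congrArg Subtype.val h0)).symm
    obtain ⟨w, hw⟩ := (isField_center hprime).mul_inv_cancel h0
    exact Or.inl ⟨_, hc, w, sub_apply_mem_Skew z, congrArg Subtype.val hw⟩

/-- An orthogonal involution fixes the centre but sends the scalar matrix z to -z, so z = 0 and Ã is
the zero ring. A module over the zero ring has `finrank` 1 by convention, so the degree would be 1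
instead of 4. -/
theorem not_isOrthogonal_of_unit (hτ : IsIsotypic τ ρ m) (J : SkewIso τ)
    {z w : commutant τ} (hz : z ∈ Subalgebra.center K (commutant τ)) (hzs : z ∈ Skew J.dagger)
    (hzw : z * w = 1) :
    ¬ (degree K (tildeA τ ρ) = 4 ∧ IsOrthogonal (tildeSigma τ ρ)) := by
  rintro ⟨hdeg, horth, -⟩
  let c := centerEquiv (tildeEquiv J hτ)
  have h1 := horth (c ⟨z, hz⟩) (c ⟨z, hz⟩).2
  rw [coe_centerEquiv, ← tildeEquiv_involution, doubleInvolution_scalar] at h1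
  have h2 := Matrix.scalar_inj.mp ((tildeEquiv J hτ).injective h1)
  have h3 : z = 0 := eq_zero_of_mem_sym_of_mem_Skew (σ := J.dagger) h2 hzs
  have h4 : (1 : commutant τ) = 0 := by rw [← hzw, h3, zero_mul]
  have h5 : Subsingleton (commutant τ) := subsingleton_of_zero_eq_one h4.symm
  have h6 : Subsingleton (tildeA τ ρ) := (tildeEquiv J hτ).symm.toEquiv.subsingleton
  have h7 : Module.finrank (Subalgebra.center K (tildeA τ ρ)) (tildeA τ ρ) = 1 := by
    rw [Module.finrank, rank_subsingleton, Cardinal.one_toNat]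
  rw [degree, h7] at hdeg
  norm_num at hdeg

end Main

end LLV

end

theorem mainTheorem2
    {K : Type*} [Field K] [CharZero K] {G : Type*} [Group G] [Finite G]
    {V : Type*} [AddCommGroup V] [Module K V] [FiniteDimensional K V]
    {W : Type*} [AddCommGroup W] [Module K W] [FiniteDimensional K W]
    (τ : Representation K G V) (ρ : Representation K G W) (m n : ℕ)
    (hρ : ρ.IsIrreducible)
    (hτ : LLV.IsIsotypic τ ρ m)
    (hdepth : LLV.HasDepth (LLV.extGrading K V) n)
    (hdepthG : LLV.HasDepth (LLV.extInvariantsGrading τ) n)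
    (hLefschetz : ∃ a : LLV.extInvariants τ, a ∈ LLV.extInvariantsGrading τ 2 ∧
      LLV.HardLefschetz (LLV.shift (LLV.extGrading K V) n)
        (LinearMap.mulLeft K (a : ExteriorAlgebra K V)) ∧
      LLV.HardLefschetz (LLV.shift (LLV.extInvariantsGrading τ) n) (LinearMap.mulLeft K a)) :
    (¬ (LLV.degree K (LLV.tildeA τ ρ) = 4 ∧ LLV.IsOrthogonal (LLV.tildeSigma τ ρ)) →
      Nonempty (LLV.llvAlgebra (LLV.extInvariantsGrading τ) n ≃ₗ⁅K⁆
        LLV.derivedSkew (LLV.tildeSigma τ ρ))) ∧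
    (LLV.degree K (LLV.tildeA τ ρ) = 4 ∧ LLV.IsOrthogonal (LLV.tildeSigma τ ρ) →
      Nonempty (LLV.llvAlgebra (LLV.extInvariantsGrading τ) n ≃ₗ⁅K⁆
        LLV.sl2 K (Subalgebra.center K (LLV.tildeA τ ρ)))) := by
  obtain ⟨a, ha, -, haR⟩ := hLefschetz
  have hpow := LLV.pow_ne_zero_of_hardLefschetz (b := ⟨a, ha⟩) haR
  let J : LLV.SkewIso τ := LLV.SkewIso.ofBivector a.2 ha
    (LLV.bivectorMap_injective (hdepth.1 _ (by omega)) ha hpow)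
  rcases LLV.exists_unit_or_prime hτ J with ⟨z, hz, w, hzs, hzw⟩ | ⟨hnt, hprime, htriv⟩
  · refine ⟨fun _ => ?_, fun h => absurd h (LLV.not_isOrthogonal_of_unit hτ J hz hzs hzw)⟩
    exact LLV.nonempty_llvAlgebra_equiv_derivedSkew J hτ hdepth fun k _ hks =>
      LLV.skew_central_of_unit hz hzs hzw hks
  · refine ⟨fun h => ?_, fun h => ?_⟩
    · refine LLV.nonempty_llvAlgebra_equiv_derivedSkew J hτ hdepth fun k _ hks => ?_
      -- A noncentral skew k commuting with Sym would put the algebra in the excluded case.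
      by_contra! hcon
      obtain ⟨x, hx⟩ := hcon
      refine h (LLV.degree_eq_four_and_isOrthogonal (LLV.tildeEquiv J hτ)
        (LLV.tildeEquiv_involution J hτ) hprime htriv (fun s hs => ?_) ⟨k, x, hx⟩)
      exact Subalgebra.mem_center_iff.mpr fun y =>
        ((LLV.isTraceForm_commutantTrace J).sym_central_of_prime hprime hks hx hs y).symm
    · let c := LLV.centerEquiv (LLV.tildeEquiv J hτ)
      refine LLV.nonempty_llvAlgebra_equiv_sl2 J hdepth
        ((Subalgebra.center K (LLV.commutant τ)).val.comp c.symm.toAlgHom)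
        (Subtype.val_injective.comp c.symm.injective) fun x => ⟨fun hx => ?_, ?_⟩
      · have hxc := LLV.mem_center_of_isOrthogonal (LLV.tildeEquiv J hτ)
          (LLV.tildeEquiv_involution J hτ) hprime htriv h.1 h.2 hx
        exact ⟨c ⟨x, hxc⟩, congrArg Subtype.val (c.symm_apply_apply ⟨x, hxc⟩)⟩
      · rintro ⟨z, rfl⟩
        exact htriv _ (c.symm z).2
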